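/- **Setting.** Fix integers $g \ge 2$ and $n \ge 0$. A *graph* has finite sets of vertices $V$ and half-edges $H$, an involution $i$ of $H$ and a root map $r\colon H\to V$; fixed points of $i$ are *legs*, pairs $\{h,i(h)\}$ with $i(h)\ne h$ are *edges*. Let $\Gamma^{\mathcal H}_{g,n}$ be the following collection of objects $\mathbf P\to\mathbf C$. * $C$ is a stable tree (every vertex has at least three half-edges) with $2g+2+n$ legs, with an injective marking $m_C\colon\{1,\dots,n\}\to L(C)$ of $n$ of its legs. * $P\to C$ is a graph-theoretic admissible $\mathbb Z/2$-cover: a morphism of graphs, with a $\mathbb Z/2$-action on $P$ over $C$ and a monodromy marking $\mu\colon H(C)\to\mathbb Z/2$ such that $\mu(i(h))=-\mu(h)$ and $\sum_{h\in r^{-1}(v)}\mu(h)=0$ for every vertex $v$; the fibre over a vertex $v$ is isomorphic, as a $\mathbb Z/2$-set, to $(\mathbb Z/2)/\langle\mu(h):h\in r^{-1}(v)\rangle$, the fibre over a half-edge $h$ to $(\mathbb Z/2)/\langle\mu(h)\rangle$, and the vertices of $P$ carry the genera determined by the local Riemann–Hurwitz formula. Marked legs have $\mu=0$ and unmarked legs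 have $\mu=1$. * $m_P\colon\{1,\dots,n\}\to L(P)$ is a lift of $m_C$. * No vertex of $C$ with exactly three half-edges, exactly two of which are legs, supports either one marked and one unmarked leg, or two marked legs whose lifts lie on different vertices of $P$. Isomorphisms are pairs of graph isomorphisms of $P$ and of $C$ that are compatible with the map $P \to C$, the markings and $\mu$. Contracting an edge of $C$ together with its preimages in $P$ gives another such object. A vertex of $C$ has *weight* equal to its number of unmarked legs. Let $\Theta_{g,n}$ be the symmetric $\Delta$-complex (presheaf of sets on the category of finite sets and injections) whose $q$-simplices, $q\ge -1$, are the isomorphism classes of pairs $(\mathbf P\to\mathbf C,\omega)$ with $\omega\colon\{0,\dots,q\}\to E(C)$ a bijection; an injection $\iota$ acts by contracting the edges whose labels are not in the image of $\iota$ and relabelling the other edges through $\iota$. The augmented rational cellular chain complex of a symmetric $\Delta$-complex $X$ is, in degree $q\ge-1$, the $\mathbb Q$-vector space spanned by the $q$-simplices modulo $x=\operatorname{sgn}(\rho)\,\rho^*x$ for all permutations $\rho$ of $\{0,\dots,q\}$, with $\partial x=\sum_{j=0}^q(-1)^j(\delta^j)^*x$, where $\delta^j$ is the increasing injection that misses $j$.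 Its homology is the reduced rational homology of $X$. **Theorem.** Let $g\ge2$ and $n\ge0$. The following subcomplexes of $\Theta_{g,n}$ have vanishing reduced rational homology in every degree: 1. the repeated marking locus $\Theta^{\mathrm{rep}}_{g,n}$ of those $\mathbf P\to\mathbf C$ for which some vertex of $P$ supports at least two of the markings $1,\dots,n$; 2. the weight $3$ locus $\Theta^{\ge3}_{g,n}$ of those $\mathbf P\to\mathbf C$ for which some vertex of $C$ has weight at least $3$; 3. the intersection $\Theta^{\mathrm{rep}}_{g,n}\cap\Theta^{\ge3}_{g,n}$. Moreover, if $n\le1$, then the whole augmented rational cellular chain complex of $\Theta_{g,n}$ is acyclic. (For $n\le1$ the complexes in 1 and 3 have no simplices at all, not even in degree $-1$, and their augmented chain complex is zero.) -/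

import Mathlib

open CategoryTheory

/-- A finite graph with legs: a set `V` of vertices, a set `H` of half-edges, an involution `i` of
`H` (the "other half" map) and a root map `r : H → V`.  The fixed points of `i` are the legs. -/
structure HEGraph where
  V : Type
  H : Type
  [finV : Finite V]
  [finH : Finite H]
  i : H → H
  r : H → V
  i_i : ∀ h, i (i h) = h

attribute [instance] HEGraph.finV HEGraph.finH

namespace HEGraph

/-- The set of legs. -/
def legs (C : HEGraph) : Set C.H := {h | C.i h = h}

/-- The set of edges; an edge is a pair `{h, i h}` of distinct half-edges. -/
def edges (C : HEGraph) : Set (Set C.H) := {e | ∃ h, C.i h ≠ h ∧ e = {h, C.i h}}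

/-- The half-edges (including legs) rooted at a vertex. -/
def star (C : HEGraph) (v : C.V) : Set C.H := {h | C.r h = v}

/-- `v` and `w` are the two ends of an edge having a half-edge in `A`. -/
def Step (C : HEGraph) (A : Set C.H) (v w : C.V) : Prop :=
  ∃ h ∈ A, C.r h = v ∧ C.r (C.i h) = w

/-- `v` and `w` are joined by a path all of whose edges have a half-edge in `A`. -/
def Conn (C : HEGraph) (A : Set C.H) : C.V → C.V → Prop := Relation.EqvGen (C.Step A)

/-- A tree is a (nonempty) connected graph in which every edge is a bridge. -/
structure IsTree (C : HEGraph) : Prop where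
  nonempty : Nonempty C.V
  conn : ∀ v w, C.Conn Set.univ v w
  bridge : ∀ h, C.i h ≠ h → ¬ C.Conn {h, C.i h}ᶜ (C.r h) (C.r (C.i h))

/-- `F` is the set of half-edges of a set of edges. -/
def IsEdgeSet (C : HEGraph) (F : Set C.H) : Prop := ∀ h ∈ F, C.i h ∈ F ∧ C.i h ≠ h

/-- Contraction of the edges whose half-edges form the set `F`: these half-edges are deleted and
their roots are identified. -/
def contract (C : HEGraph) (F : Set C.H) (hF : C.IsEdgeSet F) : HEGraph where
  V := Quot (C.Step F)
  H := {h : C.H // h ∉ F}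
  finV := Quot.finite _
  i h := ⟨C.i h.1, fun hh => h.2 (by simpa [C.i_i] using (hF _ hh).1)⟩
  r h := Quot.mk _ (C.r h.1)
  i_i h := Subtype.ext (C.i_i h.1)

/-- An isomorphism of graphs. -/
structure Iso (C D : HEGraph) where
  eV : C.V ≃ D.V
  eH : C.H ≃ D.H
  map_i : ∀ h, eH (C.i h) = D.i (eH h)
  map_r : ∀ h, eV (C.r h) = D.r (eH h)

/-! ### Paths -/

theorem Conn.refl {C : HEGraph} {A : Set C.H} (v : C.V) : C.Conn A v v := Relation.EqvGen.refl v

theorem Conn.symm {C : HEGraph} {A : Set C.H} {v w : C.V} (h : C.Conn A v w) : C.Conn A w v :=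
  Relation.EqvGen.symm _ _ h

theorem Conn.trans {C : HEGraph} {A : Set C.H} {u v w : C.V} (h : C.Conn A u v)
    (h' : C.Conn A v w) : C.Conn A u w := Relation.EqvGen.trans _ _ _ h h'

theorem Conn.step {C : HEGraph} {A : Set C.H} {h : C.H} (hh : h ∈ A) :
    C.Conn A (C.r h) (C.r (C.i h)) := Relation.EqvGen.rel _ _ ⟨h, hh, rfl, rfl⟩

theorem Conn.induct {C : HEGraph} {A : Set C.H} {R : C.V → C.V → Prop} (hR : Equivalence R)
    (hs : ∀ h ∈ A, R (C.r h) (C.r (C.i h))) {v w : C.V} (h : C.Conn A v w) : R v w := by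
  induction h with
  | rel x y h => obtain ⟨a, ha, rfl, rfl⟩ := h; exact hs a ha
  | refl x => exact hR.refl x
  | symm x y _ ih => exact hR.symm ih
  | trans x y z _ _ h1 h2 => exact hR.trans h1 h2

theorem Conn.mono {C : HEGraph} {A B : Set C.H} (hAB : A ⊆ B) {v w : C.V} (h : C.Conn A v w) :
    C.Conn B v w :=
  h.induct (R := C.Conn B) ⟨Conn.refl, Conn.symm, Conn.trans⟩ (fun _ ha => Conn.step (hAB ha))

theorem mk_eq_iff {C : HEGraph} {F : Set C.H} {v w : C.V} :
    (Quot.mk (C.Step F) v = Quot.mk (C.Step F) w) ↔ C.Conn F v w :=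
  ⟨Quot.eqvGen_exact, Quot.eqvGen_sound⟩

/-- A set of vertices closed under the steps is a union of classes. -/
theorem Conn.mem_iff {C : HEGraph} {A : Set C.H} {Z : C.V → Prop}
    (hs : ∀ h ∈ A, (Z (C.r h) ↔ Z (C.r (C.i h)))) {v w : C.V} (h : C.Conn A v w) : Z v ↔ Z w :=
  h.induct (R := fun v w => Z v ↔ Z w) ⟨fun _ => Iff.rfl, Iff.symm, Iff.trans⟩ hs

theorem Conn.eq_of_forall {C : HEGraph} {F : Set C.H} (hF : C.IsEdgeSet F) {v w : C.V}
    (hv : ∀ h ∈ F, ¬ C.Conn F (C.r h) v) (h : C.Conn F v w) : w = v := by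
  refine (Conn.mem_iff (Z := fun x => x = v) ?_ h).1 rfl
  intro a ha
  constructor
  · intro h1; exact absurd (h1 ▸ Conn.refl _) (hv a ha)
  · intro h1; exact absurd (h1 ▸ Conn.refl _) (hv _ (hF a ha).1)

/-- The half-edges that remain at the vertex of the contraction which is the image of `v`. -/
def outer (C : HEGraph) (F : Set C.H) (v : C.V) : Set C.H := {h | h ∉ F ∧ C.Conn F (C.r h) v}

theorem image_star_contract {C : HEGraph} {F : Set C.H} (hF : C.IsEdgeSet F) (v : C.V) :
    Subtype.val '' ((C.contract F hF).star (Quot.mk _ v)) = C.outer F v := by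
  ext h
  constructor
  · rintro ⟨a, ha, rfl⟩
    exact ⟨a.2, mk_eq_iff.1 ha⟩
  · rintro ⟨h1, h2⟩
    exact ⟨⟨h, h1⟩, mk_eq_iff.2 h2, rfl⟩

theorem ncard_star_contract {C : HEGraph} {F : Set C.H} (hF : C.IsEdgeSet F) (v : C.V) :
    ((C.contract F hF).star (Quot.mk _ v)).ncard = (C.outer F v).ncard := by
  exact (Set.ncard_image_of_injective _ Subtype.val_injective).symm.trans
    (congrArg _ (image_star_contract hF v))

/-- Removing one edge from a nonempty edge set. -/
theorem IsEdgeSet.diff {C : HEGraph} {F : Set C.H} (hF : C.IsEdgeSet F) (h : C.H) :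
    C.IsEdgeSet (F \ {h, C.i h}) := by
  rintro a ⟨ha, hn⟩
  refine ⟨⟨(hF a ha).1, ?_⟩, (hF a ha).2⟩
  rintro (h1 | h1)
  · exact hn (Or.inr (by simp [← h1, C.i_i]))
  · exact hn (Or.inl (by rw [← C.i_i a, h1, C.i_i]))

theorem IsEdgeSet.rec_on {C : HEGraph} {p : Set C.H → Prop} (h0 : p ∅)
    (hs : ∀ F, C.IsEdgeSet F → ∀ h ∈ F, p (F \ {h, C.i h}) → p F) {F : Set C.H}
    (hF : C.IsEdgeSet F) : p F := by
  induction hn : F.ncard using Nat.strong_induction_on generalizing F with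
  | _ n ih =>
    rcases F.eq_empty_or_nonempty with rfl | ⟨h, hh⟩
    · exact h0
    · refine hs F hF h hh (ih _ ?_ (hF.diff h) rfl)
      rw [← hn]
      exact Set.ncard_lt_ncard ⟨Set.sdiff_subset, fun hc => (hc hh).2 (Or.inl rfl)⟩

theorem IsTree.not_conn {C : HEGraph} (hC : C.IsTree) {F : Set C.H} {h : C.H} (hh : C.i h ≠ h) :
    ¬ C.Conn (F \ {h, C.i h}) (C.r h) (C.r (C.i h)) := fun hc =>
  hC.bridge h hh (hc.mono fun _ ha => ha.2)

theorem outer_subset {C : HEGraph} {F : Set C.H} {h : C.H} {v w : C.V} (hvw : C.Conn F w v) :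
    C.outer (F \ {h, C.i h}) w \ {h, C.i h} ⊆ C.outer F v := by
  rintro a ⟨⟨h1, h2⟩, h3⟩
  exact ⟨fun ha => h1 ⟨ha, h3⟩, (h2.mono Set.sdiff_subset).trans hvw⟩

theorem four_le_outer {C : HEGraph} (hC : C.IsTree) {F : Set C.H} (hF : C.IsEdgeSet F)
    {h : C.H} (hh : h ∈ F) (h3 : ∀ v, 3 ≤ (C.outer (F \ {h, C.i h}) v).ncard) {v : C.V}
    (hv : C.Conn F (C.r h) v) : 4 ≤ (C.outer F v).ncard := by
  have hb := hC.not_conn (F := F) (hF h hh).2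
  have hA := h3 (C.r h)
  have hB := h3 (C.r (C.i h))
  have hA' := outer_subset (h := h) hv
  have hB' := outer_subset (h := h) ((Conn.step hh).symm.trans hv)
  have hAB : Disjoint (C.outer (F \ {h, C.i h}) (C.r h))
      (C.outer (F \ {h, C.i h}) (C.r (C.i h))) :=
    Set.disjoint_left.2 fun a ha hb' => hb (ha.2.symm.trans hb'.2)
  generalize C.outer (F \ {h, C.i h}) (C.r h) = A at *
  generalize C.outer (F \ {h, C.i h}) (C.r (C.i h)) = B at *
  have hsub : (A ∪ B) \ {h, C.i h} ⊆ C.outer F v := by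
    rw [Set.union_sdiff_distrib]
    exact Set.union_subset hA' hB'
  have h1 : (A ∪ B).ncard = A.ncard + B.ncard := Set.ncard_union_eq hAB
  have h2 := Set.ncard_le_ncard hsub
  have h4 := Set.le_ncard_sdiff {h, C.i h} (A ∪ B)
  have h5 : ({h, C.i h} : Set C.H).ncard ≤ 2 := Set.ncard_insert_le _ _ |>.trans (by simp)
  omega

theorem three_le_outer {C : HEGraph} (hC : C.IsTree) (hst : ∀ v, 3 ≤ (C.star v).ncard)
    {F : Set C.H} (hF : C.IsEdgeSet F) : ∀ v, 3 ≤ (C.outer F v).ncard := by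
  refine IsEdgeSet.rec_on (p := fun F => ∀ v, 3 ≤ (C.outer F v).ncard) ?_ ?_ hF
  · intro v
    refine (hst v).trans (Set.ncard_le_ncard fun a ha => ⟨fun h => h, ?_⟩)
    rw [show C.r a = v from ha]; exact Conn.refl _
  · intro F hF h hh ih v
    by_cases hv : C.Conn F (C.r h) v
    · exact (Nat.le_succ 3).trans (four_le_outer hC hF hh ih hv)
    · refine (ih v).trans (Set.ncard_le_ncard fun a ha => outer_subset (Conn.refl v) ⟨ha, ?_⟩)
      have ha2 := ha.2.mono (Set.sdiff_subset (s := F))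
      rintro (rfl | h1)
      · exact hv ha2
      · have h1 : a = C.i h := h1
        subst h1
        exact hv ((Conn.step hh).trans ha2)

/-- A contracted vertex of valence at most three is not the result of a proper contraction. -/
theorem eq_of_ncard_outer {C : HEGraph} (hC : C.IsTree) (hst : ∀ v, 3 ≤ (C.star v).ncard)
    {F : Set C.H} (hF : C.IsEdgeSet F) {v : C.V} (h3 : (C.outer F v).ncard = 3) {w : C.V}
    (h : C.Conn F v w) : w = v := by
  refine Conn.eq_of_forall hF (fun a ha hc => ?_) h
  have := four_le_outer hC hF ha (three_le_outer hC hst (hF.diff a)) hc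
  omega

theorem conn_contract {C : HEGraph} {F : Set C.H} (hF : C.IsEdgeSet F) {A : Set C.H} {v w : C.V}
    (h : C.Conn A v w) :
    (C.contract F hF).Conn (Subtype.val ⁻¹' A) (Quot.mk _ v) (Quot.mk _ w) := by
  refine h.induct (R := fun v w => (C.contract F hF).Conn (Subtype.val ⁻¹' A) (Quot.mk _ v)
    (Quot.mk _ w)) ⟨fun _ => Conn.refl _, Conn.symm, Conn.trans⟩ ?_
  intro a ha
  by_cases haF : a ∈ F
  · rw [mk_eq_iff.2 (Conn.step haF)]; exact Conn.refl _
  · exact Conn.step (C := C.contract F hF) (h := ⟨a, haF⟩) ha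

theorem conn_of_contract {C : HEGraph} {F : Set C.H} (hF : C.IsEdgeSet F) {A : Set C.H}
    {v w : C.V}
    (h : (C.contract F hF).Conn (Subtype.val ⁻¹' A) (Quot.mk _ v) (Quot.mk _ w)) :
    C.Conn (F ∪ A) v w := by
  let f : (C.contract F hF).V → Quot (C.Step (F ∪ A)) :=
    Quot.map id (fun a b ⟨x, hx, h⟩ => ⟨x, Or.inl hx, h⟩)
  have := h.induct (R := fun x y => f x = f y) ⟨fun _ => rfl, Eq.symm, Eq.trans⟩
    (fun a ha => mk_eq_iff.2 (Conn.step (C := C) (h := a.1) (Or.inr ha)))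
  exact mk_eq_iff.1 this

theorem IsTree.contract {C : HEGraph} (hC : C.IsTree) {F : Set C.H} (hF : C.IsEdgeSet F) :
    (C.contract F hF).IsTree where
  nonempty := hC.nonempty.map (Quot.mk _)
  conn := by
    rintro ⟨v⟩ ⟨w⟩
    exact conn_contract hF (hC.conn v w)
  bridge := by
    rintro ⟨h, hh⟩ hi hc
    have hi' : C.i h ≠ h := fun h' => hi (Subtype.ext h')
    refine hC.bridge h hi' ?_
    have := conn_of_contract hF (A := {h, C.i h}ᶜ) (v := C.r h) (w := C.r (C.i h))
      (hc.mono ?_)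
    · refine this.mono ?_
      rintro a (ha | ha)
      · rintro (rfl | h1)
        · exact hh ha
        · have h1 : a = C.i h := h1
          subst h1
          exact hh (by simpa [C.i_i] using (hF _ ha).1)
      · exact ha
    · rintro ⟨a, ha⟩ h1 h2
      apply h1
      rcases h2 with h2 | h2
      · exact Or.inl (Subtype.ext h2)
      · exact Or.inr (Subtype.ext h2)

/-! ### Isomorphisms -/

namespace Iso

def refl (C : HEGraph) : Iso C C := ⟨Equiv.refl _, Equiv.refl _, fun _ => rfl, fun _ => rfl⟩

def symm {C D : HEGraph} (e : Iso C D) : Iso D C where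
  eV := e.eV.symm
  eH := e.eH.symm
  map_i h := by rw [Equiv.symm_apply_eq, e.map_i, Equiv.apply_symm_apply]
  map_r h := by rw [Equiv.symm_apply_eq, e.map_r, Equiv.apply_symm_apply]

def trans {C D E : HEGraph} (e : Iso C D) (e' : Iso D E) : Iso C E where
  eV := e.eV.trans e'.eV
  eH := e.eH.trans e'.eH
  map_i h := by simp [e.map_i, e'.map_i]
  map_r h := by simp [e.map_r, e'.map_r]

/-- The isomorphism of contractions induced by an isomorphism. -/
def contract {C D : HEGraph} (e : Iso C D) {F : Set C.H} {F' : Set D.H} (hF : C.IsEdgeSet F)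
    (hF' : D.IsEdgeSet F') (hFF' : ∀ h, h ∈ F ↔ e.eH h ∈ F') :
    Iso (C.contract F hF) (D.contract F' hF') where
  eV := Quot.congr e.eV (by
    intro a b
    constructor
    · rintro ⟨h, hh, rfl, rfl⟩
      exact ⟨e.eH h, (hFF' h).1 hh, (e.map_r h).symm, by rw [← e.map_i, e.map_r]⟩
    · rintro ⟨h, hh, h1, h2⟩
      obtain ⟨h, rfl⟩ := e.eH.surjective h
      refine ⟨h, (hFF' h).2 hh, e.eV.injective ?_, e.eV.injective ?_⟩
      · rw [e.map_r, h1]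
      · rw [e.map_r, e.map_i, h2])
  eH := e.eH.subtypeEquiv (fun h => not_congr (hFF' h))
  map_i h := Subtype.ext (e.map_i h.1)
  map_r h := congrArg (Quot.mk _) (e.map_r h.1)

/-- Contracting no edge changes nothing. -/
def contractEmpty (C : HEGraph) {F : Set C.H} (hF : C.IsEdgeSet F) (h0 : ∀ h, h ∉ F) :
    Iso (C.contract F hF) C where
  eV :=
    { toFun := Quot.lift id (fun _ _ ⟨h, hh, _⟩ => absurd hh (h0 h))
      invFun := Quot.mk _
      left_inv := by rintro ⟨v⟩; rfl
      right_inv _ := rfl }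
  eH := Equiv.subtypeUnivEquiv h0
  map_i _ := rfl
  map_r _ := rfl

/-- Contracting in two steps is the same as contracting at once. -/
def contractContract (C : HEGraph) {F₁ F : Set C.H} (hF₁ : C.IsEdgeSet F₁) (hF : C.IsEdgeSet F)
    {F₂ : Set (C.contract F₁ hF₁).H} (hF₂ : (C.contract F₁ hF₁).IsEdgeSet F₂)
    (h12 : ∀ h, h ∈ F ↔ h ∈ F₁ ∨ ∃ hh : h ∉ F₁, (⟨h, hh⟩ : (C.contract F₁ hF₁).H) ∈ F₂) :
    Iso (C.contract F hF) ((C.contract F₁ hF₁).contract F₂ hF₂) where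
  eV :=
    { toFun := Quot.lift (fun v => Quot.mk _ (Quot.mk _ v)) (by
        rintro a b ⟨h, hh, rfl, rfl⟩
        rcases (h12 h).1 hh with h1 | ⟨h1, h2⟩
        · exact congrArg _ (Quot.sound ⟨h, h1, rfl, rfl⟩)
        · exact Quot.sound ⟨⟨h, h1⟩, h2, rfl, rfl⟩)
      invFun := Quot.lift (Quot.lift (fun v => Quot.mk _ v) (by
        rintro a b ⟨h, hh, rfl, rfl⟩
        exact Quot.sound ⟨h, (h12 h).2 (Or.inl hh), rfl, rfl⟩)) (by
        rintro a b ⟨h, hh, rfl, rfl⟩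
        exact Quot.sound ⟨h.1, (h12 h.1).2 (Or.inr ⟨h.2, hh⟩), rfl, rfl⟩)
      left_inv := by rintro ⟨v⟩; rfl
      right_inv := by rintro ⟨⟨v⟩⟩; rfl }
  eH :=
    { toFun := fun h => ⟨⟨h.1, fun hh => h.2 ((h12 h.1).2 (Or.inl hh))⟩,
        fun hh => h.2 ((h12 h.1).2 (Or.inr ⟨_, hh⟩))⟩
      invFun := fun h => ⟨h.1.1, fun hh => by
        rcases (h12 h.1.1).1 hh with h1 | ⟨h1, h2⟩
        · exact h.1.2 h1
        · exact h.2 h2⟩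
      left_inv _ := rfl
      right_inv _ := rfl }
  map_i _ := rfl
  map_r _ := rfl

end Iso

end HEGraph

/-- A graph-theoretic admissible `ℤ/2`-cover `P → C` of a stable tree `C` (without markings).
The action of `ℤ/2` on `P` is given by the involutions `σV`, `σH` (the action of `1`).
The orbits are exactly the fibres, so `C = P/(ℤ/2)`, and the fibre over a vertex `v`
(over a half-edge `h`) is isomorphic to the `ℤ/2`-set `(ℤ/2)/⟨μ(h) : h ∈ r⁻¹(v)⟩`
(to `(ℤ/2)/⟨μ(h)⟩`): it is one point if the subgroup is `ℤ/2`, that is, if it contains a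
generator with `μ = 1`, and it is two points swapped by the involution otherwise. -/
structure AdmissibleCover where
  C : HEGraph
  P : HEGraph
  /-- the target is a stable tree -/
  tree : C.IsTree
  stable : ∀ v, 3 ≤ (C.star v).ncard
  /-- the morphism of graphs `P → C` -/
  fV : P.V → C.V
  fH : P.H → C.H
  f_i : ∀ h, fH (P.i h) = C.i (fH h)
  f_r : ∀ h, fV (P.r h) = C.r (fH h)
  /-- the action of `ℤ/2` on `P` by graph automorphisms over `C` -/
  σV : P.V → P.V
  σH : P.H → P.H
  σV_σV : ∀ x, σV (σV x) = x
  σH_σH : ∀ h, σH (σH h) = h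
  σ_i : ∀ h, σH (P.i h) = P.i (σH h)
  σ_r : ∀ h, σV (P.r h) = P.r (σH h)
  f_σV : ∀ x, fV (σV x) = fV x
  f_σH : ∀ h, fH (σH h) = fH h
  /-- the monodromy marking -/
  μ : C.H → ZMod 2
  μ_i : ∀ h, μ (C.i h) = - μ h
  μ_sum : ∀ v, ∑ᶠ h ∈ C.star v, μ h = 0
  /-- the fibres over vertices -/
  fV_surjective : Function.Surjective fV
  fV_fibre : ∀ x y, fV x = fV y → y = x ∨ y = σV x
  σV_eq_iff : ∀ x, σV x = x ↔ ∃ h ∈ C.star (fV x), μ h = 1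
  /-- the fibres over half-edges -/
  fH_surjective : Function.Surjective fH
  fH_fibre : ∀ h k, fH h = fH k → k = h ∨ k = σH h
  σH_eq_iff : ∀ h, σH h = h ↔ μ (fH h) = 1
  /-- the genera of the vertices of the source, and the local Riemann-Hurwitz formula -/
  genus : P.V → ℕ
  riemann_hurwitz : ∀ x, (2 : ℚ) - 2 * genus x =
    Nat.card (AddSubgroup.closure (μ '' C.star (fV x))) *
      (2 - ∑ᶠ h ∈ C.star (fV x), ((Nat.card (AddSubgroup.zmultiples (μ h)) : ℚ) - 1) /
        Nat.card (AddSubgroup.zmultiples (μ h)))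

theorem zmod_two_cases (a : ZMod 2) : a = 0 ∨ a = 1 := by
  revert a; decide

open Classical in
theorem finsum_mem_eq_filter {H M : Type*} [Fintype H] [AddCommMonoid M] (A : Set H) (f : H → M) :
    ∑ᶠ h ∈ A, f h = ∑ h with h ∈ A, f h := by
  rw [finsum_mem_eq_toFinset_sum]
  congr 1
  ext; simp

/-- The local Riemann-Hurwitz formula can always be solved. -/
theorem exists_genus {H : Type} [Finite H] (A : Set H) (μ : H → ZMod 2)
    (hs : ∑ᶠ h ∈ A, μ h = 0) : ∃ g : ℕ, (2 : ℚ) - 2 * g =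
      Nat.card (AddSubgroup.closure (μ '' A)) *
        (2 - ∑ᶠ h ∈ A, ((Nat.card (AddSubgroup.zmultiples (μ h)) : ℚ) - 1) /
          Nat.card (AddSubgroup.zmultiples (μ h))) := by
  classical
  have := Fintype.ofFinite H
  rw [finsum_mem_eq_filter] at hs ⊢
  have hz : ∀ h, ((Nat.card (AddSubgroup.zmultiples (μ h)) : ℚ) - 1) /
      Nat.card (AddSubgroup.zmultiples (μ h)) = if μ h = 1 then 1 / 2 else 0 := by
    intro h
    rcases zmod_two_cases (μ h) with h0 | h0
    · rw [Nat.card_zmultiples, h0]; simp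
    · rw [Nat.card_zmultiples, h0, ZMod.addOrderOf_one]; norm_num
  have hz' : ∀ h, μ h = if μ h = 1 then 1 else 0 := by
    intro h
    rcases zmod_two_cases (μ h) with h0 | h0 <;> simp [h0]
  rw [Finset.sum_congr rfl (fun h _ => hz h), Finset.sum_ite, Finset.sum_const_zero, add_zero,
    Finset.sum_const, nsmul_eq_mul]
  rw [Finset.sum_congr rfl (fun h _ => hz' h), Finset.sum_ite, Finset.sum_const_zero, add_zero,
    Finset.sum_const, nsmul_eq_mul, mul_one, ZMod.natCast_eq_zero_iff] at hs
  set S := Finset.filter (fun h => μ h = 1) (Finset.filter (fun h => h ∈ A) Finset.univ) with hS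
  obtain ⟨m, hm⟩ := hs
  rw [hm]
  rcases Nat.eq_zero_or_pos m with rfl | hm0
  · have hcl : AddSubgroup.closure (μ '' A) = ⊥ := by
      rw [AddSubgroup.closure_eq_bot_iff]
      rintro _ ⟨h, hA, rfl⟩
      rcases zmod_two_cases (μ h) with h0 | h0
      · exact h0
      · have : h ∈ S := by simp [hS, hA, h0]
        have hS0 : S = ∅ := Finset.card_eq_zero.1 (by simpa using hm)
        rw [hS0] at this
        simp at this
    refine ⟨0, ?_⟩
    rw [hcl]; simp
  · have hcl : AddSubgroup.closure (μ '' A) = ⊤ := by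
      have hpos : 0 < S.card := by omega
      obtain ⟨h, hh⟩ := Finset.card_pos.1 hpos
      simp only [hS, Finset.mem_filter, Finset.mem_univ, true_and] at hh
      have h1 : (1 : ZMod 2) ∈ AddSubgroup.closure (μ '' A) :=
        AddSubgroup.subset_closure ⟨h, hh.1, hh.2⟩
      rw [eq_top_iff]
      intro a _
      rcases zmod_two_cases a with rfl | rfl
      · exact zero_mem _
      · exact h1
    refine ⟨m - 1, ?_⟩
    rw [hcl, AddSubgroup.card_top, Nat.card_zmod, Nat.cast_sub hm0]
    push_cast
    ring

namespace AdmissibleCover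

theorem isEdgeSet_preimage (X : AdmissibleCover) {F : Set X.C.H} (hF : X.C.IsEdgeSet F) :
    X.P.IsEdgeSet (X.fH ⁻¹' F) := by
  intro h hh
  refine ⟨?_, fun h' => (hF _ hh).2 ?_⟩
  · rw [Set.mem_preimage, X.f_i]; exact (hF _ hh).1
  · rw [← X.f_i, h']

theorem exists_lift_half (X : AdmissibleCover) {x : X.P.V} {h : X.C.H} (hx : X.fV x = X.C.r h) :
    ∃ k, X.fH k = h ∧ X.P.r k = x := by
  obtain ⟨k, rfl⟩ := X.fH_surjective h
  rw [← X.f_r] at hx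
  rcases X.fV_fibre _ _ hx with h1 | h1
  · exact ⟨k, rfl, h1⟩
  · refine ⟨X.σH k, X.f_σH k, ?_⟩
    rw [← X.σ_r, h1, X.σV_σV]

theorem conn_proj (X : AdmissibleCover) {F : Set X.C.H} {x y : X.P.V}
    (h : X.P.Conn (X.fH ⁻¹' F) x y) : X.C.Conn F (X.fV x) (X.fV y) := by
  refine h.induct (R := fun x y => X.C.Conn F (X.fV x) (X.fV y))
    ⟨fun _ => HEGraph.Conn.refl _, HEGraph.Conn.symm, HEGraph.Conn.trans⟩ ?_
  intro a ha
  rw [X.f_r, X.f_r, X.f_i]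
  exact HEGraph.Conn.step ha

theorem conn_σ (X : AdmissibleCover) {F : Set X.C.H} {x y : X.P.V}
    (h : X.P.Conn (X.fH ⁻¹' F) x y) : X.P.Conn (X.fH ⁻¹' F) (X.σV x) (X.σV y) := by
  refine h.induct (R := fun x y => X.P.Conn (X.fH ⁻¹' F) (X.σV x) (X.σV y))
    ⟨fun _ => HEGraph.Conn.refl _, HEGraph.Conn.symm, HEGraph.Conn.trans⟩ ?_
  intro a ha
  rw [X.σ_r, X.σ_r, X.σ_i]
  refine HEGraph.Conn.step ?_
  rw [Set.mem_preimage, X.f_σH]; exact ha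

theorem conn_lift (X : AdmissibleCover) {F : Set X.C.H} (hF : X.C.IsEdgeSet F) {x : X.P.V}
    {w : X.C.V} (h : X.C.Conn F (X.fV x) w) :
    ∃ y, X.fV y = w ∧ X.P.Conn (X.fH ⁻¹' F) x y := by
  have key : ∀ h ∈ F, ∀ x, X.fV x = X.C.r h →
      ∃ y, X.fV y = X.C.r (X.C.i h) ∧ X.P.Conn (X.fH ⁻¹' F) x y := by
    intro h hh x hx
    obtain ⟨k, rfl, rfl⟩ := X.exists_lift_half hx
    exact ⟨X.P.r (X.P.i k), by rw [X.f_r, X.f_i], HEGraph.Conn.step hh⟩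
  refine (h.induct (R := fun v w =>
    (∀ x, X.fV x = v → ∃ y, X.fV y = w ∧ X.P.Conn (X.fH ⁻¹' F) x y) ∧
    (∀ x, X.fV x = w → ∃ y, X.fV y = v ∧ X.P.Conn (X.fH ⁻¹' F) x y)) ⟨?_, ?_, ?_⟩ ?_).1 x rfl
  · exact fun v => ⟨fun x hx => ⟨x, hx, HEGraph.Conn.refl _⟩,
      fun x hx => ⟨x, hx, HEGraph.Conn.refl _⟩⟩
  · exact fun h => ⟨h.2, h.1⟩
  · intro u v w h1 h2
    constructor
    · intro x hx
      obtain ⟨y, hy, hxy⟩ := h1.1 x hx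
      obtain ⟨z, hz, hyz⟩ := h2.1 y hy
      exact ⟨z, hz, hxy.trans hyz⟩
    · intro x hx
      obtain ⟨y, hy, hxy⟩ := h2.2 x hx
      obtain ⟨z, hz, hyz⟩ := h1.2 y hy
      exact ⟨z, hz, hxy.trans hyz⟩
  · intro h hh
    refine ⟨key h hh, ?_⟩
    have := key (X.C.i h) (hF h hh).1
    rwa [X.C.i_i] at this

/-- The monodromies at a vertex of a contraction have sum zero. -/
theorem sum_outer (X : AdmissibleCover) {F : Set X.C.H} (hF : X.C.IsEdgeSet F) (v : X.C.V) :
    ∑ᶠ h ∈ X.C.outer F v, X.μ h = 0 := by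
  classical
  have := Fintype.ofFinite X.C.H
  have := Fintype.ofFinite X.C.V
  rw [finsum_mem_eq_filter]
  have h1 : ∑ h with X.C.Conn F (X.C.r h) v, X.μ h = 0 := by
    rw [← Finset.sum_fiberwise_of_maps_to (g := X.C.r)
      (t := Finset.univ.filter fun w => X.C.Conn F w v) (by intro h hh; simpa using hh)]
    refine Finset.sum_eq_zero fun w hw => ?_
    have := X.μ_sum w
    rw [finsum_mem_eq_filter] at this
    rw [← this]
    refine Finset.sum_congr ?_ fun _ _ => rfl
    ext h
    simp only [Finset.mem_filter, Finset.mem_univ, true_and] at hw ⊢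
    constructor
    · exact fun h => h.2
    · intro h2
      have h2 : X.C.r h = w := h2
      exact ⟨h2 ▸ hw, h2⟩
  have h2 : ∑ h with (X.C.Conn F (X.C.r h) v ∧ h ∈ F), X.μ h = 0 := by
    refine Finset.sum_involution (fun h _ => X.C.i h) ?_ ?_ ?_ ?_
    · intro h _
      change X.μ h + X.μ (X.C.i h) = 0
      rw [X.μ_i, add_neg_cancel]
    · intro h hh _
      simp only [Finset.mem_filter, Finset.mem_univ, true_and] at hh
      exact (hF h hh.2).2
    · intro h hh
      simp only [Finset.mem_filter, Finset.mem_univ, true_and] at hh ⊢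
      exact ⟨(HEGraph.Conn.step hh.2).symm.trans hh.1, (hF h hh.2).1⟩
    · intro h _; exact X.C.i_i h
  rw [← Finset.sum_filter_add_sum_filter_not _ (fun h => h ∈ F), Finset.filter_filter,
    Finset.filter_filter, h2, zero_add] at h1
  rw [← h1]
  refine Finset.sum_congr ?_ fun _ _ => rfl
  ext h
  simp only [Finset.mem_filter, Finset.mem_univ, true_and]
  exact and_comm

theorem exists_odd_outer (X : AdmissibleCover) {F : Set X.C.H} (hF : X.C.IsEdgeSet F)
    {h : X.C.H} (hμ : X.μ h = 1) {v : X.C.V} (hv : X.C.Conn F (X.C.r h) v) :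
    ∃ k ∈ X.C.outer F v, X.μ k = 1 := by
  classical
  by_cases hh : h ∈ F
  swap
  · exact ⟨h, ⟨hh, hv⟩, hμ⟩
  by_contra! hno
  have hs := X.sum_outer (hF.diff h) (X.C.r h)
  have := Fintype.ofFinite X.C.H
  rw [finsum_mem_eq_filter, Finset.sum_eq_single h, hμ] at hs
  · exact one_ne_zero hs
  · intro k hk hkh
    simp only [Finset.mem_filter, Finset.mem_univ, true_and] at hk
    rcases zmod_two_cases (X.μ k) with h0 | h0
    · exact h0
    · refine absurd h0 (hno k (HEGraph.outer_subset hv ⟨hk, ?_⟩))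
      rintro (h1 | h1)
      · exact hkh h1
      · have h1 : k = X.C.i h := h1
        subst h1
        exact X.tree.not_conn (hF h hh).2 hk.2.symm
  · intro hn
    refine absurd ?_ hn
    simp only [Finset.mem_filter, Finset.mem_univ, true_and]
    exact ⟨fun h' => h'.2 (Or.inl rfl), HEGraph.Conn.refl _⟩

theorem exists_odd_of_conn (X : AdmissibleCover) {F : Set X.C.H} (hF : X.C.IsEdgeSet F) :
    ∀ x, X.P.Conn (X.fH ⁻¹' F) x (X.σV x) → ∃ h, X.C.Conn F (X.C.r h) (X.fV x) ∧ X.μ h = 1 := by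
  refine HEGraph.IsEdgeSet.rec_on (p := fun F => ∀ x, X.P.Conn (X.fH ⁻¹' F) x (X.σV x) →
    ∃ h, X.C.Conn F (X.C.r h) (X.fV x) ∧ X.μ h = 1) ?_ ?_ hF
  · intro x hx
    have : X.σV x = x := HEGraph.Conn.eq_of_forall (F := X.fH ⁻¹' ∅) (fun h hh => hh.elim)
      (fun h hh => hh.elim) hx
    obtain ⟨h, hh, hμ⟩ := (X.σV_eq_iff x).1 this
    refine ⟨h, ?_, hμ⟩
    rw [show X.C.r h = X.fV x from hh]; exact HEGraph.Conn.refl _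
  · intro F' hF' e he ih x hx
    by_contra! hno
    have hb := X.tree.not_conn (F := F') (hF' e he).2
    have hmono : F' \ {e, X.C.i e} ⊆ F' := Set.sdiff_subset
    have hmem : ∀ a ∈ F', a ∈ F' \ {e, X.C.i e} ∨ a = e ∨ a = X.C.i e := by
      intro a ha
      by_cases h1 : a = e ∨ a = X.C.i e
      · exact Or.inr h1
      · exact Or.inl ⟨ha, h1⟩
    generalize F' \ {e, X.C.i e} = F at ih hb hmono hmem
    -- a union of classes for the smaller set that treats both ends of every lift of `e` alike
    have key : ∀ Z : X.P.V → Prop,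
        (∀ y z, X.P.Conn (X.fH ⁻¹' F) y z → (Z y ↔ Z z)) →
        (∀ k, X.fH k = e → (Z (X.P.r k) ↔ Z (X.P.r (X.P.i k)))) →
        ∀ y z, X.P.Conn (X.fH ⁻¹' F') y z → (Z y ↔ Z z) := by
      intro Z h1 h2 y z hyz
      refine HEGraph.Conn.mem_iff ?_ hyz
      intro k hk
      rcases hmem _ hk with h3 | h3 | h3
      · exact h1 _ _ (HEGraph.Conn.step h3)
      · exact h2 k h3
      · have := h2 (X.P.i k) (by rw [X.f_i, h3, X.C.i_i])
        rw [X.P.i_i] at this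
        exact this.symm
    by_cases hxe : X.C.Conn F' (X.fV x) (X.C.r e)
    · obtain ⟨y, hy, hxy⟩ := X.conn_lift hF' hxe
      obtain ⟨k, hk, rfl⟩ := X.exists_lift_half hy
      have hyσ : X.P.Conn (X.fH ⁻¹' F') (X.P.r k) (X.σV (X.P.r k)) :=
        (hxy.symm.trans hx).trans (X.conn_σ hxy)
      have hbot : X.fV (X.P.r (X.P.i k)) = X.C.r (X.C.i e) := by rw [X.f_r, X.f_i, hk]
      have hstep : X.C.Conn F' (X.C.r (X.C.i e)) (X.fV x) :=
        (hxe.trans (HEGraph.Conn.step he)).symm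
      have n1 : ¬ X.P.Conn (X.fH ⁻¹' F) (X.σV (X.P.r k)) (X.P.r k) := by
        intro hc
        obtain ⟨h, hh, hμ⟩ := ih _ hc.symm
        exact hno h ((hh.mono hmono).trans (hy ▸ hxe.symm)) hμ
      have n2 : ¬ X.P.Conn (X.fH ⁻¹' F) (X.σV (X.P.r k)) (X.P.r (X.P.i k)) := by
        intro hc
        have := X.conn_proj hc
        rw [X.f_σV, hy, hbot] at this
        exact hb this
      have n3 : ¬ X.P.Conn (X.fH ⁻¹' F) (X.σV (X.P.r (X.P.i k))) (X.P.r k) := by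
        intro hc
        have := X.conn_proj hc
        rw [X.f_σV, hy, hbot] at this
        exact hb this.symm
      have n4 : ¬ X.P.Conn (X.fH ⁻¹' F) (X.σV (X.P.r (X.P.i k))) (X.P.r (X.P.i k)) := by
        intro hc
        obtain ⟨h, hh, hμ⟩ := ih _ hc.symm
        exact hno h ((hh.mono hmono).trans (hbot ▸ hstep)) hμ
      have := key (fun z => X.P.Conn (X.fH ⁻¹' F) z (X.P.r k) ∨
        X.P.Conn (X.fH ⁻¹' F) z (X.P.r (X.P.i k))) ?_ ?_ _ _ hyσ
      · rcases this.1 (Or.inl (HEGraph.Conn.refl _)) with h | h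
        · exact n1 h
        · exact n2 h
      · intro y z hyz
        exact ⟨fun h => h.imp hyz.symm.trans hyz.symm.trans, fun h => h.imp hyz.trans hyz.trans⟩
      · intro l hl
        rcases X.fH_fibre k l (hk.trans hl.symm) with rfl | rfl
        · exact ⟨fun _ => Or.inr (HEGraph.Conn.refl _), fun _ => Or.inl (HEGraph.Conn.refl _)⟩
        · rw [← X.σ_i, ← X.σ_r, ← X.σ_r]
          exact ⟨fun h => (h.elim n1 n2).elim, fun h => (h.elim n3 n4).elim⟩
    · have := key (fun z => X.P.Conn (X.fH ⁻¹' F) x z) ?_ ?_ _ _ hx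
      · obtain ⟨h, hh, hμ⟩ := ih x (this.1 (HEGraph.Conn.refl _))
        exact hno h (hh.mono hmono) hμ
      · intro y z hyz
        exact ⟨fun h => h.trans hyz, fun h => h.trans hyz.symm⟩
      · intro k hk
        constructor
        · intro hc
          have := (X.conn_proj hc).mono hmono
          rw [X.f_r, hk] at this
          exact absurd this hxe
        · intro hc
          have := (X.conn_proj hc).mono hmono
          rw [X.f_r, X.f_i, hk] at this
          exact absurd (this.trans (HEGraph.Conn.step he).symm) hxe

theorem sum_star_contract (X : AdmissibleCover) {F : Set X.C.H} (hF : X.C.IsEdgeSet F)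
    (v : (X.C.contract F hF).V) : ∑ᶠ h ∈ (X.C.contract F hF).star v, X.μ h.1 = 0 := by
  obtain ⟨v⟩ := v
  have := X.sum_outer hF v
  rw [← HEGraph.image_star_contract hF] at this
  exact (finsum_mem_image (s := (X.C.contract F hF).star (Quot.mk _ v)) (f := X.μ)
    Subtype.val_injective.injOn).symm.trans this

/-- The map on vertices induced by `P → C` after contraction. -/
def contractV (X : AdmissibleCover) (F : Set X.C.H) :
    Quot (X.P.Step (X.fH ⁻¹' F)) → Quot (X.C.Step F) :=
  Quot.map X.fV (by
    rintro _ _ ⟨k, hk, rfl, rfl⟩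
    exact ⟨X.fH k, hk, (X.f_r k).symm, by rw [X.f_r, X.f_i]⟩)

/-- Contraction of a set of edges of the target, together with their preimages in the source.  The
monodromy marking is restricted; the genera are those determined by local Riemann-Hurwitz. -/
noncomputable def contract (X : AdmissibleCover) (F : Set X.C.H) (hF : X.C.IsEdgeSet F) :
    AdmissibleCover :=
  { C := X.C.contract F hF
    P := X.P.contract (X.fH ⁻¹' F) (X.isEdgeSet_preimage hF)
    tree := X.tree.contract hF
    stable := by
      rintro ⟨v⟩
      exact (HEGraph.three_le_outer X.tree X.stable hF v).trans_eq
        (HEGraph.ncard_star_contract hF v).symm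
    fV := X.contractV F
    fH := fun h => ⟨X.fH h.1, h.2⟩
    f_i := fun h => Subtype.ext (X.f_i h.1)
    f_r := fun h => congrArg (Quot.mk _) (X.f_r h.1)
    σV := Quot.map X.σV (by
      rintro _ _ ⟨k, hk, rfl, rfl⟩
      exact ⟨X.σH k, by rw [Set.mem_preimage, X.f_σH]; exact hk, (X.σ_r k).symm,
        by rw [X.σ_r, X.σ_i]⟩)
    σH := fun h => ⟨X.σH h.1, by rw [Set.mem_preimage, X.f_σH]; exact h.2⟩
    σV_σV := by rintro ⟨x⟩; exact congrArg (Quot.mk _) (X.σV_σV x)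
    σH_σH := fun h => Subtype.ext (X.σH_σH h.1)
    σ_i := fun h => Subtype.ext (X.σ_i h.1)
    σ_r := fun h => congrArg (Quot.mk _) (X.σ_r h.1)
    f_σV := by rintro ⟨x⟩; exact congrArg (Quot.mk _) (X.f_σV x)
    f_σH := fun h => Subtype.ext (X.f_σH h.1)
    μ := fun h => X.μ h.1
    μ_i := fun h => X.μ_i h.1
    μ_sum := X.sum_star_contract hF
    fV_surjective := by
      rintro ⟨v⟩
      obtain ⟨x, rfl⟩ := X.fV_surjective v
      exact ⟨Quot.mk _ x, rfl⟩
    fV_fibre := by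
      rintro ⟨x⟩ ⟨y⟩ hxy
      obtain ⟨z, hz, hxz⟩ := X.conn_lift hF (HEGraph.mk_eq_iff.1 hxy)
      have hxz := HEGraph.mk_eq_iff.2 hxz
      rcases X.fV_fibre z y hz with rfl | rfl
      · exact Or.inl hxz.symm
      · refine Or.inr ?_
        exact HEGraph.mk_eq_iff.2 (X.conn_σ (HEGraph.mk_eq_iff.1 hxz.symm))
    σV_eq_iff := by
      rintro ⟨x⟩
      constructor
      · intro hx
        obtain ⟨h, hh, hμ⟩ := X.exists_odd_of_conn hF x (HEGraph.mk_eq_iff.1 hx).symm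
        obtain ⟨k, hk, hμ'⟩ := X.exists_odd_outer hF hμ hh
        exact ⟨⟨k, hk.1⟩, HEGraph.mk_eq_iff.2 hk.2, hμ'⟩
      · rintro ⟨k, hk, hμ⟩
        obtain ⟨y, hy, hxy⟩ := X.conn_lift hF (HEGraph.mk_eq_iff.1 hk).symm
        have hy' := (X.σV_eq_iff y).2 ⟨k.1, hy.symm, hμ⟩
        have := X.conn_σ hxy
        rw [hy'] at this
        exact HEGraph.mk_eq_iff.2 (this.trans hxy.symm)
    fH_surjective := by
      rintro ⟨h, hh⟩
      obtain ⟨k, rfl⟩ := X.fH_surjective h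
      exact ⟨⟨k, hh⟩, rfl⟩
    fH_fibre := fun h k hk => (X.fH_fibre h.1 k.1 (congrArg Subtype.val hk)).imp
      (fun h => Subtype.ext h) (fun h => Subtype.ext h)
    σH_eq_iff := fun h => Subtype.ext_iff.trans (X.σH_eq_iff h.1)
    genus := fun x => Classical.choose (exists_genus _ _ (X.sum_star_contract hF (X.contractV F x)))
    riemann_hurwitz := fun x =>
      Classical.choose_spec (exists_genus _ _ (X.sum_star_contract hF (X.contractV F x))) }

end AdmissibleCover

/-- An object of the category `Γ^H_{g,n}`: an admissible `ℤ/2`-cover `P → C` of a stable tree with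
`2g + 2 + n` legs, together with an injective marking `mC` of `n` legs of `C` and a lift `mP` of it
to the legs of `P`.  The marked legs have monodromy `0`, the unmarked legs have monodromy `1`.
Two kinds of trivalent vertices with two legs are forbidden. -/
structure HCover (g n : ℕ) extends AdmissibleCover where
  mC : Fin n → C.H
  mC_leg : ∀ j, mC j ∈ C.legs
  mC_injective : Function.Injective mC
  card_legs : C.legs.ncard = 2 * g + 2 + n
  mP : Fin n → P.H
  mP_leg : ∀ j, mP j ∈ P.legs
  f_mP : ∀ j, fH (mP j) = mC j
  μ_marked : ∀ j, μ (mC j) = 0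
  μ_unmarked : ∀ h ∈ C.legs, h ∉ Set.range mC → μ h = 1
  /-- no vertex supports exactly one edge and two marked legs whose chosen lifts lie on different
  vertices of `P` (the two marked points are conjugate) -/
  not_conjugate : ∀ v, (C.star v).ncard = 3 → (C.star v ∩ C.legs).ncard = 2 →
    ∀ j k, C.r (mC j) = v → C.r (mC k) = v → P.r (mP j) = P.r (mP k)
  /-- no vertex supports exactly one edge, one marked leg and one unmarked leg (the marked point is
  a Weierstrass point) -/
  not_weierstrass : ∀ v, ¬ ((C.star v).ncard = 3 ∧ (C.star v ∩ C.legs).ncard = 2 ∧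
    {j | C.r (mC j) = v}.ncard = 1)

namespace HCover

/-- The weight of a vertex of the target: its number of unmarked legs. -/
noncomputable def weight {g n : ℕ} (X : HCover g n) (v : X.C.V) : ℕ :=
  {h | h ∈ X.C.star v ∧ h ∈ X.C.legs ∧ h ∉ Set.range X.mC}.ncard

/-- Some vertex of the source supports at least two markings. -/
def HasRepeatedMarking {g n : ℕ} (X : HCover g n) : Prop :=
  ∃ x : X.P.V, ∃ j k, j ≠ k ∧ X.P.r (X.mP j) = x ∧ X.P.r (X.mP k) = x

/-- Some vertex of the target has weight at least three. -/
def HasWeightThree {g n : ℕ} (X : HCover g n) : Prop := ∃ v, 3 ≤ X.weight v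

theorem not_mem_of_leg {C : HEGraph} {F : Set C.H} (hF : C.IsEdgeSet F) {h : C.H}
    (hh : h ∈ C.legs) : h ∉ F := fun h' => (hF h h').2 hh

theorem outer_eq_star {C : HEGraph} (hC : C.IsTree) (hst : ∀ v, 3 ≤ (C.star v).ncard)
    {F : Set C.H} (hF : C.IsEdgeSet F) {v : C.V} (h3 : (C.outer F v).ncard = 3) :
    C.outer F v = C.star v := by
  ext a
  constructor
  · exact fun ha => HEGraph.eq_of_ncard_outer hC hst hF h3 ha.2.symm
  · intro ha
    have hc : C.Conn F (C.r a) v := by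
      rw [show C.r a = v from ha]; exact HEGraph.Conn.refl _
    refine ⟨fun haF => ?_, hc⟩
    have := HEGraph.four_le_outer hC hF haF (HEGraph.three_le_outer hC hst (hF.diff a)) hc
    omega

theorem ncard_star_legs_contract {C : HEGraph} (hC : C.IsTree)
    (hst : ∀ v, 3 ≤ (C.star v).ncard) {F : Set C.H} (hF : C.IsEdgeSet F) {v : C.V}
    (h3 : (C.outer F v).ncard = 3) :
    ((C.contract F hF).star (Quot.mk _ v) ∩ (C.contract F hF).legs).ncard =
      (C.star v ∩ C.legs).ncard := by
  refine (Set.ncard_image_of_injective _ Subtype.val_injective).symm.trans (congrArg _ ?_)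
  rw [← outer_eq_star hC hst hF h3]
  ext a
  constructor
  · rintro ⟨b, ⟨hb1, hb2⟩, rfl⟩
    exact ⟨⟨b.2, HEGraph.mk_eq_iff.1 hb1⟩, congrArg Subtype.val hb2⟩
  · rintro ⟨⟨h1, h2⟩, h3⟩
    exact ⟨⟨a, h1⟩, ⟨HEGraph.mk_eq_iff.2 h2, Subtype.ext h3⟩, rfl⟩

/-- Contraction of a set of edges of the target, together with their preimages in the source. -/
noncomputable def contract {g n : ℕ} (X : HCover g n) (F : Set X.C.H) (hF : X.C.IsEdgeSet F) :
    HCover g n where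
  toAdmissibleCover := X.toAdmissibleCover.contract F hF
  mC j := ⟨X.mC j, not_mem_of_leg hF (X.mC_leg j)⟩
  mC_leg j := Subtype.ext (X.mC_leg j)
  mC_injective j k h := X.mC_injective (congrArg Subtype.val h)
  card_legs := by
    rw [← X.card_legs]
    refine (Set.ncard_image_of_injective _ Subtype.val_injective).symm.trans (congrArg _ ?_)
    ext a
    constructor
    · rintro ⟨b, hb, rfl⟩
      exact congrArg Subtype.val hb
    · intro h
      exact ⟨⟨a, not_mem_of_leg hF h⟩, Subtype.ext h, rfl⟩
  mP j := ⟨X.mP j, not_mem_of_leg (X.isEdgeSet_preimage hF) (X.mP_leg j)⟩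
  mP_leg j := Subtype.ext (X.mP_leg j)
  f_mP j := Subtype.ext (X.f_mP j)
  μ_marked j := X.μ_marked j
  μ_unmarked h hh hn := X.μ_unmarked h.1 (congrArg Subtype.val hh)
    (fun ⟨j, hj⟩ => hn ⟨j, Subtype.ext hj⟩)
  not_conjugate := by
    rintro ⟨v⟩ h3 h2 j k hj hk
    have h3' := (HEGraph.ncard_star_contract hF v).symm.trans h3
    have h2' := (ncard_star_legs_contract X.tree X.stable hF h3').symm.trans h2
    have heq := outer_eq_star X.tree X.stable hF h3'
    have h3'' := h3'
    rw [heq] at h3''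
    refine congrArg (Quot.mk _) (X.not_conjugate v h3'' h2' j k ?_ ?_)
    · exact HEGraph.eq_of_ncard_outer X.tree X.stable hF h3' (HEGraph.mk_eq_iff.1 hj).symm
    · exact HEGraph.eq_of_ncard_outer X.tree X.stable hF h3' (HEGraph.mk_eq_iff.1 hk).symm
  not_weierstrass := by
    rintro ⟨v⟩ ⟨h3, h2, h1⟩
    have h3' := (HEGraph.ncard_star_contract hF v).symm.trans h3
    have h2' := (ncard_star_legs_contract X.tree X.stable hF h3').symm.trans h2
    have heq := outer_eq_star X.tree X.stable hF h3'
    have h3'' := h3'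
    rw [heq] at h3''
    refine X.not_weierstrass v ⟨h3'', h2', ?_⟩
    rw [← h1]
    congr 1
    ext j
    constructor
    · exact fun hj => congrArg (Quot.mk _) hj
    · exact fun hj => HEGraph.eq_of_ncard_outer X.tree X.stable hF h3' (HEGraph.mk_eq_iff.1 hj).symm

theorem HasRepeatedMarking.contract {g n : ℕ} {X : HCover g n} (hX : X.HasRepeatedMarking)
    {F : Set X.C.H} (hF : X.C.IsEdgeSet F) : (X.contract F hF).HasRepeatedMarking := by
  obtain ⟨x, j, k, hjk, hj, hk⟩ := hX
  exact ⟨Quot.mk _ x, j, k, hjk, congrArg (Quot.mk _) hj, congrArg (Quot.mk _) hk⟩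

theorem HasWeightThree.contract {g n : ℕ} {X : HCover g n} (hX : X.HasWeightThree)
    {F : Set X.C.H} (hF : X.C.IsEdgeSet F) : (X.contract F hF).HasWeightThree := by
  obtain ⟨v, hv⟩ := hX
  refine ⟨Quot.mk _ v, hv.trans ?_⟩
  refine (Set.ncard_le_ncard ?_).trans_eq (Set.ncard_image_of_injective
    {h : (X.contract F hF).C.H | h ∈ (X.contract F hF).C.star (Quot.mk _ v) ∧
      h ∈ (X.contract F hF).C.legs ∧ h ∉ Set.range (X.contract F hF).mC}
    Subtype.val_injective)
  rintro a ⟨h1, h2, h3⟩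
  exact ⟨⟨a, not_mem_of_leg hF h2⟩, ⟨congrArg (Quot.mk _) h1, Subtype.ext h2,
    fun ⟨j, hj⟩ => h3 ⟨j, congrArg Subtype.val hj⟩⟩, rfl⟩

end HCover

/-- An object `P → C` of `Γ^H_{g,n}` with a bijective edge-labelling `Fin k → E(C)`. -/
structure LabelledHCover (g n k : ℕ) extends HCover g n where
  ω : Fin k → Set C.H
  ω_bijOn : Set.BijOn ω Set.univ C.edges

theorem HEGraph.edge_eq {C : HEGraph} {e e' : Set C.H} (he : e ∈ C.edges) (he' : e' ∈ C.edges)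
    {h : C.H} (hh : h ∈ e) (hh' : h ∈ e') : e = e' := by
  have key : ∀ e ∈ C.edges, h ∈ e → e = {h, C.i h} := by
    rintro _ ⟨a, ha, rfl⟩ (rfl | h1)
    · rfl
    · have h1 : h = C.i a := h1
      rw [h1, C.i_i, Set.pair_comm]
  rw [key e he hh, key e' he' hh']

namespace LabelledHCover

/-- The half-edges of the edges whose label is not in the image of `ι`. -/
def removed {g n k l : ℕ} (X : LabelledHCover g n l) (ι : Fin k ↪ Fin l) : Set X.C.H :=
  {h | ∃ j, j ∉ Set.range ι ∧ h ∈ X.ω j}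

theorem isEdgeSet_removed {g n k l : ℕ} (X : LabelledHCover g n l) (ι : Fin k ↪ Fin l) :
    X.C.IsEdgeSet (X.removed ι) := by
  rintro h ⟨j, hj, hh⟩
  obtain ⟨a, ha, he⟩ := X.ω_bijOn.mapsTo (Set.mem_univ j)
  rw [he] at hh
  rcases hh with rfl | hh
  · exact ⟨⟨j, hj, by rw [he]; exact Or.inr rfl⟩, ha⟩
  · have hh : h = X.C.i a := hh
    subst hh
    refine ⟨⟨j, hj, by rw [he, X.C.i_i]; exact Or.inl rfl⟩, ?_⟩
    rw [X.C.i_i]; exact ha.symm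

theorem ω_eq_of_mem {g n k : ℕ} (X : LabelledHCover g n k) {a b : Fin k} {h : X.C.H}
    (ha : h ∈ X.ω a) (hb : h ∈ X.ω b) : a = b :=
  X.ω_bijOn.injOn (Set.mem_univ _) (Set.mem_univ _)
    (HEGraph.edge_eq (X.ω_bijOn.mapsTo (Set.mem_univ _)) (X.ω_bijOn.mapsTo (Set.mem_univ _)) ha hb)

theorem not_mem_removed {g n k l : ℕ} (X : LabelledHCover g n l) (ι : Fin k ↪ Fin l) {j : Fin k}
    {h : X.C.H} (hh : h ∈ X.ω (ι j)) : h ∉ X.removed ι := by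
  rintro ⟨b, hb, hhb⟩
  exact hb ⟨j, X.ω_eq_of_mem hh hhb⟩

/-- The face of a labelled cover along an injection `ι`: contract the edges whose label is not in
the image of `ι`, and relabel the remaining edges through `ι`. -/
noncomputable def face {g n k l : ℕ} (ι : Fin k ↪ Fin l) (X : LabelledHCover g n l) :
    LabelledHCover g n k where
  toHCover := X.toHCover.contract (X.removed ι) (X.isEdgeSet_removed ι)
  ω j := {h | h.1 ∈ X.ω (ι j)}
  ω_bijOn := by
    refine ⟨?_, ?_, ?_⟩
    · intro j _
      obtain ⟨a, ha, he⟩ := X.ω_bijOn.mapsTo (Set.mem_univ (ι j))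
      refine ⟨⟨a, X.not_mem_removed ι (j := j) (by rw [he]; exact Or.inl rfl)⟩,
        fun h => ha (congrArg Subtype.val h), ?_⟩
      ext b
      constructor
      · intro hb
        have hb : b.1 ∈ X.ω (ι j) := hb
        rw [he] at hb
        exact hb.imp (fun h => Subtype.ext h) (fun h => Subtype.ext h)
      · intro hb
        change b.1 ∈ X.ω (ι j)
        rw [he]
        rcases hb with h | h
        · exact Or.inl (congrArg Subtype.val h)
        · have h := congrArg Subtype.val (Set.mem_singleton_iff.1 h)
          exact Or.inr h
    · intro j _ j' _ hjj
      obtain ⟨a, ha, he⟩ := X.ω_bijOn.mapsTo (Set.mem_univ (ι j))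
      have ha' : a ∈ X.ω (ι j) := by rw [he]; exact Or.inl rfl
      have : (⟨a, X.not_mem_removed ι ha'⟩ : {h // h ∉ X.removed ι}) ∈
          {h : {h // h ∉ X.removed ι} | h.1 ∈ X.ω (ι j')} := Set.ext_iff.1 hjj _ |>.1 ha'
      exact ι.injective (X.ω_eq_of_mem ha' this)
    · rintro _ ⟨⟨a, hmem⟩, ha, rfl⟩
      have ha' : X.C.i a ≠ a := fun h => ha (Subtype.ext h)
      obtain ⟨j, _, hj⟩ := X.ω_bijOn.surjOn (show {a, X.C.i a} ∈ X.C.edges from ⟨a, ha', rfl⟩)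
      have hr : j ∈ Set.range ι := by
        by_contra hr
        exact hmem ⟨j, hr, by rw [hj]; exact Or.inl rfl⟩
      obtain ⟨j, rfl⟩ := hr
      refine ⟨j, Set.mem_univ _, ?_⟩
      ext b
      constructor
      · intro hb
        have hb : b.1 ∈ X.ω (ι j) := hb
        rw [hj] at hb
        exact hb.imp (fun h => Subtype.ext h) (fun h => Subtype.ext h)
      · intro hb
        change b.1 ∈ X.ω (ι j)
        rw [hj]
        rcases hb with h | h
        · exact Or.inl (congrArg Subtype.val h)
        · have h := congrArg Subtype.val (Set.mem_singleton_iff.1 h)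
          exact Or.inr h

/-- An isomorphism of labelled covers: compatible isomorphisms of the sources and of the targets
that preserve the markings, the monodromy and the edge-labelling.  (Compatibility with the
`ℤ/2`-actions is automatic, because the fibres are orbits with at most two points.) -/
structure Iso {g n k : ℕ} (X Y : LabelledHCover g n k) where
  φ : HEGraph.Iso X.P Y.P
  ψ : HEGraph.Iso X.C Y.C
  commV : ∀ x, Y.fV (φ.eV x) = ψ.eV (X.fV x)
  commH : ∀ h, Y.fH (φ.eH h) = ψ.eH (X.fH h)
  map_mP : ∀ j, φ.eH (X.mP j) = Y.mP j
  map_mC : ∀ j, ψ.eH (X.mC j) = Y.mC j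
  map_μ : ∀ h, Y.μ (ψ.eH h) = X.μ h
  map_ω : ∀ j h, ψ.eH h ∈ Y.ω j ↔ h ∈ X.ω j

namespace Iso

def refl {g n k : ℕ} (X : LabelledHCover g n k) : Iso X X :=
  ⟨.refl _, .refl _, fun _ => rfl, fun _ => rfl, fun _ => rfl, fun _ => rfl, fun _ => rfl,
    fun _ _ => Iff.rfl⟩

def symm {g n k : ℕ} {X Y : LabelledHCover g n k} (e : Iso X Y) : Iso Y X where
  φ := e.φ.symm
  ψ := e.ψ.symm
  commV x := by
    obtain ⟨x, rfl⟩ := e.φ.eV.surjective x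
    rw [e.commV]; simp [HEGraph.Iso.symm]
  commH x := by
    obtain ⟨x, rfl⟩ := e.φ.eH.surjective x
    rw [e.commH]; simp [HEGraph.Iso.symm]
  map_mP j := by rw [← e.map_mP]; simp [HEGraph.Iso.symm]
  map_mC j := by rw [← e.map_mC]; simp [HEGraph.Iso.symm]
  map_μ h := by rw [← e.map_μ]; simp [HEGraph.Iso.symm]
  map_ω j h := by rw [← e.map_ω]; simp [HEGraph.Iso.symm]

def trans {g n k : ℕ} {X Y Z : LabelledHCover g n k} (e : Iso X Y) (e' : Iso Y Z) : Iso X Z where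
  φ := e.φ.trans e'.φ
  ψ := e.ψ.trans e'.ψ
  commV x := (e'.commV _).trans (congrArg _ (e.commV x))
  commH x := (e'.commH _).trans (congrArg _ (e.commH x))
  map_mP j := (congrArg _ (e.map_mP j)).trans (e'.map_mP j)
  map_mC j := (congrArg _ (e.map_mC j)).trans (e'.map_mC j)
  map_μ h := (e'.map_μ _).trans (e.map_μ h)
  map_ω j h := (e'.map_ω j _).trans (e.map_ω j h)

theorem mem_removed {g n k l : ℕ} {X Y : LabelledHCover g n l} (e : Iso X Y) (ι : Fin k ↪ Fin l)
    (h : X.C.H) : h ∈ X.removed ι ↔ e.ψ.eH h ∈ Y.removed ι :=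
  exists_congr fun j => and_congr_right fun _ => (e.map_ω j h).symm

/-- Isomorphic labelled covers have isomorphic faces. -/
def face {g n k l : ℕ} {X Y : LabelledHCover g n l} (e : Iso X Y) (ι : Fin k ↪ Fin l) :
    Iso (X.face ι) (Y.face ι) where
  φ := e.φ.contract (X.isEdgeSet_preimage (X.isEdgeSet_removed ι))
    (Y.isEdgeSet_preimage (Y.isEdgeSet_removed ι)) (by
    intro h
    rw [Set.mem_preimage, Set.mem_preimage, e.commH]
    exact e.mem_removed ι _)
  ψ := e.ψ.contract (X.isEdgeSet_removed ι) (Y.isEdgeSet_removed ι) (e.mem_removed ι)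
  commV := by rintro ⟨x⟩; exact congrArg (Quot.mk _) (e.commV x)
  commH h := Subtype.ext (e.commH h.1)
  map_mP j := Subtype.ext (e.map_mP j)
  map_mC j := Subtype.ext (e.map_mC j)
  map_μ h := e.map_μ h.1
  map_ω j h := e.map_ω (ι j) h.1

/-- The face along the identity. -/
def faceId {g n k : ℕ} (X : LabelledHCover g n k) :
    Iso (X.face (Function.Embedding.refl _)) X where
  φ := .contractEmpty _ (X.isEdgeSet_preimage (X.isEdgeSet_removed _)) (fun _ ⟨j, hj, _⟩ => hj ⟨j, rfl⟩)
  ψ := .contractEmpty _ (X.isEdgeSet_removed _) (fun _ ⟨j, hj, _⟩ => hj ⟨j, rfl⟩)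
  commV := by rintro ⟨x⟩; rfl
  commH _ := rfl
  map_mP _ := rfl
  map_mC _ := rfl
  map_μ _ := rfl
  map_ω _ _ := Iff.rfl

theorem mem_removed_trans {g n k l m : ℕ} (X : LabelledHCover g n m) (κ : Fin k ↪ Fin l)
    (ι : Fin l ↪ Fin m) (h : X.C.H) : h ∈ X.removed (κ.trans ι) ↔ h ∈ X.removed ι ∨
      ∃ hh : h ∉ X.removed ι, (⟨h, hh⟩ : (X.face ι).C.H) ∈ (X.face ι).removed κ := by
  constructor
  · rintro ⟨j, hj, hh⟩
    by_cases hr : j ∈ Set.range ι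
    · obtain ⟨j, rfl⟩ := hr
      refine Or.inr ⟨X.not_mem_removed ι hh, j, ?_, hh⟩
      rintro ⟨a, rfl⟩
      exact hj ⟨a, rfl⟩
    · exact Or.inl ⟨j, hr, hh⟩
  · rintro (⟨j, hj, hh⟩ | ⟨_, j, hj, hh⟩)
    · exact ⟨j, fun ⟨a, ha⟩ => hj ⟨κ a, ha⟩, hh⟩
    · exact ⟨ι j, fun ⟨a, ha⟩ => hj ⟨a, ι.injective ha⟩, hh⟩

/-- The face along a composition. -/
def faceTrans {g n k l m : ℕ} (X : LabelledHCover g n m) (κ : Fin k ↪ Fin l) (ι : Fin l ↪ Fin m) :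
    Iso (X.face (κ.trans ι)) ((X.face ι).face κ) where
  φ := .contractContract X.P (X.isEdgeSet_preimage (X.isEdgeSet_removed ι))
    (X.isEdgeSet_preimage (X.isEdgeSet_removed _))
    ((X.face ι).isEdgeSet_preimage ((X.face ι).isEdgeSet_removed κ))
    (fun h => mem_removed_trans X κ ι (X.fH h))
  ψ := .contractContract X.C (X.isEdgeSet_removed ι) (X.isEdgeSet_removed _)
    ((X.face ι).isEdgeSet_removed κ)
    (mem_removed_trans X κ ι)
  commV := by rintro ⟨x⟩; rfl
  commH _ := rfl
  map_mP _ := rfl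
  map_mC _ := rfl
  map_μ _ := rfl
  map_ω _ _ := Iff.rfl

theorem hasRepeatedMarking {g n k : ℕ} {X Y : LabelledHCover g n k} (e : Iso X Y)
    (hX : X.HasRepeatedMarking) : Y.HasRepeatedMarking := by
  obtain ⟨x, j, l, hjl, hj, hl⟩ := hX
  refine ⟨e.φ.eV x, j, l, hjl, ?_, ?_⟩
  · rw [← e.map_mP, ← e.φ.map_r, hj]
  · rw [← e.map_mP, ← e.φ.map_r, hl]

theorem hasWeightThree {g n k : ℕ} {X Y : LabelledHCover g n k} (e : Iso X Y)
    (hX : X.HasWeightThree) : Y.HasWeightThree := by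
  obtain ⟨v, hv⟩ := hX
  refine ⟨e.ψ.eV v, hv.trans ?_⟩
  refine (Set.ncard_image_of_injective _ e.ψ.eH.injective).symm.trans_le (Set.ncard_le_ncard ?_)
  rintro _ ⟨a, ⟨h1, h2, h3⟩, rfl⟩
  refine ⟨?_, ?_, ?_⟩
  · have h1 : X.C.r a = v := h1
    change Y.C.r _ = _
    rw [← e.ψ.map_r, h1]
  · have h2 : X.C.i a = a := h2
    change Y.C.i _ = _
    rw [← e.ψ.map_i, h2]
  · rintro ⟨j, hj⟩
    rw [← e.map_mC] at hj
    exact h3 ⟨j, e.ψ.eH.injective hj⟩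

end Iso

/-- Two labelled covers are identified when they are isomorphic. -/
def setoid (g n k : ℕ) : Setoid (LabelledHCover g n k) where
  r X Y := Nonempty (Iso X Y)
  iseqv := ⟨fun X => ⟨.refl X⟩, fun ⟨e⟩ => ⟨e.symm⟩, fun ⟨e⟩ ⟨e'⟩ => ⟨e.trans e'⟩⟩

end LabelledHCover

/-! ### Symmetric Δ-complexes and their homology -/

/-- The objects of (a skeleton of) the category of finite sets and injections; `⟨k⟩` stands for a
set with `k` elements. -/
structure FinInj where
  card : ℕ

instance : Category FinInj where
  Hom a b := Fin a.card ↪ Fin b.card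
  id _ := Function.Embedding.refl _
  comp f g := f.trans g

/-- A symmetric Δ-complex is a presheaf of sets on the category of finite sets and injections.  Its
value on a set with `k` elements is the set of `(k - 1)`-simplices. -/
abbrev SymmDeltaComplex := FinInjᵒᵖ ⥤ Type 1

namespace SymmDeltaComplex

/-- The set of simplices with `k` vertices, that is, of dimension `k - 1`. -/
abbrev simplices (X : SymmDeltaComplex) (k : ℕ) : Type 1 := X.obj (Opposite.op ⟨k⟩)

/-- The map `ι^*` on simplices. -/
def pull (X : SymmDeltaComplex) {k l : ℕ} (ι : Fin k ↪ Fin l) (x : X.simplices l) :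
    X.simplices k :=
  X.map (Quiver.Hom.op (X := (⟨k⟩ : FinInj)) (Y := ⟨l⟩) ι) x

theorem pull_trans (X : SymmDeltaComplex) {k l m : ℕ} (κ : Fin k ↪ Fin l) (ι : Fin l ↪ Fin m)
    (x : X.simplices m) : X.pull κ (X.pull ι x) = X.pull (κ.trans ι) x := by
  unfold pull
  rw [← ConcreteCategory.comp_apply, ← X.map_comp]
  rfl

/-- The relations `x = sgn(ρ) ρ^* x`. -/
noncomputable def signRelations (X : SymmDeltaComplex) (k : ℕ) : Submodule ℚ (X.simplices k →₀ ℚ) :=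
  Submodule.span ℚ {y | ∃ (x : X.simplices k) (ρ : Equiv.Perm (Fin k)),
    y = Finsupp.single x 1 - Finsupp.single (X.pull ρ.toEmbedding x) ((ρ.sign : ℤ) : ℚ)}

/-- The group of rational cellular chains spanned by the simplices with `k` vertices, modulo the
relations `x = sgn(ρ) ρ^* x`. -/
abbrev Chains (X : SymmDeltaComplex) (k : ℕ) : Type 1 :=
  (X.simplices k →₀ ℚ) ⧸ X.signRelations k

/-- The chain given by a simplex. -/
noncomputable def chain (X : SymmDeltaComplex) {k : ℕ} (x : X.simplices k) : X.Chains k :=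
  (X.signRelations k).mkQ (Finsupp.single x 1)

theorem chain_pull_perm (X : SymmDeltaComplex) {k : ℕ} (x : X.simplices k)
    (ρ : Equiv.Perm (Fin k)) :
    X.chain (X.pull ρ.toEmbedding x) = ((ρ.sign : ℤ) : ℚ) • X.chain x := by
  have h : X.chain x = ((ρ.sign : ℤ) : ℚ) • X.chain (X.pull ρ.toEmbedding x) := by
    unfold chain
    rw [← map_smul, ← sub_eq_zero, ← map_sub, Submodule.mkQ_apply, Submodule.Quotient.mk_eq_zero]
    refine Submodule.subset_span ⟨x, ρ, ?_⟩
    rw [Finsupp.smul_single, smul_eq_mul, mul_one]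
  rw [h, smul_smul, ← Int.cast_mul, ← Units.val_mul, Int.units_mul_self]
  simp

/-- The signed sum of the faces of a simplex. -/
noncomputable def facesSum (X : SymmDeltaComplex) {k : ℕ} (x : X.simplices (k + 1)) :
    X.Chains k :=
  ∑ j : Fin (k + 1), (-1 : ℚ) ^ (j : ℕ) • X.chain (X.pull j.succAboveEmb x)

theorem exists_perm_succAbove {k : ℕ} (ρ : Equiv.Perm (Fin (k + 1))) (j : Fin (k + 1)) :
    ∃ τ : Equiv.Perm (Fin k), (∀ a, ρ (j.succAbove a) = (ρ j).succAbove (τ a)) ∧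
      τ.sign = (-1) ^ (ρ j : ℕ) * ρ.sign * (-1) ^ (j : ℕ) := by
  obtain ⟨⟨p, τ⟩, hπ⟩ := Equiv.Perm.decomposeFin.symm.surjective
    ((ρ j).cycleRange * ρ * j.cycleRange.symm)
  have hp : p = 0 := by
    rw [← Equiv.Perm.decomposeFin_symm_apply_zero p τ, hπ]
    simp
  subst hp
  refine ⟨τ, fun a => (ρ j).cycleRange.injective ?_, ?_⟩
  · have := congrArg (fun e => e a.succ) hπ
    simp only [Equiv.Perm.decomposeFin_symm_apply_succ, Equiv.swap_self, Equiv.refl_apply,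
      Equiv.Perm.mul_apply, Fin.cycleRange_symm_succ] at this
    rw [← this, Fin.cycleRange_succAbove]
  · have := congrArg Equiv.Perm.sign hπ
    rw [Equiv.Perm.decomposeFin.symm_sign, if_pos rfl, one_mul] at this
    rw [this]
    simp [Equiv.Perm.sign_symm]

theorem facesSum_pull_perm (X : SymmDeltaComplex) {k : ℕ} (x : X.simplices (k + 1))
    (ρ : Equiv.Perm (Fin (k + 1))) :
    X.facesSum (X.pull ρ.toEmbedding x) = ((ρ.sign : ℤ) : ℚ) • X.facesSum x := by
  unfold facesSum
  rw [Finset.smul_sum]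
  conv_rhs => rw [← Equiv.sum_comp ρ]
  refine Finset.sum_congr rfl fun j _ => ?_
  obtain ⟨τ, h1, h2⟩ := exists_perm_succAbove ρ j
  have h3 : j.succAboveEmb.trans ρ.toEmbedding =
      τ.toEmbedding.trans (ρ j).succAboveEmb := by
    ext a
    simp [h1]
  rw [pull_trans, h3, ← pull_trans, chain_pull_perm, smul_smul, smul_smul, h2]
  congr 1
  push_cast
  have : ((-1 : ℚ) ^ (j : ℕ)) * (-1) ^ (j : ℕ) = 1 := by
    rw [← mul_pow]; simp
  linear_combination ((-1 : ℚ) ^ (ρ j : ℕ) * ((ρ.sign : ℤ) : ℚ)) * this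

/-- The cellular boundary map `∂ x = ∑ⱼ (-1)ʲ (δʲ)^* x`, where `δʲ` is the increasing injection
that misses `j`. -/
noncomputable def boundary (X : SymmDeltaComplex) (k : ℕ) : X.Chains (k + 1) →ₗ[ℚ] X.Chains k :=
  (X.signRelations (k + 1)).liftQ (Finsupp.linearCombination ℚ X.facesSum) (by
    refine Submodule.span_le.2 ?_
    rintro _ ⟨x, ρ, rfl⟩
    simp only [SetLike.mem_coe, LinearMap.mem_ker, map_sub, Finsupp.linearCombination_single,
      one_smul]
    rw [facesSum_pull_perm, smul_smul, ← Int.cast_mul, ← Units.val_mul, Int.units_mul_self]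
    simp)

theorem boundary_chain (X : SymmDeltaComplex) {k : ℕ} (x : X.simplices (k + 1)) :
    X.boundary k (X.chain x) = X.facesSum x := by
  change (Finsupp.linearCombination ℚ X.facesSum) (Finsupp.single x 1) = _
  rw [Finsupp.linearCombination_single, one_smul]

theorem boundary_facesSum (X : SymmDeltaComplex) {k : ℕ} (x : X.simplices (k + 2)) :
    X.boundary k (X.facesSum x) = 0 := by
  rw [facesSum, map_sum]
  simp only [map_smul, boundary_chain, facesSum, Finset.smul_sum, smul_smul, pull_trans]
  rw [← Finset.sum_product']
  refine Finset.sum_involution (fun p _ => (p.1.succAbove p.2, p.2.predAbove p.1)) ?_ ?_ ?_ ?_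
  · rintro ⟨i, j⟩ _
    have h : (j.predAbove i).succAboveEmb.trans
        (i.succAbove j).succAboveEmb =
        j.succAboveEmb.trans i.succAboveEmb := by
      ext a
      simp [Fin.succAbove_succAbove_succAbove_predAbove]
    simp only [h, ← pow_add]
    rw [Fin.neg_one_pow_succAbove_add_predAbove, ← add_smul]
    simp
  · rintro ⟨i, j⟩ _ _ h
    exact Fin.succAbove_ne i j (congrArg Prod.fst h)
  · intro _ _; simp
  · rintro ⟨i, j⟩ _
    simp [Fin.succAbove_succAbove_predAbove, Fin.predAbove_predAbove_succAbove]

theorem boundary_boundary (X : SymmDeltaComplex) (k : ℕ) (c : X.Chains (k + 2)) :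
    X.boundary k (X.boundary (k + 1) c) = 0 := by
  have h : (X.boundary k ∘ₗ X.boundary (k + 1)) ∘ₗ (X.signRelations (k + 2)).mkQ = 0 := by
    refine Finsupp.lhom_ext' fun x => LinearMap.ext_ring ?_
    change X.boundary k (X.boundary (k + 1) (X.chain x)) = 0
    rw [boundary_chain, boundary_facesSum]
  obtain ⟨c, rfl⟩ := Submodule.mkQ_surjective _ c
  exact LinearMap.congr_fun h c

/-- The augmented rational cellular chain complex of a symmetric Δ-complex.  It is indexed by the
number of vertices: the term in position `k` is spanned by the simplices of dimension `k - 1`, the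
term in position `0` being the augmentation. -/
noncomputable def cellularChainComplex (X : SymmDeltaComplex) :
    ChainComplex (ModuleCat.{1} ℚ) ℕ :=
  ChainComplex.of (fun k => ModuleCat.of ℚ (X.Chains k)) (fun k => ModuleCat.ofHom (X.boundary k))
    (fun k => by
      ext c
      exact X.boundary_boundary k _)

/-- The reduced rational homology of a symmetric Δ-complex in dimension `k - 1`. -/
noncomputable def reducedHomology (X : SymmDeltaComplex) (k : ℕ) : ModuleCat.{1} ℚ :=
  X.cellularChainComplex.homology k

end SymmDeltaComplex

/-! ### The complex `Θ_{g,n}` and its subcomplexes -/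

/-- The face map on isomorphism classes of labelled covers. -/
noncomputable def LabelledHCover.faceClass {g n k l : ℕ} (ι : Fin k ↪ Fin l) :
    Quotient (LabelledHCover.setoid g n l) → Quotient (LabelledHCover.setoid g n k) :=
  Quotient.map (LabelledHCover.face ι) (fun _ _ ⟨e⟩ => ⟨e.face ι⟩)

/-- The symmetric Δ-complex `Θ_{g,n}`: its `(k-1)`-simplices are the isomorphism classes of objects
`P → C` of `Γ^H_{g,n}` with a bijective edge-labelling `Fin k → E(C)`. -/
noncomputable def Theta (g n : ℕ) : SymmDeltaComplex where
  obj a := Quotient (LabelledHCover.setoid g n a.unop.card)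
  map f := TypeCat.ofHom (LabelledHCover.faceClass f.unop)
  map_id a := by
    ext ⟨X⟩
    exact Quotient.sound ⟨LabelledHCover.Iso.faceId X⟩
  map_comp f f' := by
    ext ⟨X⟩
    exact Quotient.sound ⟨LabelledHCover.Iso.faceTrans X _ _⟩

/-- The repeated marking locus: the simplices such that some vertex of `P` supports at least two
markings. -/
noncomputable def ThetaRep (g n : ℕ) : Subfunctor (Theta g n) where
  obj a := {x | ∃ X : LabelledHCover g n a.unop.card,
    Quotient.mk (LabelledHCover.setoid g n a.unop.card) X = x ∧ X.HasRepeatedMarking}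
  map f := by
    rintro _ ⟨X, rfl, hX⟩
    exact ⟨X.face f.unop, rfl, hX.contract _⟩

/-- The weight three locus: the simplices such that some vertex of `C` has weight at least `3`. -/
noncomputable def ThetaWeightThree (g n : ℕ) : Subfunctor (Theta g n) where
  obj a := {x | ∃ X : LabelledHCover g n a.unop.card,
    Quotient.mk (LabelledHCover.setoid g n a.unop.card) X = x ∧ X.HasWeightThree}
  map f := by
    rintro _ ⟨X, rfl, hX⟩
    exact ⟨X.face f.unop, rfl, hX.contract _⟩

/-!
# Acyclic subcomplexes of the complex of hyperelliptic covers

Fix a set `B` of markings and a number `s`.  A *bunch* of a cover `P → C` is a set of legs of `C`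
that consists of the legs marked by `B` and of `s` unmarked legs.  If the legs of a bunch are rooted
at one vertex `v` of `C` (and the lifts of its marked legs at one vertex of `P`), then they can be
moved to a new vertex, a *fan*, that is joined to `v` by a new edge; contracting the new edge gives
back the old cover.  The edge of a fan that already exists is the result of such an expansion.

Let `h` be the operator on chains that sends a labelled cover to the sum of its expansions at all
bunches, the new edge being labelled `0` (`expandChains`).  For a bunch that is expandable or forms
a fan, the contribution to `∂h + h∂` on a cover `X` is `X` itself.  For any other bunch `S`, the
contribution comes from the edges whose contraction makes `S` expandable.  If such an edge ends in
the fan of another bunch `T`, then, after the contraction, `S` and `T` are exchanged by an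
automorphism, so that the contribution is `X` again; otherwise it is a cover with more fans than `X`
(`exists_boundary_expansionChain_add`).  Thus `∂h + h∂` is triangular for the filtration by the
number of fans, and its diagonal entries are positive integers on any subcomplex in which every
cover has a bunch that is expandable or a fan.  If the subcomplex is closed under expansions, it is
acyclic (`AcyclicOn.of_triangular_homotopy`, `acyclicOn_of_bunches`).

All this requires that an expansion exists (`exists_isExpansion`) and is unique
(`nonempty_iso_of_fan`).  Isomorphisms between covers of trees are easy to control: `P → C` has a
section (`exists_section`), and two covers are isomorphic as soon as their targets are, by an
isomorphism that respects the monodromy and under which two sections meet the lifts of the same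
markings (`LabelledHCover.Iso.ofSections`).

* For the locus of weight three, take `B = ∅` and `s = 3`; the monodromy at the new edge is then
  nontrivial, so that no choice of sheets arises.
* For `n ≤ 1` and the whole complex, take `B = ∅` and `s = 2`; a vertex at the end of the tree
  carries two unmarked legs, because a marked and an unmarked leg may not be alone there.
* The repeated marking locus is the union, over pairs of markings, of the loci where the two
  markings lie on one vertex of `P`.  An intersection of such loci is given by a relation on the
  markings; take for `B` a nontrivial class of the generated equivalence relation and `s = 0`
  (`acyclicOn_coincidence_inf`).  Mayer–Vietoris then gives the union.  These expansions do not
  change the weights, so the same argument works inside the locus of weight three.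
-/

/-! ### Chains of subcomplexes -/

namespace SymmDeltaComplex

theorem chains_induction {X : SymmDeltaComplex} {k : ℕ} {p : X.Chains k → Prop}
    (h0 : p 0) (hs : ∀ x, p (X.chain x)) (ha : ∀ a b, p a → p b → p (a + b))
    (hc : ∀ (q : ℚ) a, p a → p (q • a)) (z : X.Chains k) : p z := by
  obtain ⟨f, rfl⟩ := Submodule.mkQ_surjective _ z
  induction f using Finsupp.induction_linear with
  | zero => simpa using h0
  | add f g hf hg => rw [map_add]; exact ha _ _ hf hg
  | single x q =>
    have : Finsupp.single x q = q • Finsupp.single x (1 : ℚ) := by simp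
    rw [this, map_smul]
    exact hc _ _ (hs x)

theorem chains_hom_ext {X : SymmDeltaComplex} {k : ℕ} {M : Type*} [AddCommGroup M] [Module ℚ M]
    {f g : X.Chains k →ₗ[ℚ] M} (h : ∀ x, f (X.chain x) = g (X.chain x)) : f = g := by
  refine LinearMap.ext fun z => chains_induction (p := fun z => f z = g z) ?_ h ?_ ?_ z
  · simp
  · intro a b ha hb; rw [map_add, map_add, ha, hb]
  · intro q a ha; rw [map_smul, map_smul, ha]

/-- The linear map on chains defined by an alternating function on simplices. -/
noncomputable def liftChains (X : SymmDeltaComplex) {k : ℕ} {M : Type*} [AddCommGroup M]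
    [Module ℚ M] (f : X.simplices k → M)
    (hf : ∀ x (ρ : Equiv.Perm (Fin k)), f (X.pull ρ.toEmbedding x) = ((ρ.sign : ℤ) : ℚ) • f x) :
    X.Chains k →ₗ[ℚ] M :=
  (X.signRelations k).liftQ (Finsupp.linearCombination ℚ f) (by
    refine Submodule.span_le.2 ?_
    rintro _ ⟨x, ρ, rfl⟩
    simp only [SetLike.mem_coe, LinearMap.mem_ker, map_sub, Finsupp.linearCombination_single,
      one_smul]
    rw [hf, smul_smul, ← Int.cast_mul, ← Units.val_mul, Int.units_mul_self]
    simp)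

@[simp]
theorem liftChains_chain (X : SymmDeltaComplex) {k : ℕ} {M : Type*} [AddCommGroup M]
    [Module ℚ M] (f : X.simplices k → M)
    (hf : ∀ x (ρ : Equiv.Perm (Fin k)), f (X.pull ρ.toEmbedding x) = ((ρ.sign : ℤ) : ℚ) • f x)
    (x : X.simplices k) : X.liftChains f hf (X.chain x) = f x := by
  change (Finsupp.linearCombination ℚ f) (Finsupp.single x 1) = _
  rw [Finsupp.linearCombination_single, one_smul]

theorem pull_refl (X : SymmDeltaComplex) {k : ℕ} (x : X.simplices k) :
    X.pull (Function.Embedding.refl _) x = x :=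
  ConcreteCategory.congr_hom (X.map_id (Opposite.op ⟨k⟩)) x

/-- The simplices with `k` vertices of a subcomplex. -/
abbrev simplicesIn {X : SymmDeltaComplex} (K : Subfunctor X) (k : ℕ) : Set (X.simplices k) :=
  K.obj (Opposite.op ⟨k⟩)

/-- A simplex of `X` that lies in the subcomplex `K`, as a simplex of `K`. -/
def toSimplexIn {X : SymmDeltaComplex} {K : Subfunctor X} {k : ℕ} (x : X.simplices k)
    (hx : x ∈ simplicesIn K k) : SymmDeltaComplex.simplices K.toFunctor k := ⟨x, hx⟩

theorem pull_mem {X : SymmDeltaComplex} (K : Subfunctor X) {k l : ℕ} (ι : Fin k ↪ Fin l)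
    {x : X.simplices l} (hx : x ∈ simplicesIn K l) : X.pull ι x ∈ simplicesIn K k :=
  K.map (Quiver.Hom.op (X := (⟨k⟩ : FinInj)) (Y := ⟨l⟩) ι) hx

theorem pull_perm_mem_iff {X : SymmDeltaComplex} (K : Subfunctor X) {k : ℕ}
    (ρ : Equiv.Perm (Fin k)) (x : X.simplices k) :
    X.pull ρ.toEmbedding x ∈ simplicesIn K k ↔ x ∈ simplicesIn K k := by
  refine ⟨fun h => ?_, pull_mem K _⟩
  have := pull_mem K ρ.symm.toEmbedding h
  rw [pull_trans] at this
  convert this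
  rw [show ρ.symm.toEmbedding.trans ρ.toEmbedding = Function.Embedding.refl _ by ext; simp,
    pull_refl]

/-- The span, inside the chains of `X`, of the simplices of the subcomplex `K`. -/
noncomputable def chainsIn {X : SymmDeltaComplex} (K : Subfunctor X) (k : ℕ) :
    Submodule ℚ (X.Chains k) :=
  Submodule.span ℚ (X.chain '' simplicesIn K k)

theorem chain_mem_chainsIn {X : SymmDeltaComplex} {K : Subfunctor X} {k : ℕ} {x : X.simplices k}
    (hx : x ∈ simplicesIn K k) : X.chain x ∈ chainsIn K k :=
  Submodule.subset_span ⟨x, hx, rfl⟩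

theorem boundary_mem_chainsIn {X : SymmDeltaComplex} {K : Subfunctor X} {k : ℕ}
    {z : X.Chains (k + 1)} (hz : z ∈ chainsIn K (k + 1)) : X.boundary k z ∈ chainsIn K k := by
  suffices h : chainsIn K (k + 1) ≤ Submodule.comap (X.boundary k) (chainsIn K k) from h hz
  refine Submodule.span_le.2 ?_
  rintro _ ⟨x, hx, rfl⟩
  change X.boundary k (X.chain x) ∈ chainsIn K k
  rw [boundary_chain]
  exact Submodule.sum_mem _ fun j _ => Submodule.smul_mem _ _ (chain_mem_chainsIn (pull_mem K _ hx))

theorem chainsIn_mono {X : SymmDeltaComplex} {K L : Subfunctor X} (h : K ≤ L) (k : ℕ) :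
    chainsIn K k ≤ chainsIn L k :=
  Submodule.span_mono (Set.image_mono (h _))

theorem chainsIn_sup {X : SymmDeltaComplex} (K L : Subfunctor X) (k : ℕ) :
    chainsIn (K ⊔ L) k = chainsIn K k ⊔ chainsIn L k := by
  unfold chainsIn
  rw [← Submodule.span_union, ← Set.image_union]
  rfl

theorem chainsIn_top (X : SymmDeltaComplex) (k : ℕ) : chainsIn (⊤ : Subfunctor X) k = ⊤ := by
  rw [eq_top_iff]
  intro z _
  exact chains_induction (p := fun z => z ∈ chainsIn (⊤ : Subfunctor X) k)
    (zero_mem _) (fun x => chain_mem_chainsIn (Set.mem_univ x))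
    (fun _ _ => add_mem) (fun _ _ => Submodule.smul_mem _ _) z

/-- The map on chains induced by the inclusion of a subcomplex. -/
noncomputable def chainsIncl {X : SymmDeltaComplex} (K : Subfunctor X) (k : ℕ) :
    SymmDeltaComplex.Chains K.toFunctor k →ₗ[ℚ] X.Chains k :=
  liftChains K.toFunctor (fun x => X.chain x.1) (fun x ρ => X.chain_pull_perm x.1 ρ)

@[simp]
theorem chainsIncl_chain {X : SymmDeltaComplex} (K : Subfunctor X) {k : ℕ}
    (x : SymmDeltaComplex.simplices K.toFunctor k) :
    chainsIncl K k (chain K.toFunctor x) = X.chain x.1 :=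
  liftChains_chain ..

open Classical in
/-- The projection of the chains of `X` to those of the subcomplex `K` that kills the simplices
outside `K`. -/
noncomputable def chainsProj {X : SymmDeltaComplex} (K : Subfunctor X) (k : ℕ) :
    X.Chains k →ₗ[ℚ] SymmDeltaComplex.Chains K.toFunctor k :=
  X.liftChains (fun x =>
    if hx : x ∈ simplicesIn K k then chain K.toFunctor (toSimplexIn x hx) else 0) (by
    intro x ρ
    by_cases hx : x ∈ simplicesIn K k
    · rw [dif_pos hx, dif_pos ((pull_perm_mem_iff K ρ x).2 hx)]
      exact chain_pull_perm K.toFunctor (toSimplexIn x hx) ρ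
    · rw [dif_neg hx, dif_neg (mt (pull_perm_mem_iff K ρ x).1 hx), smul_zero])

theorem chainsProj_chain_of_mem {X : SymmDeltaComplex} {K : Subfunctor X} {k : ℕ}
    {x : X.simplices k} (hx : x ∈ simplicesIn K k) :
    chainsProj K k (X.chain x) = chain K.toFunctor (toSimplexIn x hx) :=
  (liftChains_chain ..).trans (dif_pos hx)

theorem chainsProj_chain_of_notMem {X : SymmDeltaComplex} {K : Subfunctor X} {k : ℕ}
    {x : X.simplices k} (hx : x ∉ simplicesIn K k) : chainsProj K k (X.chain x) = 0 :=
  (liftChains_chain ..).trans (dif_neg hx)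

theorem chainsProj_incl {X : SymmDeltaComplex} (K : Subfunctor X) {k : ℕ}
    (z : SymmDeltaComplex.Chains K.toFunctor k) : chainsProj K k (chainsIncl K k z) = z := by
  have : chainsProj K k ∘ₗ chainsIncl K k = LinearMap.id :=
    chains_hom_ext fun x => by
      rw [LinearMap.comp_apply, chainsIncl_chain, chainsProj_chain_of_mem x.2]; rfl
  exact LinearMap.congr_fun this z

theorem chainsIncl_mem {X : SymmDeltaComplex} (K : Subfunctor X) {k : ℕ}
    (z : SymmDeltaComplex.Chains K.toFunctor k) : chainsIncl K k z ∈ chainsIn K k := by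
  refine chains_induction (p := fun z => chainsIncl K k z ∈ chainsIn K k) ?_ ?_ ?_ ?_ z
  · rw [map_zero]; exact zero_mem _
  · intro x; rw [chainsIncl_chain]; exact chain_mem_chainsIn x.2
  · intro a b ha hb; rw [map_add]; exact add_mem ha hb
  · intro q a ha; rw [map_smul]; exact Submodule.smul_mem _ _ ha

theorem chainsIncl_proj {X : SymmDeltaComplex} {K : Subfunctor X} {k : ℕ} {z : X.Chains k}
    (hz : z ∈ chainsIn K k) : chainsIncl K k (chainsProj K k z) = z := by
  have h : chainsIn K k ≤ LinearMap.eqLocus (chainsIncl K k ∘ₗ chainsProj K k) LinearMap.id := by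
    refine Submodule.span_le.2 ?_
    rintro _ ⟨x, hx, rfl⟩
    change chainsIncl K k (chainsProj K k (X.chain x)) = X.chain x
    rw [chainsProj_chain_of_mem hx, chainsIncl_chain]
    rfl
  exact h hz

theorem chainsIncl_boundary {X : SymmDeltaComplex} (K : Subfunctor X) {k : ℕ}
    (z : SymmDeltaComplex.Chains K.toFunctor (k + 1)) :
    chainsIncl K k (boundary K.toFunctor k z) = X.boundary k (chainsIncl K (k + 1) z) := by
  have : chainsIncl K k ∘ₗ boundary K.toFunctor k = X.boundary k ∘ₗ chainsIncl K (k + 1) :=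
    chains_hom_ext fun x => by
      rw [LinearMap.comp_apply, LinearMap.comp_apply, chainsIncl_chain, boundary_chain,
        boundary_chain, facesSum, facesSum, map_sum]
      refine Finset.sum_congr rfl fun j _ => ?_
      rw [map_smul, chainsIncl_chain]
      rfl
  exact LinearMap.congr_fun this z

/-- The projection to the chains of `K` maps chains of `L` to chains of `K ⊓ L`, because it maps
each simplex to itself or to zero. -/
theorem mem_chainsIn_inf {X : SymmDeltaComplex} {K L : Subfunctor X} {k : ℕ} {z : X.Chains k}
    (hK : z ∈ chainsIn K k) (hL : z ∈ chainsIn L k) : z ∈ chainsIn (K ⊓ L) k := by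
  rw [← chainsIncl_proj hK]
  have h : chainsIn L k ≤
      Submodule.comap (chainsIncl K k ∘ₗ chainsProj K k) (chainsIn (K ⊓ L) k) := by
    refine Submodule.span_le.2 ?_
    rintro _ ⟨x, hx, rfl⟩
    change chainsIncl K k (chainsProj K k (X.chain x)) ∈ chainsIn (K ⊓ L) k
    by_cases hx' : x ∈ simplicesIn K k
    · rw [chainsProj_chain_of_mem hx', chainsIncl_chain]
      exact chain_mem_chainsIn ⟨hx', hx⟩
    · rw [chainsProj_chain_of_notMem hx', map_zero]
      exact zero_mem _
  exact h hL

/-! ### Acyclicity -/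

/-- Cycles of the augmented cellular chain complex; in the lowest degree every chain is a cycle. -/
def IsCycle (X : SymmDeltaComplex) : ∀ k, X.Chains k → Prop
  | 0, _ => True
  | k + 1, z => X.boundary k z = 0

theorem isCycle_boundary (X : SymmDeltaComplex) :
    ∀ k (z : X.Chains (k + 1)), X.IsCycle k (X.boundary k z)
  | 0, _ => trivial
  | k + 1, z => X.boundary_boundary k z

theorem IsCycle.sub {X : SymmDeltaComplex} : ∀ {k} {y z : X.Chains k}, X.IsCycle k y →
    X.IsCycle k z → X.IsCycle k (y - z)
  | 0, _, _, _, _ => trivial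
  | k + 1, y, z, hy, hz => by
    change X.boundary k (y - z) = 0
    rw [map_sub, hy, hz, sub_zero]

theorem IsCycle.smul {X : SymmDeltaComplex} (q : ℚ) : ∀ {k} {z : X.Chains k}, X.IsCycle k z →
    X.IsCycle k (q • z)
  | 0, _, _ => trivial
  | k + 1, z, hz => by
    change X.boundary k (q • z) = 0
    rw [map_smul, hz, smul_zero]

/-- The augmented chain complex of the subcomplex `K` is exact, expressed inside the chains
of `X`. -/
def AcyclicOn {X : SymmDeltaComplex} (K : Subfunctor X) : Prop :=
  ∀ k, ∀ z ∈ chainsIn K k, X.IsCycle k z → ∃ w ∈ chainsIn K (k + 1), X.boundary k w = z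

theorem cellularChainComplex_d (X : SymmDeltaComplex) (k : ℕ) :
    X.cellularChainComplex.d (k + 1) k = ModuleCat.ofHom (X.boundary k) :=
  ChainComplex.of_d (fun k => ModuleCat.of ℚ (X.Chains k))
    (fun k => ModuleCat.ofHom (X.boundary k)) _

theorem exactAt_of_forall (X : SymmDeltaComplex) (k : ℕ)
    (h : ∀ z : X.Chains k, X.IsCycle k z → ∃ w, X.boundary k w = z) :
    X.cellularChainComplex.ExactAt k := by
  cases k with
  | zero =>
    rw [HomologicalComplex.exactAt_iff' _ 1 0 0 (by simp) (by simp),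
      ShortComplex.moduleCat_exact_iff]
    intro z _
    obtain ⟨w, hw⟩ := h z trivial
    refine ⟨w, ?_⟩
    change (X.cellularChainComplex.d 1 0).hom w = z
    rw [cellularChainComplex_d]
    exact hw
  | succ k =>
    rw [HomologicalComplex.exactAt_iff' _ (k + 2) (k + 1) k (by simp) (by simp),
      ShortComplex.moduleCat_exact_iff]
    intro z hz
    change (X.cellularChainComplex.d (k + 1) k).hom z = 0 at hz
    rw [cellularChainComplex_d] at hz
    obtain ⟨w, hw⟩ := h z hz
    refine ⟨w, ?_⟩
    change (X.cellularChainComplex.d (k + 1 + 1) (k + 1)).hom w = z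
    rw [cellularChainComplex_d]
    exact hw

theorem AcyclicOn.isZero_reducedHomology {X : SymmDeltaComplex} {K : Subfunctor X}
    (h : AcyclicOn K) (k : ℕ) : Limits.IsZero (reducedHomology K.toFunctor k) := by
  unfold reducedHomology
  rw [← HomologicalComplex.exactAt_iff_isZero_homology]
  refine exactAt_of_forall _ k fun z hz => ?_
  obtain ⟨w, hw, hwz⟩ := h k _ (chainsIncl_mem K z) (by
    cases k with
    | zero => trivial
    | succ k =>
      change X.boundary k _ = 0
      rw [← chainsIncl_boundary, show boundary K.toFunctor k z = 0 from hz, map_zero])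
  refine ⟨chainsProj K (k + 1) w, ?_⟩
  rw [← chainsProj_incl K (boundary _ _ _), chainsIncl_boundary, chainsIncl_proj hw, hwz,
    chainsProj_incl]

theorem AcyclicOn.acyclic {X : SymmDeltaComplex} (h : AcyclicOn (⊤ : Subfunctor X)) :
    X.cellularChainComplex.Acyclic := fun k => exactAt_of_forall X k fun z hz => by
  obtain ⟨w, -, hw⟩ := h k z (by rw [chainsIn_top]; trivial) hz
  exact ⟨w, hw⟩

/-- Mayer–Vietoris. -/
theorem AcyclicOn.sup {X : SymmDeltaComplex} {K L : Subfunctor X} (hK : AcyclicOn K)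
    (hL : AcyclicOn L) (hKL : AcyclicOn (K ⊓ L)) : AcyclicOn (K ⊔ L) := by
  intro k z hz hc
  rw [chainsIn_sup] at hz
  obtain ⟨x, hx, y, hy, rfl⟩ := Submodule.mem_sup.1 hz
  -- modify `x` and `y` by a common chain of `K ⊓ L` so that both become cycles
  obtain ⟨w, hw, hxw, hyw⟩ : ∃ w ∈ chainsIn (K ⊓ L) k, X.IsCycle k (x - w) ∧
      X.IsCycle k (y + w) := by
    cases k with
    | zero => exact ⟨0, zero_mem _, trivial, trivial⟩
    | succ k =>
      have hc : X.boundary k (x + y) = 0 := hc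
      rw [map_add] at hc
      obtain ⟨w, hw, hwx⟩ := hKL k (X.boundary k x) (mem_chainsIn_inf (boundary_mem_chainsIn hx) (by
        rw [eq_neg_of_add_eq_zero_left hc]
        exact neg_mem (boundary_mem_chainsIn hy))) (X.isCycle_boundary k x)
      refine ⟨w, hw, ?_, ?_⟩
      · change X.boundary k (x - w) = 0
        rw [map_sub, hwx, sub_self]
      · change X.boundary k (y + w) = 0
        rw [map_add, hwx, add_comm, hc]
  obtain ⟨a, ha, hax⟩ := hK k _ (sub_mem hx (chainsIn_mono inf_le_left k hw)) hxw
  obtain ⟨b, hb, hby⟩ := hL k _ (add_mem hy (chainsIn_mono inf_le_right k hw)) hyw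
  refine ⟨a + b, ?_, ?_⟩
  · rw [chainsIn_sup]; exact Submodule.add_mem_sup ha hb
  · rw [map_add, hax, hby]; abel

theorem acyclicOn_bot (X : SymmDeltaComplex) : AcyclicOn (⊥ : Subfunctor X) := by
  intro k z hz _
  have : z = 0 := by
    have h : chainsIn (⊥ : Subfunctor X) k = ⊥ := by
      unfold chainsIn
      rw [Submodule.span_eq_bot]
      rintro _ ⟨x, hx, _⟩
      exact hx.elim
    rwa [h, Submodule.mem_bot] at hz
  exact ⟨0, zero_mem _, by rw [map_zero, this]⟩

/-- A finite union of members of a family of acyclic subcomplexes that is closed under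
intersections is acyclic. -/
theorem acyclicOn_biSup {X : SymmDeltaComplex} {𝓕 : Set (Subfunctor X)}
    (hinf : ∀ K ∈ 𝓕, ∀ L ∈ 𝓕, K ⊓ L ∈ 𝓕) (hac : ∀ K ∈ 𝓕, AcyclicOn K) {ι : Type*}
    (t : Finset ι) (f : ι → Subfunctor X) (hf : ∀ i ∈ t, f i ∈ 𝓕) : AcyclicOn (⨆ i ∈ t, f i) := by
  classical
  induction t using Finset.induction_on generalizing f with
  | empty => simpa using acyclicOn_bot X
  | insert a t ha ih =>
    rw [Finset.iSup_insert]
    refine (hac _ (hf a (Finset.mem_insert_self a t))).sup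
      (ih f fun i hi => hf i (Finset.mem_insert_of_mem hi)) ?_
    rw [inf_comm, Subfunctor.iSup_min]
    simp only [Subfunctor.iSup_min]
    exact ih _ fun i hi => hinf _ (hf i (Finset.mem_insert_of_mem hi)) _
      (hf a (Finset.mem_insert_self a t))

/-- A candidate chain homotopy composed with the boundary; in the lowest degree it is zero. -/
noncomputable def afterBoundary {X : SymmDeltaComplex}
    (h : ∀ k, X.Chains k →ₗ[ℚ] X.Chains (k + 1)) : ∀ k, X.Chains k →ₗ[ℚ] X.Chains k
  | 0 => 0
  | k + 1 => h k ∘ₗ X.boundary k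

theorem afterBoundary_of_isCycle {X : SymmDeltaComplex}
    (h : ∀ k, X.Chains k →ₗ[ℚ] X.Chains (k + 1)) :
    ∀ {k} {z : X.Chains k}, X.IsCycle k z → afterBoundary h k z = 0
  | 0, _, _ => rfl
  | k + 1, z, hz => by
    change h k (X.boundary k z) = 0
    rw [show X.boundary k z = 0 from hz, map_zero]

/-- A subcomplex is acyclic as soon as it has an operator `h` for which `∂h + h∂` is triangular
with positive diagonal entries with respect to a bounded filtration. -/
theorem AcyclicOn.of_triangular_homotopy {X : SymmDeltaComplex} {K : Subfunctor X}
    (rank : ∀ k, X.simplices k → ℕ) (hrank : ∀ k x, rank k x ≤ k)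
    (h : ∀ k, X.Chains k →ₗ[ℚ] X.Chains (k + 1))
    (hK : ∀ k, ∀ x ∈ simplicesIn K k, h k (X.chain x) ∈ chainsIn K (k + 1))
    (hD : ∀ k, ∀ x ∈ simplicesIn K k, ∃ N : ℕ, 0 < N ∧
      X.boundary k (h k (X.chain x)) + afterBoundary h k (X.chain x) - (N : ℚ) • X.chain x ∈
        Submodule.span ℚ (X.chain '' {y | y ∈ simplicesIn K k ∧ rank k x < rank k y})) :
    AcyclicOn K := by
  intro k
  choose! N hN0 hN using hD k
  let D : X.Chains k →ₗ[ℚ] X.Chains k := X.boundary k ∘ₗ h k + afterBoundary h k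
  have hDc : ∀ z, X.IsCycle k z → D z = X.boundary k (h k z) := fun z hz => by
    change X.boundary k (h k z) + afterBoundary h k z = _
    rw [afterBoundary_of_isCycle h hz, add_zero]
  have hhK : ∀ z ∈ chainsIn K k, h k z ∈ chainsIn K (k + 1) := by
    intro z hz
    have : chainsIn K k ≤ (chainsIn K (k + 1)).comap (h k) := by
      refine Submodule.span_le.2 ?_
      rintro _ ⟨x, hx, rfl⟩
      exact hK k x hx
    exact this hz
  -- The diagonal entries may differ among simplices of one rank, so the filtration is refined to
  -- one by pairs (rank, diagonal entry), spanned by the simplices of larger rank, or of the same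
  -- rank and diagonal entry at most `M`.
  let W : ℕ → ℕ → Submodule ℚ (X.Chains k) := fun m M => Submodule.span ℚ
    (X.chain '' {y | y ∈ simplicesIn K k ∧ (m < rank k y ∨ rank k y = m ∧ N y ≤ M)})
  have hWmono : ∀ m M M', M ≤ M' → W m M ≤ W m M' := by
    intro m M M' hM
    refine Submodule.span_mono (Set.image_mono ?_)
    rintro y ⟨hy, h1 | h1⟩
    · exact ⟨hy, Or.inl h1⟩
    · exact ⟨hy, Or.inr ⟨h1.1, h1.2.trans hM⟩⟩
  have hWK : ∀ m M, W m M ≤ chainsIn K k := fun m M =>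
    Submodule.span_mono (Set.image_mono fun y hy => hy.1)
  -- subtracting `(M + 1)⁻¹ • D z`, which is a boundary if `z` is a cycle, lowers the filtration
  have hstep : ∀ m M, W m (M + 1) ≤ (W m M).comap (((M + 1 : ℕ) : ℚ) • LinearMap.id - D) := by
    intro m M
    refine Submodule.span_le.2 ?_
    rintro _ ⟨x, ⟨hx, hxm⟩, rfl⟩
    change ((M + 1 : ℕ) : ℚ) • X.chain x - D (X.chain x) ∈ W m M
    have h1 : D (X.chain x) - (N x : ℚ) • X.chain x ∈ W m M := by
      refine Submodule.span_mono (Set.image_mono ?_) (hN x hx)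
      rintro y ⟨hy, hxy⟩
      refine ⟨hy, Or.inl ?_⟩
      rcases hxm with h | h <;> omega
    have h2 : (((M + 1 : ℕ) : ℚ) - N x) • X.chain x ∈ W m M := by
      by_cases hc : rank k x = m ∧ N x = M + 1
      · rw [hc.2, sub_self, zero_smul]; exact zero_mem _
      · refine Submodule.smul_mem _ _ (Submodule.subset_span ⟨x, ⟨hx, ?_⟩, rfl⟩)
        rcases hxm with h | h
        · exact Or.inl h
        · refine Or.inr ⟨h.1, ?_⟩
          have := h.2
          by_contra hlt
          exact hc ⟨h.1, by omega⟩
    have := sub_mem h2 h1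
    rw [sub_smul] at this
    convert this using 1
    abel
  have key : ∀ d m, k + 1 ≤ m + d → ∀ M, ∀ z ∈ W m M, X.IsCycle k z →
      ∃ w ∈ chainsIn K (k + 1), X.boundary k w = z := by
    intro d
    induction d with
    | zero =>
      intro m hm M z hz _
      have : W m M = ⊥ := by
        refine Submodule.span_eq_bot.2 ?_
        rintro _ ⟨y, ⟨_, hy⟩, rfl⟩
        have := hrank k y
        rcases hy with h | h <;> omega
      rw [this, Submodule.mem_bot] at hz
      exact ⟨0, zero_mem _, by rw [map_zero, hz]⟩
    | succ d ihd =>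
      intro m hm M
      induction M with
      | zero =>
        intro z hz hc
        -- diagonal entries are positive, so only simplices of larger rank are left
        have hz' : ∃ M, z ∈ W (m + 1) M := by
          refine Submodule.span_induction (p := fun z _ => ∃ M, z ∈ W (m + 1) M) ?_ ?_ ?_ ?_ hz
          · rintro _ ⟨y, ⟨hy, h1⟩, rfl⟩
            refine ⟨N y, Submodule.subset_span ⟨y, ⟨hy, ?_⟩, rfl⟩⟩
            rcases h1 with h1 | h1
            · rcases Nat.lt_or_eq_of_le (Nat.succ_le_of_lt h1) with h2 | h2
              · exact Or.inl h2
              · exact Or.inr ⟨h2.symm, le_rfl⟩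
            · have := hN0 y hy; omega
          · exact ⟨0, zero_mem _⟩
          · rintro a b _ _ ⟨M, hM⟩ ⟨M', hM'⟩
            exact ⟨max M M', add_mem (hWmono _ _ _ (le_max_left _ _) hM)
              (hWmono _ _ _ (le_max_right _ _) hM')⟩
          · rintro q a _ ⟨M, hM⟩
            exact ⟨M, Submodule.smul_mem _ _ hM⟩
        obtain ⟨M, hM⟩ := hz'
        exact ihd (m + 1) (by omega) M z hM hc
      | succ M ihM =>
        intro z hz hc
        have hz' := hstep m M hz
        have hz'e : (((M + 1 : ℕ) : ℚ) • (LinearMap.id : X.Chains k →ₗ[ℚ] X.Chains k) - D) z =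
            ((M + 1 : ℕ) : ℚ) • z - X.boundary k (h k z) := by
          rw [← hDc z hc]; rfl
        rw [Submodule.mem_comap, hz'e] at hz'
        obtain ⟨w, hw, hwz⟩ := ihM _ hz' ((hc.smul _).sub (X.isCycle_boundary k _))
        refine ⟨(((M + 1 : ℕ) : ℚ))⁻¹ • (w + h k z), Submodule.smul_mem _ _
          (add_mem hw (hhK z (hWK _ _ hz))), ?_⟩
        rw [map_smul, map_add, hwz, sub_add_cancel, smul_smul, inv_mul_cancel₀, one_smul]
        exact_mod_cast Nat.succ_ne_zero M
  intro z hz hc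
  obtain ⟨M, hM⟩ : ∃ M, z ∈ W 0 M := by
    refine Submodule.span_induction (p := fun z _ => ∃ M, z ∈ W 0 M) ?_ ?_ ?_ ?_ hz
    · rintro _ ⟨y, hy, rfl⟩
      refine ⟨N y, Submodule.subset_span ⟨y, ⟨hy, ?_⟩, rfl⟩⟩
      rcases Nat.eq_zero_or_pos (rank k y) with h1 | h1
      · exact Or.inr ⟨h1, le_rfl⟩
      · exact Or.inl h1
    · exact ⟨0, zero_mem _⟩
    · rintro a b _ _ ⟨M, hM⟩ ⟨M', hM'⟩
      exact ⟨max M M', add_mem (hWmono _ _ _ (le_max_left _ _) hM)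
        (hWmono _ _ _ (le_max_right _ _) hM')⟩
    · rintro q a _ ⟨M, hM⟩
      exact ⟨M, Submodule.smul_mem _ _ hM⟩
  exact key (k + 1) 0 (by omega) M z hM hc

end SymmDeltaComplex

/-! ### Sections of a cover of a tree -/

/-- An isomorphism of graphs without isolated vertices is given by a bijection of half-edges
that commutes with the involutions and preserves the relation of having the same root. -/
noncomputable def HEGraph.Iso.ofHalfEdges {C D : HEGraph} (hC : ∀ v, (C.star v).Nonempty)
    (hD : ∀ v, (D.star v).Nonempty) (e : C.H ≃ D.H) (hi : ∀ h, e (C.i h) = D.i (e h))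
    (hr : ∀ h h', C.r h = C.r h' ↔ D.r (e h) = D.r (e h')) : HEGraph.Iso C D where
  eV := Equiv.ofBijective (fun v => D.r (e (hC v).some)) (by
    constructor
    · intro v w hvw
      have := (hr _ _).2 hvw
      rwa [show C.r (hC v).some = v from (hC v).some_mem,
        show C.r (hC w).some = w from (hC w).some_mem] at this
    · intro w
      obtain ⟨h, rfl⟩ := hD w
      obtain ⟨h, rfl⟩ := e.surjective h
      exact ⟨C.r h, (hr _ _).1 (hC (C.r h)).some_mem⟩)
  eH := e
  map_i := hi
  map_r h := (hr _ _).1 (hC (C.r h)).some_mem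

/-- A vertex is ramified when some half-edge at it has nontrivial monodromy; its fibre in the cover
is then a single vertex. -/
def HEGraph.Ram (C : HEGraph) (μ : C.H → ZMod 2) (v : C.V) : Prop := ∃ h ∈ C.star v, μ h = 1

namespace AdmissibleCover

theorem star_nonempty (X : AdmissibleCover) (v : X.C.V) : (X.C.star v).Nonempty := by
  rw [← Set.ncard_pos]
  have := X.stable v
  omega

theorem star_nonempty_source (X : AdmissibleCover) (x : X.P.V) : (X.P.star x).Nonempty := by
  obtain ⟨h, hh⟩ := X.star_nonempty (X.fV x)
  obtain ⟨k, -, hk⟩ := X.exists_lift_half (h := h) hh.symm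
  exact ⟨k, hk⟩

/-- A section over the half-edges of the morphism of graphs `P → C`; it is compatible with roots, so
it induces a section over the vertices. -/
structure Section (X : AdmissibleCover) where
  s : X.C.H → X.P.H
  f_s : ∀ h, X.fH (s h) = h
  i_s : ∀ h, X.P.i (s h) = s (X.C.i h)
  r_s : ∀ h h', X.C.r h = X.C.r h' → X.P.r (s h) = X.P.r (s h')

/-- A cover of a tree has a section: lift every vertex with its star, then make the lifts agree
along one edge after the other, flipping each time the lifts on one side of the edge. -/
theorem exists_section (X : AdmissibleCover) (hleg : ∀ k, X.fH k ∈ X.C.legs → k ∈ X.P.legs) :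
    Nonempty X.Section := by
  classical
  have key : ∀ F : Set X.C.H, X.C.IsEdgeSet F → ∃ s : X.C.H → X.P.H, (∀ h, X.fH (s h) = h) ∧
      (∀ h h', X.C.r h = X.C.r h' → X.P.r (s h) = X.P.r (s h')) ∧
      ∀ h ∈ F, X.P.i (s h) = s (X.C.i h) := by
    intro F hF
    refine HEGraph.IsEdgeSet.rec_on (p := fun F => ∃ s : X.C.H → X.P.H, (∀ h, X.fH (s h) = h) ∧
      (∀ h h', X.C.r h = X.C.r h' → X.P.r (s h) = X.P.r (s h')) ∧
      ∀ h ∈ F, X.P.i (s h) = s (X.C.i h)) ?_ ?_ hF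
    · choose sV hsV using X.fV_surjective
      choose s hs hs' using fun h => X.exists_lift_half (h := h) (hsV (X.C.r h))
      exact ⟨s, hs, fun h h' hh => by rw [hs', hs', hh], fun h hh => hh.elim⟩
    · intro F hF h hh ⟨s, hs, hr, hi⟩
      have hmem : ∀ a ∈ F, a ∈ F \ {h, X.C.i h} ∨ a = h ∨ a = X.C.i h := by
        intro a ha
        by_cases h1 : a = h ∨ a = X.C.i h
        · exact Or.inr h1
        · exact Or.inl ⟨ha, h1⟩
      rcases X.fH_fibre (X.P.i (s h)) (s (X.C.i h)) (by rw [X.f_i, hs, hs]) with h1 | h1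
      · refine ⟨s, hs, hr, fun a ha => ?_⟩
        rcases hmem a ha with h2 | rfl | rfl
        · exact hi a h2
        · exact h1.symm
        · rw [h1, X.P.i_i, X.C.i_i]
      · have hnot : ¬ X.C.Conn (F \ {h, X.C.i h}) (X.C.r h) (X.C.r (X.C.i h)) :=
          X.tree.not_conn (hF h hh).2
        refine ⟨fun a => if X.C.Conn (F \ {h, X.C.i h}) (X.C.r h) (X.C.r a) then X.σH (s a)
          else s a, ?_, ?_, ?_⟩
        · intro a
          beta_reduce
          split_ifs
          · rw [X.f_σH, hs]
          · exact hs a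
        · intro a b hab
          beta_reduce
          rw [hab]
          split_ifs
          · rw [← X.σ_r, ← X.σ_r, hr a b hab]
          · exact hr a b hab
        · intro a ha
          beta_reduce
          rcases hmem a ha with h2 | rfl | rfl
          · have h3 : X.C.Conn (F \ {h, X.C.i h}) (X.C.r h) (X.C.r (X.C.i a)) ↔
                X.C.Conn (F \ {h, X.C.i h}) (X.C.r h) (X.C.r a) :=
              ⟨fun h4 => h4.trans (HEGraph.Conn.step h2).symm,
                fun h4 => h4.trans (HEGraph.Conn.step h2)⟩
            simp only [h3]
            split_ifs
            · rw [← X.σ_i, hi a h2]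
            · exact hi a h2
          · rw [if_pos (HEGraph.Conn.refl _), if_neg hnot, ← X.σ_i, h1]
          · rw [if_neg hnot, X.C.i_i, if_pos (HEGraph.Conn.refl _), h1, ← X.σ_i, X.P.i_i]
  obtain ⟨s, hs, hr, hi⟩ := key {h | X.C.i h ≠ h} (fun h hh => ⟨by
    rw [Set.mem_ofPred_eq, X.C.i_i]; exact Ne.symm hh, hh⟩)
  refine ⟨⟨s, hs, fun h => ?_, hr⟩⟩
  by_cases hh : X.C.i h = h
  · rw [hh]
    exact hleg (s h) (by rw [hs]; exact hh)
  · exact hi h hh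

namespace Section

theorem eq_or {X : AdmissibleCover} (s : X.Section) (k : X.P.H) :
    k = s.s (X.fH k) ∨ k = X.σH (s.s (X.fH k)) :=
  X.fH_fibre _ _ (s.f_s _)

theorem ext_of_iff {X : AdmissibleCover} (s : X.Section) {k l : X.P.H} (h : X.fH k = X.fH l)
    (h' : k = s.s (X.fH k) ↔ l = s.s (X.fH l)) : k = l := by
  by_cases hk : k = s.s (X.fH k)
  · rw [hk, h'.1 hk, ← h, ← hk]
  · rw [(s.eq_or k).resolve_left hk, (s.eq_or l).resolve_left (mt h'.2 hk), h]

/-- Two half-edges of the source over half-edges with the same root have the same root if and only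
if this root is ramified or the section treats them alike. -/
theorem root_eq_iff {X : AdmissibleCover} (s : X.Section) {k l : X.P.H}
    (h : X.C.r (X.fH k) = X.C.r (X.fH l)) : X.P.r k = X.P.r l ↔
      X.C.Ram X.μ (X.C.r (X.fH k)) ∨ (k = s.s (X.fH k) ↔ l = s.s (X.fH l)) := by
  have hf : X.fV (X.P.r k) = X.fV (X.P.r l) := by rw [X.f_r, X.f_r, h]
  by_cases hram : X.C.Ram X.μ (X.C.r (X.fH k))
  · refine iff_of_true ?_ (Or.inl hram)
    rw [← X.f_r] at hram
    rcases X.fV_fibre _ _ hf with h1 | h1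
    · exact h1.symm
    · rw [h1, (X.σV_eq_iff _).2 hram]
  · have hne : ∀ x, X.fV x = X.C.r (X.fH k) → X.σV x ≠ x := by
      intro x hx hσ
      apply hram
      rw [← hx]
      exact (X.σV_eq_iff _).1 hσ
    rw [or_iff_right hram]
    have hs := s.r_s _ _ h
    have hv : X.fV (X.P.r (s.s (X.fH k))) = X.C.r (X.fH k) := by rw [X.f_r, s.f_s]
    have hv' : X.fV (X.P.r (s.s (X.fH l))) = X.C.r (X.fH k) := by rw [X.f_r, s.f_s, h]
    constructor
    · intro hr
      constructor
      · intro hk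
        by_contra hl
        have hl' := (s.eq_or l).resolve_left hl
        rw [hk, hl', ← X.σ_r, hs] at hr
        exact hne _ hv' hr.symm
      · intro hl
        by_contra hk
        have hk' := (s.eq_or k).resolve_left hk
        rw [hk', hl, ← X.σ_r, ← hs] at hr
        exact hne _ hv hr
    · intro hr
      by_cases hk : k = s.s (X.fH k)
      · rw [hk, hr.1 hk, hs]
      · rw [(s.eq_or k).resolve_left hk, (s.eq_or l).resolve_left (mt hr.2 hk), ← X.σ_r,
          ← X.σ_r, hs]

open Classical in
/-- The map between the half-edges of the sources of two covers that matches two given sections. -/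
noncomputable def transfer {X Y : AdmissibleCover} (s : X.Section) (t : Y.Section)
    (e : X.C.H ≃ Y.C.H) (k : X.P.H) : Y.P.H :=
  if k = s.s (X.fH k) then t.s (e (X.fH k)) else Y.σH (t.s (e (X.fH k)))

theorem fH_transfer {X Y : AdmissibleCover} (s : X.Section) (t : Y.Section)
    (e : X.C.H ≃ Y.C.H) (k : X.P.H) : Y.fH (s.transfer t e k) = e (X.fH k) := by
  unfold transfer
  split_ifs
  · exact t.f_s _
  · rw [Y.f_σH, t.f_s]

theorem transfer_eq_iff {X Y : AdmissibleCover} (s : X.Section) (t : Y.Section)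
    (e : X.C.H ≃ Y.C.H) (hμ : ∀ h, Y.μ (e h) = X.μ h) (k : X.P.H) :
    s.transfer t e k = t.s (Y.fH (s.transfer t e k)) ↔ k = s.s (X.fH k) := by
  rw [fH_transfer]
  unfold transfer
  by_cases hk : k = s.s (X.fH k)
  · rw [if_pos hk]
    exact iff_of_true rfl hk
  · rw [if_neg hk]
    refine iff_of_false (fun h => hk ?_) hk
    rw [Y.σH_eq_iff, t.f_s, hμ] at h
    have h2 := (s.eq_or k).resolve_left hk
    rw [h2, (X.σH_eq_iff _).2 (by rw [s.f_s]; exact h), s.f_s]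

/-- The bijection between the half-edges of the sources of two covers that matches two sections. -/
noncomputable def transferEquiv {X Y : AdmissibleCover} (s : X.Section) (t : Y.Section)
    (e : X.C.H ≃ Y.C.H) (hμ : ∀ h, Y.μ (e h) = X.μ h) : X.P.H ≃ Y.P.H where
  toFun := s.transfer t e
  invFun := t.transfer s e.symm
  left_inv k := s.ext_of_iff (by rw [fH_transfer, fH_transfer, e.symm_apply_apply]) (by
    rw [transfer_eq_iff t s e.symm (fun h => by rw [← hμ, e.apply_symm_apply]),
      transfer_eq_iff s t e hμ])
  right_inv k := t.ext_of_iff (by rw [fH_transfer, fH_transfer, e.apply_symm_apply]) (by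
    rw [transfer_eq_iff s t e hμ,
      transfer_eq_iff t s e.symm (fun h => by rw [← hμ, e.apply_symm_apply])])

/-- Sections of two covers extend an isomorphism of the targets to the sources. -/
noncomputable def isoSource {X Y : AdmissibleCover} (s : X.Section) (t : Y.Section)
    (ψ : HEGraph.Iso X.C Y.C) (hμ : ∀ h, Y.μ (ψ.eH h) = X.μ h) : HEGraph.Iso X.P Y.P :=
  HEGraph.Iso.ofHalfEdges X.star_nonempty_source Y.star_nonempty_source
    (s.transferEquiv t ψ.eH hμ)
    (fun k => t.ext_of_iff (by
      change Y.fH (s.transfer t _ _) = Y.fH (Y.P.i (s.transfer t _ _))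
      rw [Y.f_i, fH_transfer, fH_transfer, X.f_i, ψ.map_i]) (by
      change s.transfer t _ _ = t.s (Y.fH (s.transfer t _ _)) ↔
        Y.P.i (s.transfer t _ _) = t.s (Y.fH (Y.P.i (s.transfer t _ _)))
      have hX : X.P.i k = s.s (X.fH (X.P.i k)) ↔ k = s.s (X.fH k) := by
        rw [X.f_i, ← s.i_s, (Function.LeftInverse.injective X.P.i_i).eq_iff]
      have hY : ∀ l, Y.P.i l = t.s (Y.fH (Y.P.i l)) ↔ l = t.s (Y.fH l) := by
        intro l
        rw [Y.f_i, ← t.i_s, (Function.LeftInverse.injective Y.P.i_i).eq_iff]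
      rw [hY, transfer_eq_iff s t _ hμ, transfer_eq_iff s t _ hμ, hX]))
    (fun k l => by
      change _ ↔ Y.P.r (s.transfer t _ _) = Y.P.r (s.transfer t _ _)
      have hrr : ∀ h h', Y.C.r (ψ.eH h) = Y.C.r (ψ.eH h') ↔ X.C.r h = X.C.r h' := by
        intro h h'
        rw [← ψ.map_r, ← ψ.map_r, ψ.eV.injective.eq_iff]
      have hram : ∀ h, Y.C.Ram Y.μ (Y.C.r (ψ.eH h)) ↔ X.C.Ram X.μ (X.C.r h) := by
        intro h
        constructor
        · rintro ⟨a, ha, ha'⟩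
          obtain ⟨a, rfl⟩ := ψ.eH.surjective a
          exact ⟨a, (hrr _ _).1 ha, by rw [← hμ]; exact ha'⟩
        · rintro ⟨a, ha, ha'⟩
          exact ⟨ψ.eH a, (hrr _ _).2 ha, by rw [hμ]; exact ha'⟩
      by_cases hkl : X.C.r (X.fH k) = X.C.r (X.fH l)
      · rw [s.root_eq_iff hkl, t.root_eq_iff (by rw [fH_transfer, fH_transfer, hrr]; exact hkl),
          transfer_eq_iff s t _ hμ, transfer_eq_iff s t _ hμ, fH_transfer, hram]
      · refine iff_of_false (fun h => hkl ?_) (fun h => hkl ?_)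
        · rw [← X.f_r, ← X.f_r, h]
        · rw [← hrr, ← fH_transfer s t, ← fH_transfer s t, ← Y.f_r, ← Y.f_r, h])

/-- The other lift of every half-edge is a section too. -/
def flip {X : AdmissibleCover} (s : X.Section) : X.Section where
  s h := X.σH (s.s h)
  f_s h := by rw [X.f_σH, s.f_s]
  i_s h := by rw [← X.σ_i, s.i_s]
  r_s h h' hh := by rw [← X.σ_r, ← X.σ_r, s.r_s h h' hh]

/-- A section maps paths to paths. -/
theorem conn {X : AdmissibleCover} (s : X.Section) {F : Set X.C.H} {h h' : X.C.H}
    (hc : X.C.Conn F (X.C.r h) (X.C.r h')) :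
    X.P.Conn (X.fH ⁻¹' F) (X.P.r (s.s h)) (X.P.r (s.s h')) := by
  have := hc.induct (R := fun v w => ∀ h h', X.C.r h = v → X.C.r h' = w →
    X.P.Conn (X.fH ⁻¹' F) (X.P.r (s.s h)) (X.P.r (s.s h'))) ⟨?_, ?_, ?_⟩ ?_
  · exact this h h' rfl rfl
  · intro v h h' h1 h2
    rw [s.r_s h h' (h1.trans h2.symm)]
    exact HEGraph.Conn.refl _
  · intro v w ih h h' h1 h2
    exact (ih h' h h2 h1).symm
  · intro u v w ih ih' h h' h1 h2
    obtain ⟨a, ha⟩ := X.star_nonempty v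
    exact (ih h a h1 ha).trans (ih' a h' ha h2)
  · intro a ha h h' h1 h2
    rw [s.r_s h a h1, s.r_s h' _ h2, ← s.i_s]
    refine HEGraph.Conn.step ?_
    rw [Set.mem_preimage, s.f_s]
    exact ha

/-- The section of a contraction induced by a section. -/
def contract {X : AdmissibleCover} (s : X.Section) {F : Set X.C.H} (hF : X.C.IsEdgeSet F) :
    (X.contract F hF).Section where
  s h := ⟨s.s h.1, by rw [Set.mem_preimage, s.f_s]; exact h.2⟩
  f_s h := Subtype.ext (s.f_s h.1)
  i_s h := Subtype.ext (s.i_s h.1)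
  r_s h h' hh := HEGraph.mk_eq_iff.2 (s.conn (HEGraph.mk_eq_iff.1 hh))

end Section

/-! ### The canonical cover of a tree -/

open Classical in
/-- The admissible cover of a tree with a given monodromy marking in which the two sheets are
labelled by `Bool`: the two sheets are glued over the vertices and the half-edges that have only one
preimage. -/
noncomputable def ofTree (C : HEGraph) (tree : C.IsTree) (stable : ∀ v, 3 ≤ (C.star v).ncard)
    (μ : C.H → ZMod 2) (μ_i : ∀ h, μ (C.i h) = - μ h) (μ_sum : ∀ v, ∑ᶠ h ∈ C.star v, μ h = 0) :
    AdmissibleCover where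
  C := C
  P :=
    { V := {p : C.V × Bool // C.Ram μ p.1 → p.2 = false}
      H := {p : C.H × Bool // μ p.1 = 1 → p.2 = false}
      i := fun p => ⟨(C.i p.1.1, p.1.2), fun h => p.2 (by rwa [μ_i, ZMod.neg_eq_self_mod_two] at h)⟩
      r := fun p => ⟨(C.r p.1.1, if C.Ram μ (C.r p.1.1) then false else p.1.2),
        fun h => if_pos h⟩
      i_i := fun p => Subtype.ext (Prod.ext (C.i_i _) rfl) }
  tree := tree
  stable := stable
  fV p := p.1.1
  fH p := p.1.1
  f_i _ := rfl
  f_r _ := rfl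
  σV p := ⟨(p.1.1, if C.Ram μ p.1.1 then false else !p.1.2), fun h => if_pos h⟩
  σH p := ⟨(p.1.1, if μ p.1.1 = 1 then false else !p.1.2), fun h => if_pos h⟩
  σV_σV := by
    rintro ⟨⟨v, b⟩, h⟩
    refine Subtype.ext (Prod.ext rfl ?_)
    by_cases hv : C.Ram μ v
    · simpa [hv] using h hv
    · simp [hv]
  σH_σH := by
    rintro ⟨⟨v, b⟩, h⟩
    refine Subtype.ext (Prod.ext rfl ?_)
    by_cases hv : μ v = 1
    · simpa [hv] using h hv
    · simp [hv]
  σ_i := by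
    rintro ⟨⟨v, b⟩, h⟩
    refine Subtype.ext (Prod.ext rfl ?_)
    simp [μ_i, ZMod.neg_eq_self_mod_two]
  σ_r := by
    rintro ⟨⟨v, b⟩, h⟩
    refine Subtype.ext (Prod.ext rfl ?_)
    by_cases hv : C.Ram μ (C.r v)
    · simp [hv]
    · have : μ v ≠ 1 := fun h1 => hv ⟨v, rfl, h1⟩
      simp [hv, this]
  f_σV _ := rfl
  f_σH _ := rfl
  μ := μ
  μ_i := μ_i
  μ_sum := μ_sum
  fV_surjective v := ⟨⟨(v, false), fun _ => rfl⟩, rfl⟩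
  fV_fibre := by
    rintro ⟨⟨v, b⟩, h⟩ ⟨⟨w, c⟩, h'⟩ hvw
    obtain rfl : v = w := hvw
    by_cases hv : C.Ram μ v
    · exact Or.inl (Subtype.ext (Prod.ext rfl ((h' hv).trans (h hv).symm)))
    · rcases Bool.eq_or_eq_not c b with rfl | rfl
      · exact Or.inl rfl
      · exact Or.inr (Subtype.ext (Prod.ext rfl (if_neg hv).symm))
  σV_eq_iff := by
    rintro ⟨⟨v, b⟩, h⟩
    change _ ↔ C.Ram μ v
    rw [Subtype.ext_iff, Prod.ext_iff]
    by_cases hv : C.Ram μ v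
    · simpa [hv] using h hv
    · simp [hv]
  fH_surjective v := ⟨⟨(v, false), fun _ => rfl⟩, rfl⟩
  fH_fibre := by
    rintro ⟨⟨v, b⟩, h⟩ ⟨⟨w, c⟩, h'⟩ hvw
    obtain rfl : v = w := hvw
    by_cases hv : μ v = 1
    · exact Or.inl (Subtype.ext (Prod.ext rfl ((h' hv).trans (h hv).symm)))
    · rcases Bool.eq_or_eq_not c b with rfl | rfl
      · exact Or.inl rfl
      · exact Or.inr (Subtype.ext (Prod.ext rfl (if_neg hv).symm))
  σH_eq_iff := by
    rintro ⟨⟨v, b⟩, h⟩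
    rw [Subtype.ext_iff, Prod.ext_iff]
    by_cases hv : μ v = 1
    · simpa [hv] using h hv
    · simp [hv]
  genus x := Classical.choose (exists_genus _ _ (μ_sum x.1.1))
  riemann_hurwitz x := Classical.choose_spec (exists_genus _ _ (μ_sum x.1.1))

/-- The sheet `false` of the canonical cover. -/
noncomputable def ofTreeSection (C : HEGraph) (tree : C.IsTree)
    (stable : ∀ v, 3 ≤ (C.star v).ncard) (μ : C.H → ZMod 2) (μ_i : ∀ h, μ (C.i h) = - μ h)
    (μ_sum : ∀ v, ∑ᶠ h ∈ C.star v, μ h = 0) :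
    (ofTree C tree stable μ μ_i μ_sum).Section where
  s h := ⟨(h, false), fun _ => rfl⟩
  f_s _ := rfl
  i_s _ := rfl
  r_s _ _ hh := Subtype.ext (Prod.ext hh ((ite_self _).trans (ite_self _).symm))

end AdmissibleCover

namespace HCover

/-- The half-edges of the source over a leg are legs: over a marked leg because the marking lifts to
a leg, and over an unmarked leg because there is only one. -/
theorem mem_legs_of_fH {g n : ℕ} (X : HCover g n) (k : X.P.H) (hk : X.fH k ∈ X.C.legs) :
    k ∈ X.P.legs := by
  by_cases hm : X.fH k ∈ Set.range X.mC
  · obtain ⟨j, hj⟩ := hm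
    have hl : X.P.i (X.mP j) = X.mP j := X.mP_leg j
    rcases X.fH_fibre (X.mP j) k (by rw [X.f_mP, hj]) with rfl | rfl
    · exact hl
    · change X.P.i _ = _
      rw [← X.σ_i, hl]
  · have hμ := X.μ_unmarked _ hk hm
    have hk' : X.C.i (X.fH k) = X.fH k := hk
    rcases X.fH_fibre k (X.P.i k) (by rw [X.f_i, hk']) with h1 | h1
    · exact h1
    · change X.P.i k = k
      rw [h1]
      exact (X.σH_eq_iff k).2 hμ

theorem exists_section {g n : ℕ} (X : HCover g n) : Nonempty X.toAdmissibleCover.Section :=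
  X.toAdmissibleCover.exists_section X.mem_legs_of_fH

end HCover

/-- Isomorphisms of the targets extend to isomorphisms of covers that match two given sections,
provided that the sections treat the markings of the sources alike. -/
noncomputable def LabelledHCover.Iso.ofSections {g n k : ℕ} {X Y : LabelledHCover g n k}
    (ψ : HEGraph.Iso X.C Y.C) (hmC : ∀ j, ψ.eH (X.mC j) = Y.mC j)
    (hμ : ∀ h, Y.μ (ψ.eH h) = X.μ h) (hω : ∀ j h, ψ.eH h ∈ Y.ω j ↔ h ∈ X.ω j)
    (s : X.toAdmissibleCover.Section) (t : Y.toAdmissibleCover.Section)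
    (hst : ∀ j, X.mP j = s.s (X.mC j) ↔ Y.mP j = t.s (Y.mC j)) : Iso X Y where
  φ := s.isoSource t ψ hμ
  ψ := ψ
  commV x := by
    obtain ⟨k, rfl⟩ := X.star_nonempty_source x
    rw [(s.isoSource t ψ hμ).map_r, Y.f_r, X.f_r, ψ.map_r]
    exact congrArg _ (AdmissibleCover.Section.fH_transfer s t ψ.eH k)
  commH k := AdmissibleCover.Section.fH_transfer s t ψ.eH k
  map_mP j := by
    change s.transfer t ψ.eH (X.mP j) = Y.mP j
    refine t.ext_of_iff ?_ ?_
    · rw [AdmissibleCover.Section.fH_transfer, X.f_mP, Y.f_mP, hmC]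
    · rw [AdmissibleCover.Section.transfer_eq_iff s t ψ.eH hμ, X.f_mP, Y.f_mP, hst]
  map_mC := hmC
  map_μ := hμ
  map_ω := hω

/-! ### Fans -/

namespace HEGraph

theorem Iso.root_eq_iff {C D : HEGraph} (e : Iso C D) (h h' : C.H) :
    D.r (e.eH h) = D.r (e.eH h') ↔ C.r h = C.r h' := by
  rw [← e.map_r, ← e.map_r, e.eV.injective.eq_iff]

/-- An isomorphism of contractions preserves the connectedness by contracted edges. -/
theorem Iso.conn_iff {C D : HEGraph} {F : Set C.H} {F' : Set D.H} {hF : C.IsEdgeSet F}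
    {hF' : D.IsEdgeSet F'} (e : Iso (C.contract F hF) (D.contract F' hF'))
    (h h' : (C.contract F hF).H) : C.Conn F (C.r h.1) (C.r h'.1) ↔
      D.Conn F' (D.r (e.eH h).1) (D.r (e.eH h').1) :=
  mk_eq_iff.symm.trans ((e.root_eq_iff h h').symm.trans mk_eq_iff)

/-- The half-edge `h`, which belongs to an edge, is rooted at a vertex whose other half-edges are
the legs in `S`. -/
structure IsFan (C : HEGraph) (h : C.H) (S : Set C.H) : Prop where
  ne : C.i h ≠ h
  legs : S ⊆ C.legs
  star : C.star (C.r h) = insert h S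

theorem IsFan.root_eq_iff {C : HEGraph} {h : C.H} {S : Set C.H} (hf : C.IsFan h S) {a : C.H} :
    C.r a = C.r h ↔ a = h ∨ a ∈ S := by
  have : a ∈ C.star (C.r h) ↔ a ∈ insert h S := by rw [hf.star]
  exact this

theorem IsFan.notMem {C : HEGraph} {h : C.H} {S : Set C.H} (hf : C.IsFan h S) : h ∉ S :=
  fun hh => hf.ne (hf.legs hh)

theorem IsFan.root_ne {C : HEGraph} {h : C.H} {S : Set C.H} (hf : C.IsFan h S) :
    C.r (C.i h) ≠ C.r h := by
  intro hr
  rcases hf.root_eq_iff.1 hr with h1 | h1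
  · exact hf.ne h1
  · have : C.i (C.i h) = C.i h := hf.legs h1
    rw [C.i_i] at this
    exact hf.ne this.symm

theorem leg_notMem_pair {C : HEGraph} {h a : C.H} (hh : C.i h ≠ h) (ha : a ∈ C.legs) :
    a ∉ ({h, C.i h} : Set C.H) := by
  have ha : C.i a = a := ha
  rintro (rfl | h1)
  · exact hh ha
  · have h1 : a = C.i h := h1
    rw [h1, C.i_i] at ha
    exact hh ha.symm

theorem conn_pair_iff {C : HEGraph} {h : C.H} {v w : C.V} : C.Conn {h, C.i h} v w ↔
    v = w ∨ ((v = C.r h ∨ v = C.r (C.i h)) ∧ (w = C.r h ∨ w = C.r (C.i h))) := by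
  have hstep : C.Conn {h, C.i h} (C.r h) (C.r (C.i h)) := Conn.step (Or.inl rfl)
  constructor
  · intro hc
    refine hc.induct (R := fun v w => v = w ∨ ((v = C.r h ∨ v = C.r (C.i h)) ∧
      (w = C.r h ∨ w = C.r (C.i h)))) ⟨fun _ => Or.inl rfl, ?_, ?_⟩ ?_
    · rintro v w (rfl | h1)
      · exact Or.inl rfl
      · exact Or.inr h1.symm
    · rintro u v w (rfl | h1) (rfl | h2)
      · exact Or.inl rfl
      · exact Or.inr h2
      · exact Or.inr h1
      · exact Or.inr ⟨h1.1, h2.2⟩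
    · rintro a (rfl | h1)
      · exact Or.inr ⟨Or.inl rfl, Or.inr rfl⟩
      · have h1 : a = C.i h := h1
        subst h1
        rw [C.i_i]
        exact Or.inr ⟨Or.inr rfl, Or.inl rfl⟩
  · rintro (rfl | ⟨rfl | rfl, rfl | rfl⟩)
    · exact Conn.refl _
    · exact Conn.refl _
    · exact hstep
    · exact hstep.symm
    · exact Conn.refl _

/-- Contracting the edge of a fan identifies no two vertices outside the fan. -/
theorem IsFan.eq_iff {C : HEGraph} {h : C.H} {S : Set C.H} (hf : C.IsFan h S) {v w : C.V} :
    v = w ↔ C.Conn {h, C.i h} v w ∧ (v = C.r h ↔ w = C.r h) := by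
  constructor
  · rintro rfl
    exact ⟨Conn.refl _, Iff.rfl⟩
  · rintro ⟨h1, h2⟩
    rw [conn_pair_iff] at h1
    have := hf.root_ne
    rcases h1 with h1 | ⟨rfl | rfl, rfl | rfl⟩
    · exact h1
    · rfl
    · exact (h2.1 rfl).symm
    · exact h2.2 rfl
    · rfl

section Extend

variable {C D : HEGraph} {F : Set C.H} {F' : Set D.H}

open Classical in
/-- Extends a map between the half-edges outside an edge `{a, i a}` and outside an edge `{b, i b}`
to all half-edges. -/
noncomputable def extendHalf (E : {h // h ∉ F} → {h // h ∉ F'}) (a : C.H) (b : D.H) (h : C.H) :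
    D.H :=
  if hh : h ∈ F then (if h = a then b else D.i b) else (E ⟨h, hh⟩).1

theorem extendHalf_of_notMem (E : {h // h ∉ F} → {h // h ∉ F'}) (a : C.H) (b : D.H) {h : C.H}
    (hh : h ∉ F) : extendHalf E a b h = (E ⟨h, hh⟩).1 := dif_neg hh

theorem extendHalf_self (E : {h // h ∉ F} → {h // h ∉ F'}) {a : C.H} (b : D.H)
    (hF : F = {a, C.i a}) : extendHalf E a b a = b := by
  unfold extendHalf
  rw [dif_pos (by rw [hF]; exact Or.inl rfl), if_pos rfl]

theorem extendHalf_i (E : {h // h ∉ F} → {h // h ∉ F'}) {a : C.H} (b : D.H)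
    (hF : F = {a, C.i a}) (ha : C.i a ≠ a) : extendHalf E a b (C.i a) = D.i b := by
  unfold extendHalf
  rw [dif_pos (by rw [hF]; exact Or.inr rfl), if_neg ha]

theorem extendHalf_extendHalf (E : {h // h ∉ F} ≃ {h // h ∉ F'}) {a : C.H} {b : D.H}
    (hF : F = {a, C.i a}) (hF' : F' = {b, D.i b}) (ha : C.i a ≠ a) (hb : D.i b ≠ b) (h : C.H) :
    extendHalf E.symm b a (extendHalf E a b h) = h := by
  by_cases hh : h ∈ F
  · have hh' := hh
    rw [hF] at hh'
    rcases hh' with rfl | rfl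
    · rw [extendHalf_self _ _ hF, extendHalf_self _ _ hF']
    · rw [extendHalf_i _ _ hF ha, extendHalf_i _ _ hF' hb]
  · rw [extendHalf_of_notMem _ _ _ hh, extendHalf_of_notMem _ _ _ (E ⟨h, hh⟩).2]
    simp

/-- An isomorphism between the contractions of two graphs along the edge of a fan extends to the
graphs if it matches the legs of the fans. -/
noncomputable def Iso.extendFan (hC : ∀ v, (C.star v).Nonempty) (hD : ∀ v, (D.star v).Nonempty)
    (hF : C.IsEdgeSet F) (E : {h // h ∉ F} ≃ {h // h ∉ F'})
    (hi : ∀ h hh hh', (E ⟨C.i h, hh'⟩).1 = D.i (E ⟨h, hh⟩).1)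
    (hr : ∀ h hh h' hh', C.Conn F (C.r h) (C.r h') ↔
      D.Conn F' (D.r (E ⟨h, hh⟩).1) (D.r (E ⟨h', hh'⟩).1))
    {a : C.H} {b : D.H} (hFa : F = {a, C.i a}) (hFb : F' = {b, D.i b}) {S : Set C.H} {T : Set D.H}
    (ha : C.IsFan a S) (hb : D.IsFan b T) (hne : S.Nonempty)
    (hST : ∀ h hh, h ∈ S ↔ (E ⟨h, hh⟩).1 ∈ T) : Iso C D :=
  Iso.ofHalfEdges hC hD
    ⟨extendHalf E a b, extendHalf E.symm b a, extendHalf_extendHalf E hFa hFb ha.ne hb.ne,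
      extendHalf_extendHalf E.symm hFb hFa hb.ne ha.ne⟩
    (by
      intro h
      change extendHalf _ _ _ _ = D.i (extendHalf _ _ _ _)
      by_cases hh : h ∈ F
      · rw [hFa] at hh
        rcases hh with rfl | rfl
        · rw [extendHalf_i _ _ hFa ha.ne, extendHalf_self _ _ hFa]
        · rw [C.i_i, extendHalf_i _ _ hFa ha.ne, extendHalf_self _ _ hFa, D.i_i]
      · have hh' : C.i h ∉ F := fun h1 => hh (by simpa [C.i_i] using (hF _ h1).1)
        rw [extendHalf_of_notMem _ _ _ hh, extendHalf_of_notMem _ _ _ hh']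
        exact hi h hh hh')
    (by
      intro h h'
      change _ ↔ D.r (extendHalf _ _ _ _) = D.r (extendHalf _ _ _ _)
      have hS : ∀ c ∈ S, c ∉ F := fun c hc => by
        rw [hFa]; exact leg_notMem_pair ha.ne (ha.legs hc)
      -- every half-edge has a companion outside `F` with the same image in the contraction
      have hrep : ∀ h, ∃ c, ∃ hc : c ∉ F, C.Conn F (C.r h) (C.r c) ∧
          D.Conn F' (D.r (extendHalf E a b h)) (D.r (E ⟨c, hc⟩).1) := by
        intro h
        by_cases hh : h ∈ F
        · obtain ⟨c, hc⟩ := hne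
          have h1 : C.r c = C.r a := ha.root_eq_iff.2 (Or.inr hc)
          have h2 : D.r (E ⟨c, hS c hc⟩).1 = D.r b :=
            hb.root_eq_iff.2 (Or.inr ((hST c _).1 hc))
          refine ⟨c, hS c hc, ?_⟩
          rw [h1, h2]
          have haF : a ∈ F := by rw [hFa]; exact Or.inl rfl
          have hbF : b ∈ F' := by rw [hFb]; exact Or.inl rfl
          have hh' := hh
          rw [hFa] at hh'
          rcases hh' with h3 | h3
          · rw [h3, extendHalf_self _ _ hFa]
            exact ⟨Conn.refl _, Conn.refl _⟩
          · rw [show h = C.i a from h3, extendHalf_i _ _ hFa ha.ne]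
            exact ⟨(Conn.step haF).symm, (Conn.step hbF).symm⟩
        · refine ⟨h, hh, Conn.refl _, ?_⟩
          rw [extendHalf_of_notMem _ _ _ hh]
          exact Conn.refl _
      have hconn : C.Conn F (C.r h) (C.r h') ↔
          D.Conn F' (D.r (extendHalf E a b h)) (D.r (extendHalf E a b h')) := by
        obtain ⟨c, hc, h1, h2⟩ := hrep h
        obtain ⟨c', hc', h1', h2'⟩ := hrep h'
        have hcc := hr c hc c' hc'
        exact ⟨fun hx => (h2.trans (hcc.1 ((h1.symm.trans hx).trans h1'))).trans h2'.symm,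
          fun hx => (h1.trans (hcc.2 ((h2.symm.trans hx).trans h2'))).trans h1'.symm⟩
      have hroot : ∀ h, C.r h = C.r a ↔ D.r (extendHalf E a b h) = D.r b := by
        intro h
        by_cases hh : h ∈ F
        · have hh' := hh
          rw [hFa] at hh'
          rcases hh' with rfl | rfl
          · rw [extendHalf_self _ _ hFa]
            exact iff_of_true rfl rfl
          · rw [extendHalf_i _ _ hFa ha.ne]
            exact iff_of_false ha.root_ne hb.root_ne
        · rw [extendHalf_of_notMem _ _ _ hh, ha.root_eq_iff, hb.root_eq_iff, hST h hh]
          have h1 : h ≠ a := by rintro rfl; exact hh (by rw [hFa]; exact Or.inl rfl)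
          have h2 : (E ⟨h, hh⟩).1 ≠ b := by
            intro hx
            apply (E ⟨h, hh⟩).2
            rw [hx, hFb]; exact Or.inl rfl
          rw [or_iff_right h1, or_iff_right h2]
      rw [ha.eq_iff, hb.eq_iff, ← hFa, ← hFb, hconn, hroot, hroot])

end Extend

end HEGraph

namespace AdmissibleCover

/-- A section of the contraction of a cover along the edge of a fan lifts to a section of the cover
if it treats the legs of the fan alike, unless the fan is ramified and its neighbour is not. -/
theorem exists_section_lift {Y : AdmissibleCover} {F : Set Y.C.H} {hF : Y.C.IsEdgeSet F}
    (t : (Y.contract F hF).Section) {a : Y.C.H} (hFa : F = {a, Y.C.i a}) {S : Set Y.C.H}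
    (ha : Y.C.IsFan a S) (hne : S.Nonempty)
    (hram : Y.C.Ram Y.μ (Y.C.r a) → Y.C.Ram Y.μ (Y.C.r (Y.C.i a)))
    (ht : ∀ b hb c hc, b ∈ S → c ∈ S → Y.P.r (t.s ⟨b, hb⟩).1 = Y.P.r (t.s ⟨c, hc⟩).1) :
    ∃ u : Y.Section, ∀ b hb, u.s b = (t.s ⟨b, hb⟩).1 := by
  classical
  have hS : ∀ c ∈ S, c ∉ F := fun c hc => by
    rw [hFa]; exact HEGraph.leg_notMem_pair ha.ne (ha.legs hc)
  obtain ⟨b, hb⟩ := hne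
  have hft : ∀ c hc, Y.fH (t.s ⟨c, hc⟩).1 = c := fun c hc => congrArg Subtype.val (t.f_s ⟨c, hc⟩)
  have hrb : Y.C.r b = Y.C.r a := ha.root_eq_iff.2 (Or.inr hb)
  obtain ⟨k, hk, hkr⟩ := Y.exists_lift_half (x := Y.P.r (t.s ⟨b, hS b hb⟩).1) (h := a)
    (by rw [Y.f_r, hft, hrb])
  let u : Y.C.H → Y.P.H := fun h =>
    if hh : h ∈ F then (if h = a then k else Y.P.i k) else (t.s ⟨h, hh⟩).1
  have haF : a ∈ F := by rw [hFa]; exact Or.inl rfl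
  have hiF : Y.C.i a ∈ F := by rw [hFa]; exact Or.inr rfl
  have hu : ∀ h (hh : h ∉ F), u h = (t.s ⟨h, hh⟩).1 := fun h hh => dif_neg hh
  have hua : u a = k := by exact (dif_pos haF).trans (if_pos rfl)
  have hui : u (Y.C.i a) = Y.P.i k := by simp only [u]; rw [dif_pos hiF, if_neg ha.ne]
  have hcases : ∀ h, h = a ∨ h = Y.C.i a ∨ h ∉ F := by
    intro h
    by_cases hh : h ∈ F
    · rw [hFa] at hh
      rcases hh with h1 | h1
      · exact Or.inl h1
      · exact Or.inr (Or.inl h1)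
    · exact Or.inr (Or.inr hh)
  have hfu : ∀ h, Y.fH (u h) = h := by
    intro h
    rcases hcases h with rfl | rfl | hh
    · rw [hua, hk]
    · rw [hui, Y.f_i, hk]
    · rw [hu h hh, hft]
  -- over a vertex outside the fan, the contraction identifies no two vertices of the source
  have hinj : ∀ x y, Y.fV x = Y.fV y → Y.fV x ≠ Y.C.r a → Y.P.Conn (Y.fH ⁻¹' F) x y → x = y := by
    intro x y hxy hxa hc
    rcases Y.fV_fibre x y hxy with rfl | rfl
    · rfl
    · obtain ⟨⟨h, _⟩, hh, hμ⟩ := ((Y.contract F hF).σV_eq_iff (Quot.mk _ x)).1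
        (HEGraph.mk_eq_iff.2 hc.symm)
      have hh : Y.C.Conn F (Y.C.r h) (Y.fV x) := HEGraph.mk_eq_iff.1 hh
      replace hμ : Y.μ h = 1 := hμ
      rw [hFa, HEGraph.conn_pair_iff] at hh
      refine ((Y.σV_eq_iff x).2 ?_).symm
      rcases hh with h1 | ⟨h1, h2⟩
      · exact ⟨h, h1, hμ⟩
      · rw [h2.resolve_left hxa]
        rcases h1 with h1 | h1
        · exact hram ⟨h, h1, hμ⟩
        · exact ⟨h, h1, hμ⟩
  refine ⟨⟨u, hfu, ?_, ?_⟩, hu⟩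
  · intro h
    rcases hcases h with rfl | rfl | hh
    · rw [hua, hui]
    · rw [Y.C.i_i, hui, hua, Y.P.i_i]
    · have hh' : Y.C.i h ∉ F := fun h1 => hh (by simpa [Y.C.i_i] using (hF _ h1).1)
      rw [hu h hh, hu _ hh']
      exact congrArg Subtype.val (t.i_s ⟨h, hh⟩)
  · intro h h' hr
    by_cases hra : Y.C.r h = Y.C.r a
    · have key : ∀ h, Y.C.r h = Y.C.r a → Y.P.r (u h) = Y.P.r (t.s ⟨b, hS b hb⟩).1 := by
        intro h hra
        rcases ha.root_eq_iff.1 hra with rfl | h1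
        · rw [hua, hkr]
        · rw [hu h (hS h h1)]
          exact ht _ _ _ _ h1 hb
      rw [key h hra, key h' (hr ▸ hra)]
    · have hrep : ∀ h, ∃ c, ∃ hc : c ∉ F, Y.C.Conn F (Y.C.r h) (Y.C.r c) ∧
          Y.P.Conn (Y.fH ⁻¹' F) (Y.P.r (u h)) (Y.P.r (t.s ⟨c, hc⟩).1) := by
        intro h
        rcases hcases h with rfl | rfl | hh
        · refine ⟨b, hS b hb, ?_⟩
          rw [hrb, hua, hkr]
          exact ⟨HEGraph.Conn.refl _, HEGraph.Conn.refl _⟩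
        · refine ⟨b, hS b hb, ?_⟩
          rw [hrb, hui, ← hkr]
          exact ⟨(HEGraph.Conn.step haF).symm,
            (HEGraph.Conn.step (by rw [Set.mem_preimage, hk]; exact haF)).symm⟩
        · refine ⟨h, hh, HEGraph.Conn.refl _, ?_⟩
          rw [hu h hh]
          exact HEGraph.Conn.refl _
      obtain ⟨c, hc, h1, h2⟩ := hrep h
      obtain ⟨c', hc', h1', h2'⟩ := hrep h'
      have h3 : Y.C.Conn F (Y.C.r c) (Y.C.r c') := by
        rw [hr] at h1
        exact h1.symm.trans h1'
      have h4 := HEGraph.mk_eq_iff.1 (t.r_s ⟨c, hc⟩ ⟨c', hc'⟩ (HEGraph.mk_eq_iff.2 h3))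
      refine hinj _ _ ?_ ?_ ((h2.trans h4).trans h2'.symm)
      · rw [Y.f_r, Y.f_r, hfu, hfu, hr]
      · rw [Y.f_r, hfu]; exact hra

end AdmissibleCover

/-- The section transported along an isomorphism. -/
def LabelledHCover.Iso.mapSection {g n k : ℕ} {X Y : LabelledHCover g n k} (e : Iso X Y)
    (s : X.toAdmissibleCover.Section) : Y.toAdmissibleCover.Section where
  s h := e.φ.eH (s.s (e.ψ.eH.symm h))
  f_s h := by rw [e.commH, s.f_s, Equiv.apply_symm_apply]
  i_s h := by
    rw [← e.φ.map_i, s.i_s]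
    exact congrArg (fun a => e.φ.eH (s.s a)) (e.ψ.symm.map_i h).symm
  r_s h h' hh := by
    rw [← e.φ.map_r, ← e.φ.map_r, s.r_s]
    apply e.ψ.eV.injective
    rw [e.ψ.map_r, e.ψ.map_r, Equiv.apply_symm_apply, Equiv.apply_symm_apply, hh]

namespace HCover

/-- `S` is a set of legs that consists of the marked legs with label in `B` and of `s` unmarked
legs. -/
structure IsBunch {g n : ℕ} (B : Set (Fin n)) (s : ℕ) (X : HCover g n) (S : Set X.C.H) :
    Prop where
  legs : S ⊆ X.C.legs
  mem_iff : ∀ j, X.mC j ∈ S ↔ j ∈ B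
  ncard : (S \ Set.range X.mC).ncard = s

/-- The lifts of the marked legs in `S` have the same root. -/
def Coherent {g n : ℕ} (X : HCover g n) (S : Set X.C.H) : Prop :=
  ∀ j k, X.mC j ∈ S → X.mC k ∈ S → X.P.r (X.mP j) = X.P.r (X.mP k)

theorem IsBunch.sum_μ {g n : ℕ} {B : Set (Fin n)} {s : ℕ} {X : HCover g n} {S : Set X.C.H}
    (hS : X.IsBunch B s S) : ∑ᶠ h ∈ S, X.μ h = (s : ZMod 2) := by
  rw [← finsum_mem_inter_add_sdiff (Set.range X.mC) (Set.toFinite S), ← hS.ncard]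
  have h1 : ∑ᶠ h ∈ S ∩ Set.range X.mC, X.μ h = 0 := by
    rw [finsum_mem_congr rfl (g := fun _ => 0), finsum_mem_zero]
    rintro _ ⟨_, j, rfl⟩
    exact X.μ_marked j
  have h2 : ∑ᶠ h ∈ S \ Set.range X.mC, X.μ h = ∑ᶠ h ∈ S \ Set.range X.mC, 1 :=
    finsum_mem_congr rfl fun h hh => X.μ_unmarked h (hS.legs hh.1) hh.2
  have := Fintype.ofFinite ↑(S \ Set.range X.mC)
  rw [h1, h2, zero_add, finsum_mem_eq_toFinset_sum, Finset.sum_const, nsmul_eq_mul, mul_one,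
    ← Set.ncard_eq_toFinset_card']

theorem IsBunch.μ_fan {g n : ℕ} {B : Set (Fin n)} {s : ℕ} {X : HCover g n} {S : Set X.C.H}
    (hS : X.IsBunch B s S) {a : X.C.H} (ha : X.C.IsFan a S) : X.μ a = (s : ZMod 2) := by
  have := X.μ_sum (X.C.r a)
  rw [ha.star, finsum_mem_insert _ ha.notMem (Set.toFinite S), hS.sum_μ] at this
  rw [eq_neg_of_add_eq_zero_left this, ZMod.neg_eq_self_mod_two]

/-- With at most one marking, one of the two lifts of it belongs to a given section, and the other
one to the flipped section. -/
theorem exists_section_of_le_one {g n : ℕ} (hn : n ≤ 1) (X : HCover g n) :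
    ∃ s : X.toAdmissibleCover.Section, ∀ j, X.mP j = s.s (X.mC j) := by
  obtain ⟨s⟩ := X.exists_section
  rcases Nat.le_one_iff_eq_zero_or_eq_one.1 hn with rfl | rfl
  · exact ⟨s, fun j => j.elim0⟩
  · rcases s.eq_or (X.mP 0) with h1 | h1 <;> rw [X.f_mP] at h1
    · exact ⟨s, fun j => by rw [Subsingleton.elim j 0]; exact h1⟩
    · exact ⟨s.flip, fun j => by rw [Subsingleton.elim j 0]; exact h1⟩

end HCover

namespace LabelledHCover

theorem removed_succAboveEmb {g n k : ℕ} (X : LabelledHCover g n (k + 1)) (j : Fin (k + 1)) :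
    X.removed j.succAboveEmb = X.ω j := by
  ext h
  constructor
  · rintro ⟨i, hi, hh⟩
    have : i = j := by
      by_contra hij
      exact hi (Fin.exists_succAbove_eq hij)
    rwa [← this]
  · intro hh
    exact ⟨j, fun ⟨i, hi⟩ => Fin.succAbove_ne j i hi, hh⟩

theorem i_ne_of_mem_ω {g n k : ℕ} (X : LabelledHCover g n k) {j : Fin k} {h : X.C.H}
    (hh : h ∈ X.ω j) : X.C.i h ≠ h := by
  obtain ⟨a, ha, he⟩ := X.ω_bijOn.mapsTo (Set.mem_univ j)
  rw [he] at hh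
  rcases hh with rfl | rfl
  · exact ha
  · rw [X.C.i_i]; exact ha.symm

theorem ω_eq_pair {g n k : ℕ} (X : LabelledHCover g n k) {j : Fin k} {h : X.C.H}
    (hh : h ∈ X.ω j) : X.ω j = {h, X.C.i h} :=
  HEGraph.edge_eq (X.ω_bijOn.mapsTo (Set.mem_univ j)) ⟨h, X.i_ne_of_mem_ω hh, rfl⟩ hh (Or.inl rfl)

/-- The edge with label `i` joins the rest of the tree to a vertex whose other half-edges are the
legs in `S`; the lifts of the marked legs in `S` have the same root. -/
def Fan {g n k : ℕ} (X : LabelledHCover g n k) (i : Fin k) (S : Set X.C.H) : Prop :=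
  ∃ h ∈ X.ω i, X.C.IsFan h S ∧ X.Coherent S

/-- A fan is determined by its contraction: an isomorphism of contractions that matches the legs of
the fans extends to the covers.  The sources are compared through sections, transported through the
contraction when the fan is not more ramified than its neighbour, and chosen afresh when there is at
most one marking to match. -/
theorem nonempty_iso_of_fan {g n k s : ℕ} {B : Set (Fin n)} (hs : s = 0 ∨ Odd s ∨ n ≤ 1)
    {X Y : LabelledHCover g n (k + 1)} {S : Set X.C.H} {T : Set Y.C.H} (hSB : X.IsBunch B s S)
    (hTB : Y.IsBunch B s T) (hne : S.Nonempty) (hX : X.Fan 0 S) (hY : Y.Fan 0 T)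
    (e : Iso (X.face (0 : Fin (k + 1)).succAboveEmb) (Y.face (0 : Fin (k + 1)).succAboveEmb))
    (hST : ∀ h hh, h ∈ S ↔ (e.ψ.eH ⟨h, hh⟩).1 ∈ T) : Nonempty (Iso X Y) := by
  obtain ⟨a, haω, ha, hSc⟩ := hX
  obtain ⟨b, hbω, hb, hTc⟩ := hY
  have hFa : X.removed (0 : Fin (k + 1)).succAboveEmb = {a, X.C.i a} :=
    (X.removed_succAboveEmb 0).trans (X.ω_eq_pair haω)
  have hFb : Y.removed (0 : Fin (k + 1)).succAboveEmb = {b, Y.C.i b} :=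
    (Y.removed_succAboveEmb 0).trans (Y.ω_eq_pair hbω)
  let ψ : HEGraph.Iso X.C Y.C := HEGraph.Iso.extendFan X.star_nonempty Y.star_nonempty
    (X.isEdgeSet_removed _) e.ψ.eH (fun h hh hh' => congrArg Subtype.val (e.ψ.map_i ⟨h, hh⟩))
    (fun h hh h' hh' => HEGraph.Iso.conn_iff (hF := X.isEdgeSet_removed _)
      (hF' := Y.isEdgeSet_removed _) e.ψ ⟨h, hh⟩ ⟨h', hh'⟩) hFa hFb ha hb hne hST
  have hψ : ∀ h hh, ψ.eH h = (e.ψ.eH ⟨h, hh⟩).1 := fun h hh =>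
    HEGraph.extendHalf_of_notMem _ _ _ hh
  have hψa : ψ.eH a = b := HEGraph.extendHalf_self _ _ hFa
  have hψi : ψ.eH (X.C.i a) = Y.C.i b := by rw [ψ.map_i, hψa]
  have hcases : ∀ h, h = a ∨ h = X.C.i a ∨ h ∉ X.removed (0 : Fin (k + 1)).succAboveEmb := by
    intro h
    by_cases hh : h ∈ X.removed (0 : Fin (k + 1)).succAboveEmb
    · rw [hFa] at hh
      rcases hh with h1 | h1
      · exact Or.inl h1
      · exact Or.inr (Or.inl h1)
    · exact Or.inr (Or.inr hh)
  have hmC : ∀ j, ψ.eH (X.mC j) = Y.mC j := fun j => by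
    rw [hψ _ (HCover.not_mem_of_leg (X.isEdgeSet_removed _) (X.mC_leg j))]
    exact congrArg Subtype.val (e.map_mC j)
  have hμ : ∀ h, Y.μ (ψ.eH h) = X.μ h := by
    intro h
    rcases hcases h with rfl | rfl | hh
    · rw [hψa, hSB.μ_fan ha, hTB.μ_fan hb]
    · rw [hψi, X.μ_i, Y.μ_i, hSB.μ_fan ha, hTB.μ_fan hb]
    · rw [hψ h hh]
      exact e.map_μ ⟨h, hh⟩
  have hω : ∀ j h, ψ.eH h ∈ Y.ω j ↔ h ∈ X.ω j := by
    have hia : X.C.i a ∈ X.ω 0 := by rw [X.ω_eq_pair haω]; exact Or.inr rfl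
    have hib : Y.C.i b ∈ Y.ω 0 := by rw [Y.ω_eq_pair hbω]; exact Or.inr rfl
    intro j h
    rcases hcases h with rfl | rfl | hh
    · rw [hψa]
      exact ⟨fun h1 => Y.ω_eq_of_mem hbω h1 ▸ haω, fun h1 => X.ω_eq_of_mem haω h1 ▸ hbω⟩
    · rw [hψi]
      exact ⟨fun h1 => Y.ω_eq_of_mem hib h1 ▸ hia, fun h1 => X.ω_eq_of_mem hia h1 ▸ hib⟩
    · rw [hψ h hh]
      rcases Fin.eq_zero_or_eq_succ j with rfl | ⟨j, rfl⟩
      · rw [← X.removed_succAboveEmb, ← Y.removed_succAboveEmb]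
        exact iff_of_false (e.ψ.eH ⟨h, hh⟩).2 hh
      · rw [← Fin.succAbove_zero_apply]
        exact e.map_ω j ⟨h, hh⟩
  by_cases hn : n ≤ 1
  · obtain ⟨s, hs⟩ := X.exists_section_of_le_one hn
    obtain ⟨t, ht⟩ := Y.exists_section_of_le_one hn
    exact ⟨Iso.ofSections ψ hmC hμ hω s t fun j => iff_of_true (hs j) (ht j)⟩
  obtain ⟨σ⟩ := X.exists_section
  let t : (Y.face (0 : Fin (k + 1)).succAboveEmb).toAdmissibleCover.Section :=
    e.mapSection (σ.contract (X.isEdgeSet_removed _))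
  have htm : ∀ j hj, X.mP j = σ.s (X.mC j) ↔ Y.mP j = (t.s ⟨Y.mC j, hj⟩).1 := by
    intro j hj
    have h2 := e.map_mP j
    have h3 : t.s ⟨Y.mC j, hj⟩ = e.φ.eH ((σ.contract (X.isEdgeSet_removed _)).s
        ((X.face (0 : Fin (k + 1)).succAboveEmb).mC j)) :=
      congrArg (fun z => e.φ.eH ((σ.contract (X.isEdgeSet_removed _)).s z))
        ((Equiv.symm_apply_eq _).2 (e.map_mC j).symm)
    rw [h3]
    constructor
    · intro h4
      refine (congrArg Subtype.val h2).symm.trans (congrArg (fun z => (e.φ.eH z).1) ?_)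
      exact Subtype.ext h4
    · intro h4
      have h5 := h2.trans (Subtype.ext h4 : (Y.face (0 : Fin (k + 1)).succAboveEmb).mP j = _)
      exact congrArg Subtype.val (e.φ.eH.injective h5)
  obtain ⟨u, hu⟩ := AdmissibleCover.exists_section_lift t hFb hb (by
    obtain ⟨c, hc⟩ := hne
    exact ⟨_, (hST c (HCover.not_mem_of_leg (X.isEdgeSet_removed _) (hSB.legs hc))).1 hc⟩)
    (by
      intro hr
      obtain ⟨c, hc, hc1⟩ := hr
      rcases hs with rfl | hs | hs
      · exfalso
        rcases hb.root_eq_iff.1 hc with rfl | h1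
        · rw [hTB.μ_fan hb] at hc1
          simp at hc1
        · have : c ∈ Set.range Y.mC := by
            by_contra hcr
            have := (Set.ncard_eq_zero).1 hTB.ncard
            exact Set.notMem_empty c (this ▸ ⟨h1, hcr⟩)
          obtain ⟨j, rfl⟩ := this
          rw [Y.μ_marked] at hc1
          exact zero_ne_one hc1
      · refine ⟨Y.C.i b, rfl, ?_⟩
        rw [Y.μ_i, hTB.μ_fan hb, ZMod.neg_eq_self_mod_two]
        exact (ZMod.natCast_eq_one_iff_odd).2 hs
      · exact absurd hs hn)
    (by
      intro c hc d hd hcT hdT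
      have hft : ∀ c hc, Y.fH (t.s ⟨c, hc⟩).1 = c := fun c hc =>
        congrArg Subtype.val (t.f_s ⟨c, hc⟩)
      rcases hs with rfl | hs | hs
      · have hrange : ∀ c ∈ T, ∃ j, Y.mC j = c := by
          intro c hcT
          by_contra hcr
          have := (Set.ncard_eq_zero).1 hTB.ncard
          exact Set.notMem_empty c (this ▸ ⟨hcT, hcr⟩)
        obtain ⟨j, rfl⟩ := hrange c hcT
        obtain ⟨l, rfl⟩ := hrange d hdT
        have hj := (hSB.mem_iff j).2 ((hTB.mem_iff j).1 hcT)
        have hl := (hSB.mem_iff l).2 ((hTB.mem_iff l).1 hdT)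
        have hrj := ha.root_eq_iff.2 (Or.inr hj)
        have hrl := ha.root_eq_iff.2 (Or.inr hl)
        -- the fan is unramified, so the section of `X` treats the lifts of the marks alike
        have hX := (σ.root_eq_iff (by rw [X.f_mP, X.f_mP, hrj, hrl])).1 (hSc j l hj hl)
        rw [X.f_mP, X.f_mP, htm j hc, htm l hd] at hX
        have hX := hX.resolve_left (by
          rintro ⟨c, hc, hc1⟩
          rw [hrj] at hc
          rcases ha.root_eq_iff.1 hc with rfl | h1
          · rw [hSB.μ_fan ha] at hc1
            simp at hc1
          · have : c ∈ Set.range X.mC := by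
              by_contra hcr
              have := (Set.ncard_eq_zero).1 hSB.ncard
              exact Set.notMem_empty c (this ▸ ⟨h1, hcr⟩)
            obtain ⟨j, rfl⟩ := this
            rw [X.μ_marked] at hc1
            exact zero_ne_one hc1)
        have hYr := hTc j l hcT hdT
        by_cases hm : Y.mP j = (t.s ⟨Y.mC j, hc⟩).1
        · rw [← hm, ← hX.1 hm, hYr]
        · have h1 := (Y.fH_fibre (Y.mP j) (t.s ⟨Y.mC j, hc⟩).1
            (by rw [hft, Y.f_mP])).resolve_left (fun h => hm h.symm)
          have h2 := (Y.fH_fibre (Y.mP l) (t.s ⟨Y.mC l, hd⟩).1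
            (by rw [hft, Y.f_mP])).resolve_left (fun h => hm (hX.2 h.symm))
          rw [h1, h2, ← Y.σ_r, ← Y.σ_r, hYr]
      · obtain ⟨c', hc', hcr⟩ : (T \ Set.range Y.mC).Nonempty := by
          rw [← Set.ncard_pos, hTB.ncard]
          exact hs.pos
        have hrc := hb.root_eq_iff.2 (Or.inr hcT)
        have hrd := hb.root_eq_iff.2 (Or.inr hdT)
        have hσ : Y.σV (Y.P.r (t.s ⟨c, hc⟩).1) = Y.P.r (t.s ⟨c, hc⟩).1 := by
          refine (Y.σV_eq_iff _).2 ⟨c', ?_, Y.μ_unmarked _ (hTB.legs hc') hcr⟩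
          rw [Y.f_r, hft, hrc]
          exact hb.root_eq_iff.2 (Or.inr hc')
        rcases Y.fV_fibre (Y.P.r (t.s ⟨c, hc⟩).1) (Y.P.r (t.s ⟨d, hd⟩).1)
          (by rw [Y.f_r, Y.f_r, hft, hft, hrc, hrd]) with h1 | h1
        · exact h1.symm
        · rw [h1, hσ]
      · exact absurd hs hn)
  refine ⟨Iso.ofSections ψ hmC hμ hω σ u fun j => ?_⟩
  rw [hu _ (HCover.not_mem_of_leg (Y.isEdgeSet_removed _) (Y.mC_leg j))]
  exact htm j _

end LabelledHCover

/-! ### Expanding a fan -/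

namespace HEGraph

open Classical in
/-- The legs in `S`, rooted at `v`, are moved to a new vertex `none`, which is joined to `v` by a
new edge with half-edges `inr true` (at the new vertex) and `inr false` (at `v`). -/
noncomputable abbrev expand (C : HEGraph) (S : Set C.H) (v : C.V) : HEGraph where
  V := Option C.V
  H := C.H ⊕ Bool
  i := Sum.map C.i not
  r := Sum.elim (fun h => if h ∈ S then none else some (C.r h))
    (fun b => if b then none else some v)
  i_i := by rintro (h | b) <;> simp [C.i_i]

section Expand

variable {C : HEGraph} {S : Set C.H} {v : C.V}

theorem expand_r_of_mem {h : C.H} (hh : h ∈ S) : (C.expand S v).r (Sum.inl h) = none := if_pos hh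

theorem expand_r_of_notMem {h : C.H} (hh : h ∉ S) :
    (C.expand S v).r (Sum.inl h) = some (C.r h) := if_neg hh

theorem expand_legs : (C.expand S v).legs = Sum.inl '' C.legs := by
  ext (h | b)
  · change Sum.inl (C.i h) = Sum.inl h ↔ _
    rw [Sum.inl.injEq, Sum.inl_injective.mem_set_image]
    exact Iff.rfl
  · change Sum.inr (!b) = Sum.inr b ↔ _
    simp

theorem expand_star_none : (C.expand S v).star none = insert (Sum.inr true) (Sum.inl '' S) := by
  ext (h | b)
  · by_cases hh : h ∈ S
    · exact iff_of_true (expand_r_of_mem hh) (Or.inr ⟨h, hh, rfl⟩)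
    · refine iff_of_false (fun hr => ?_) ?_
      · have hr : (C.expand S v).r (Sum.inl h) = none := hr
        rw [expand_r_of_notMem hh] at hr
        simp at hr
      · simpa using hh
  · cases b
    · exact iff_of_false (fun hr => by simp [expand, star] at hr) (by simp)
    · exact iff_of_true rfl (Or.inl rfl)

theorem expand_star_some_of_ne (hv : S ⊆ C.star v) {w : C.V} (hw : w ≠ v) :
    (C.expand S v).star (some w) = Sum.inl '' C.star w := by
  ext (h | b)
  · rw [Sum.inl_injective.mem_set_image]
    by_cases hh : h ∈ S
    · refine iff_of_false (fun hr => ?_) (fun hr => ?_)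
      · have hr : (C.expand S v).r (Sum.inl h) = some w := hr
        rw [expand_r_of_mem hh] at hr
        simp at hr
      · exact hw ((show C.r h = w from hr).symm.trans (hv hh))
    · change (C.expand S v).r (Sum.inl h) = some w ↔ C.r h = w
      rw [expand_r_of_notMem hh, Option.some_inj]
  · refine iff_of_false (fun hr => ?_) (by simp)
    cases b
    · exact hw (Option.some_inj.1 (show some v = some w from hr)).symm
    · exact absurd (show none = some w from hr) (by simp)

theorem expand_star_some : (C.expand S v).star (some v) =
    insert (Sum.inr false) (Sum.inl '' (C.star v \ S)) := by
  ext (h | b)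
  · by_cases hh : h ∈ S
    · refine iff_of_false (fun hr => ?_) (by simp [hh])
      have hr : (C.expand S v).r (Sum.inl h) = some v := hr
      rw [expand_r_of_mem hh] at hr
      simp at hr
    · change (C.expand S v).r (Sum.inl h) = some v ↔ _
      rw [expand_r_of_notMem hh, Option.some_inj]
      simp [hh, star]
  · cases b
    · exact iff_of_true rfl (Or.inl rfl)
    · exact iff_of_false (fun hr => absurd (show none = some v from hr) (by simp)) (by simp)

theorem expand_isFan (hS : S ⊆ C.legs) : (C.expand S v).IsFan (Sum.inr true) (Sum.inl '' S) where
  ne := by simp [expand]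
  legs := by rw [expand_legs]; exact Set.image_mono hS
  star := expand_star_none

/-- The old vertex from which a vertex of the expansion comes. -/
theorem expand_r_getD (hv : S ⊆ C.star v) (h : C.H) :
    ((C.expand S v).r (Sum.inl h)).getD v = C.r h := by
  by_cases hh : h ∈ S
  · rw [expand_r_of_mem hh]; exact (hv hh).symm
  · rw [expand_r_of_notMem hh]; rfl

theorem expand_conn_new (a : Option C.V) :
    (C.expand S v).Conn {Sum.inr true, Sum.inr false} (some (a.getD v)) a := by
  cases a with
  | none => exact (Conn.step (C := C.expand S v) (h := Sum.inr true) (Or.inl rfl)).symm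
  | some a => exact Conn.refl _

theorem expand_conn_iff (hv : S ⊆ C.star v) (h h' : C.H) :
    (C.expand S v).Conn {Sum.inr true, Sum.inr false} ((C.expand S v).r (Sum.inl h))
      ((C.expand S v).r (Sum.inl h')) ↔ C.r h = C.r h' := by
  constructor
  · intro hc
    have := hc.induct (R := fun a b : Option C.V => a.getD v = b.getD v)
      ⟨fun _ => rfl, Eq.symm, Eq.trans⟩ (by rintro _ (rfl | rfl) <;> rfl)
    rwa [expand_r_getD hv, expand_r_getD hv] at this
  · intro hr
    have h1 := expand_conn_new (C := C) (S := S) (v := v) ((C.expand S v).r (Sum.inl h))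
    have h2 := expand_conn_new (C := C) (S := S) (v := v) ((C.expand S v).r (Sum.inl h'))
    rw [expand_r_getD hv] at h1 h2
    rw [hr] at h1
    exact h1.symm.trans h2

theorem expand_isTree (hC : C.IsTree) (hS : S ⊆ C.legs) (hv : S ⊆ C.star v) :
    (C.expand S v).IsTree where
  nonempty := ⟨none⟩
  conn := by
    have hsome : ∀ a b : C.V, (C.expand S v).Conn Set.univ (some a) (some b) := by
      intro a b
      refine (hC.conn a b).induct (R := fun a b => (C.expand S v).Conn Set.univ (some a) (some b))
        ⟨fun _ => Conn.refl _, Conn.symm, Conn.trans⟩ ?_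
      intro h _
      by_cases hh : C.i h = h
      · rw [hh]; exact Conn.refl _
      · have h1 : h ∉ S := fun h1 => hh (hS h1)
        have h2 : C.i h ∉ S := fun h2 => hh (by
          have := hS h2
          rwa [legs, Set.mem_ofPred_eq, C.i_i, eq_comm] at this)
        have := Conn.step (C := C.expand S v) (A := Set.univ) (h := Sum.inl h) trivial
        rwa [show (C.expand S v).i (Sum.inl h) = Sum.inl (C.i h) from rfl,
          expand_r_of_notMem h1, expand_r_of_notMem h2] at this
    intro a b
    exact (((expand_conn_new a).mono (Set.subset_univ _)).symm.trans (hsome _ _)).trans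
      ((expand_conn_new b).mono (Set.subset_univ _))
  bridge := by
    have hleg : ∀ h : C.H, h ∈ S → C.i h ∈ S := fun h hh => by rwa [show C.i h = h from hS hh]
    rintro (h | b) hne hc
    · have hne' : C.i h ≠ h := fun h1 => hne (congrArg Sum.inl h1)
      refine hC.bridge h hne' ?_
      have := hc.induct (R := fun a b : Option C.V =>
        C.Conn {h, C.i h}ᶜ (a.getD v) (b.getD v))
        ⟨fun _ => Conn.refl _, Conn.symm, Conn.trans⟩ ?_
      · change C.Conn _ (((C.expand S v).r (Sum.inl h)).getD v)
          (((C.expand S v).r (Sum.inl (C.i h))).getD v) at this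
        rwa [expand_r_getD hv, expand_r_getD hv] at this
      · rintro (a | b) ha
        · change C.Conn _ (((C.expand S v).r (Sum.inl a)).getD v)
            (((C.expand S v).r (Sum.inl (C.i a))).getD v)
          rw [expand_r_getD hv, expand_r_getD hv]
          refine Conn.step fun ha' => ha ?_
          rcases ha' with rfl | rfl
          · exact Or.inl rfl
          · exact Or.inr rfl
        · cases b <;> exact Conn.refl _
    · -- without the new edge, no path leaves the new vertex
      have := hc.mem_iff (Z := fun a : Option C.V => a = none) ?_
      · cases b <;> simp at this
      · rintro (a | a) ha
        · change (C.expand S v).r (Sum.inl a) = none ↔ (C.expand S v).r (Sum.inl (C.i a)) = none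
          by_cases h1 : a ∈ S
          · rw [expand_r_of_mem h1, expand_r_of_mem (hleg a h1)]
          · have h2 : C.i a ∉ S := fun h2 => h1 (by simpa [C.i_i] using hleg _ h2)
            rw [expand_r_of_notMem h1, expand_r_of_notMem h2]
            simp
        · exfalso
          apply ha
          cases a <;> cases b <;> simp [expand]

theorem expand_stable (hst : ∀ v, 3 ≤ (C.star v).ncard) (hv : S ⊆ C.star v) (h2 : 2 ≤ S.ncard)
    (h2' : 2 ≤ (C.star v \ S).ncard) (w : (C.expand S v).V) :
    3 ≤ ((C.expand S v).star w).ncard := by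
  rcases w with _ | w
  · rw [show ((C.expand S v).star none) = _ from expand_star_none,
      Set.ncard_insert_of_notMem (by simp), Set.ncard_image_of_injective _ Sum.inl_injective]
    omega
  · by_cases hw : w = v
    · subst hw
      rw [show ((C.expand S w).star (some w)) = _ from expand_star_some,
        Set.ncard_insert_of_notMem (by simp), Set.ncard_image_of_injective _ Sum.inl_injective]
      omega
    · rw [show ((C.expand S v).star (some w)) = _ from expand_star_some_of_ne hv hw,
        Set.ncard_image_of_injective _ Sum.inl_injective]
      exact hst w

/-- The monodromy marking of the expansion; its value at the new edge is forced by the sum condition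
at the new vertex. -/
noncomputable def expandμ (C : HEGraph) (S : Set C.H) (μ : C.H → ZMod 2) : C.H ⊕ Bool → ZMod 2 :=
  Sum.elim μ (fun _ => ∑ᶠ h ∈ S, μ h)

theorem expandμ_sum {μ : C.H → ZMod 2} (hμ : ∀ v, ∑ᶠ h ∈ C.star v, μ h = 0) (hv : S ⊆ C.star v)
    (w : (C.expand S v).V) : ∑ᶠ h ∈ (C.expand S v).star w, C.expandμ S μ h = 0 := by
  have himg : ∀ A : Set C.H, ∑ᶠ h ∈ Sum.inl '' A, C.expandμ S μ h = ∑ᶠ h ∈ A, μ h := fun A =>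
    finsum_mem_image Sum.inl_injective.injOn
  rcases w with _ | w
  · rw [show ((C.expand S v).star none) = _ from expand_star_none]
    refine (finsum_mem_insert _ (by simp) (Set.toFinite _)).trans ?_
    rw [himg]
    exact CharTwo.add_self_eq_zero _
  · by_cases hw : w = v
    · subst hw
      rw [show ((C.expand S w).star (some w)) = _ from expand_star_some]
      refine (finsum_mem_insert _ (by simp) (Set.toFinite _)).trans ?_
      rw [himg]
      refine Eq.trans ?_ (hμ w)
      rw [← finsum_mem_inter_add_sdiff S (Set.toFinite (C.star w)),
        Set.inter_eq_self_of_subset_right hv]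
      rfl
    · rw [show ((C.expand S v).star (some w)) = _ from expand_star_some_of_ne hv hw, himg, hμ]

/-- The new edge gets the label `0`. -/
theorem expand_bijOn {k : ℕ} {ω : Fin k → Set C.H} (hω : Set.BijOn ω Set.univ C.edges) :
    Set.BijOn (Fin.cons {Sum.inr true, Sum.inr false} (fun j => Sum.inl '' ω j) :
      Fin (k + 1) → Set (C.H ⊕ Bool)) Set.univ (C.expand S v).edges := by
  refine ⟨?_, ?_, ?_⟩
  · intro j _
    rcases Fin.eq_zero_or_eq_succ j with rfl | ⟨j, rfl⟩
    · rw [Fin.cons_zero]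
      exact ⟨Sum.inr true, by change Sum.inr false ≠ Sum.inr true; simp, rfl⟩
    · rw [Fin.cons_succ]
      obtain ⟨a, ha, he⟩ := hω.mapsTo (Set.mem_univ j)
      refine ⟨Sum.inl a, fun h => ha (Sum.inl_injective h), ?_⟩
      rw [he, Set.image_pair]
      rfl
  · intro j _ j' _ hjj
    rcases Fin.eq_zero_or_eq_succ j with rfl | ⟨j, rfl⟩ <;>
      rcases Fin.eq_zero_or_eq_succ j' with rfl | ⟨j', rfl⟩
    · rfl
    · rw [Fin.cons_zero, Fin.cons_succ] at hjj
      have : Sum.inr true ∈ Sum.inl '' ω j' := hjj ▸ Or.inl rfl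
      simp at this
    · rw [Fin.cons_zero, Fin.cons_succ] at hjj
      have : Sum.inr true ∈ Sum.inl '' ω j := hjj ▸ Or.inl rfl
      simp at this
    · rw [Fin.cons_succ, Fin.cons_succ] at hjj
      rw [hω.injOn (Set.mem_univ j) (Set.mem_univ j')
        (Set.image_injective.2 Sum.inl_injective hjj)]
  · rintro _ ⟨a | b, ha, rfl⟩
    · obtain ⟨j, _, hj⟩ := hω.surjOn (show {a, C.i a} ∈ C.edges from
        ⟨a, fun h => ha (congrArg Sum.inl h), rfl⟩)
      refine ⟨j.succ, Set.mem_univ _, ?_⟩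
      rw [Fin.cons_succ, hj, Set.image_pair]
      rfl
    · refine ⟨0, Set.mem_univ _, ?_⟩
      rw [Fin.cons_zero]
      cases b
      · exact Set.pair_comm _ _
      · rfl

end Expand

/-- A vertex of a connected graph that only has legs carries all legs. -/
theorem IsTree.legs_subset_star {C : HEGraph} (hC : C.IsTree) {v : C.V} (hv : C.star v ⊆ C.legs) :
    C.legs ⊆ C.star v := by
  intro h _
  refine ((hC.conn v (C.r h)).mem_iff (Z := fun w => w = v) ?_).1 rfl
  intro a _
  constructor
  · intro ha
    rw [show C.i a = a from hv ha, ha]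
  · intro ha
    have : C.i (C.i a) = C.i a := hv ha
    rw [C.i_i] at this
    rw [this, ha]

end HEGraph

theorem AdmissibleCover.root_eq_of_ram (X : AdmissibleCover) {k l : X.P.H} (h : X.C.r (X.fH k) = X.C.r (X.fH l))
    (hr : X.C.Ram X.μ (X.C.r (X.fH k))) : X.P.r k = X.P.r l := by
  have hf : X.fV (X.P.r k) = X.fV (X.P.r l) := by rw [X.f_r, X.f_r, h]
  rw [← X.f_r] at hr
  rcases X.fV_fibre _ _ hf with h1 | h1
  · exact h1.symm
  · rw [h1, (X.σV_eq_iff _).2 hr]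

namespace HCover

/-- The legs in `S` are rooted at one vertex of the target, and the lifts of the marked ones at one
vertex of the source. -/
def Together {g n : ℕ} (X : HCover g n) (S : Set X.C.H) : Prop :=
  (∃ v, S ⊆ X.C.star v) ∧ X.Coherent S

/-- If the legs of `S` are together, some section meets the lifts of all the markings in `S`, or of
none of them. -/
theorem Together.exists_section {g n : ℕ} {X : HCover g n} {S : Set X.C.H} (hS : X.Together S) :
    ∃ s : X.toAdmissibleCover.Section, ∀ j k, X.mC j ∈ S → X.mC k ∈ S →
      (X.mP j = s.s (X.mC j) ↔ X.mP k = s.s (X.mC k)) := by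
  classical
  obtain ⟨s⟩ := X.exists_section
  obtain ⟨⟨v, hv⟩, hc⟩ := hS
  by_cases hr : X.C.Ram X.μ v
  · -- over a ramified vertex, the section may be changed at every leg separately
    let t : X.C.H → X.P.H := fun h =>
      if hh : ∃ j, X.mC j = h ∧ h ∈ S then X.mP hh.choose else s.s h
    have ht : ∀ j, X.mC j ∈ S → t (X.mC j) = X.mP j := by
      intro j hj
      have hh : ∃ j', X.mC j' = X.mC j ∧ X.mC j ∈ S := ⟨j, rfl, hj⟩
      refine (dif_pos hh).trans (congrArg _ (X.mC_injective hh.choose_spec.1))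
    have ht' : ∀ h, (¬ ∃ j, X.mC j = h ∧ h ∈ S) → t h = s.s h := fun h hh => dif_neg hh
    have hft : ∀ h, X.fH (t h) = h := by
      intro h
      by_cases hh : ∃ j, X.mC j = h ∧ h ∈ S
      · obtain ⟨j, rfl, hj⟩ := hh
        rw [ht j hj, X.f_mP]
      · rw [ht' h hh, s.f_s]
    refine ⟨⟨t, hft, ?_, ?_⟩, fun j k hj hk => iff_of_true (ht j hj).symm (ht k hk).symm⟩
    · intro h
      by_cases hh : ∃ j, X.mC j = h ∧ h ∈ S
      · obtain ⟨j, rfl, hj⟩ := hh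
        rw [show X.C.i (X.mC j) = X.mC j from X.mC_leg j, ht j hj]
        exact X.mP_leg j
      · rw [ht' h hh, ht', s.i_s]
        rintro ⟨j, hj, hj'⟩
        have : X.C.i (X.mC j) = X.mC j := X.mC_leg j
        rw [hj, X.C.i_i] at this
        exact hh ⟨j, hj.trans this.symm, this ▸ hj'⟩
    · intro h h' hrr
      by_cases hhv : X.C.r h = v
      · exact AdmissibleCover.root_eq_of_ram _ (by rw [hft, hft, hrr]) (by rw [hft, hhv]; exact hr)
      · rw [ht', ht', s.r_s h h' hrr]
        · rintro ⟨j, -, hj⟩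
          exact hhv (hrr.trans (hv hj))
        · rintro ⟨j, -, hj⟩
          exact hhv (hv hj)
  · refine ⟨s, fun j k hj hk => ?_⟩
    have hrj : X.C.r (X.mC j) = v := hv hj
    have hrk : X.C.r (X.mC k) = v := hv hk
    have := (s.root_eq_iff (k := X.mP j) (l := X.mP k) (by rw [X.f_mP, X.f_mP, hrj, hrk])).1
      (hc j k hj hk)
    rw [X.f_mP, X.f_mP, hrj] at this
    exact this.resolve_left hr

open Classical in
/-- The expansion of a cover at legs `S` rooted at the vertex `v`; the source is the canonical
cover of the expanded tree, and the markings are lifted to the sheets in which a section `s` of the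
given cover finds them. -/
noncomputable def expand {g n : ℕ} (X : HCover g n) (S : Set X.C.H) (v : X.C.V)
    (s : X.toAdmissibleCover.Section) (hS : S ⊆ X.C.legs) (hv : S ⊆ X.C.star v)
    (h2 : 2 ≤ S.ncard) (h2' : 2 ≤ (X.C.star v \ S).ncard) (h3 : S.ncard + 3 ≤ 2 * g + 2 + n)
    (hpure : S ⊆ Set.range X.mC ∨ Disjoint S (Set.range X.mC))
    (hs : ∀ j k, X.mC j ∈ S → X.mC k ∈ S →
      (X.mP j = s.s (X.mC j) ↔ X.mP k = s.s (X.mC k))) : HCover g n where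
  toAdmissibleCover := AdmissibleCover.ofTree (X.C.expand S v)
    (HEGraph.expand_isTree X.tree hS hv) (HEGraph.expand_stable X.stable hv h2 h2')
    (X.C.expandμ S X.μ) (by
      rintro (h | b)
      · exact X.μ_i h
      · exact (ZMod.neg_eq_self_mod_two _).symm) (HEGraph.expandμ_sum X.μ_sum hv)
  mC j := Sum.inl (X.mC j)
  mC_leg j := by
    change _ ∈ (X.C.expand S v).legs
    rw [HEGraph.expand_legs]
    exact ⟨_, X.mC_leg j, rfl⟩
  mC_injective j k h := X.mC_injective (Sum.inl_injective h)
  card_legs := by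
    change (X.C.expand S v).legs.ncard = _
    rw [HEGraph.expand_legs, Set.ncard_image_of_injective _ Sum.inl_injective, X.card_legs]
  mP j := ⟨(Sum.inl (X.mC j), !decide (X.mP j = s.s (X.mC j))), fun h => by
    have h : X.μ (X.mC j) = 1 := h
    rw [X.μ_marked] at h
    exact absurd h zero_ne_one⟩
  mP_leg j := Subtype.ext (Prod.ext (congrArg Sum.inl (X.mC_leg j)) rfl)
  f_mP j := rfl
  μ_marked j := X.μ_marked j
  μ_unmarked := by
    intro h hh hm
    change h ∈ (X.C.expand S v).legs at hh
    rw [HEGraph.expand_legs] at hh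
    obtain ⟨h, hh, rfl⟩ := hh
    refine X.μ_unmarked h hh ?_
    rintro ⟨j, rfl⟩
    exact hm ⟨j, rfl⟩
  not_conjugate := by
    intro w hw3 hw2 j k hj hk
    change ((X.C.expand S v).star w).ncard = 3 at hw3
    change ((X.C.expand S v).star w ∩ (X.C.expand S v).legs).ncard = 2 at hw2
    change (X.C.expand S v).r (Sum.inl (X.mC j)) = w at hj
    change (X.C.expand S v).r (Sum.inl (X.mC k)) = w at hk
    suffices h : (X.C.expand S v).Ram (X.C.expandμ S X.μ) w ∨
        (X.mP j = s.s (X.mC j) ↔ X.mP k = s.s (X.mC k)) by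
      refine Subtype.ext (Prod.ext (hj.trans hk.symm) ?_)
      change (if (X.C.expand S v).Ram (X.C.expandμ S X.μ) ((X.C.expand S v).r (Sum.inl (X.mC j)))
        then false else _) = if (X.C.expand S v).Ram (X.C.expandμ S X.μ)
          ((X.C.expand S v).r (Sum.inl (X.mC k))) then false else _
      rw [hj, hk]
      rcases h with h | h
      · rw [if_pos h, if_pos h]
      · simp only [h]
    have hmem : ∀ j, (X.C.expand S v).r (Sum.inl (X.mC j)) = none → X.mC j ∈ S := by
      intro j hj
      by_contra h
      rw [HEGraph.expand_r_of_notMem h] at hj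
      simp at hj
    have hroot : ∀ j w, (X.C.expand S v).r (Sum.inl (X.mC j)) = some w → X.C.r (X.mC j) = w := by
      intro j w hj
      rw [← HEGraph.expand_r_getD hv, hj]; rfl
    rcases w with _ | w
    · exact Or.inr (hs j k (hmem j hj) (hmem k hk))
    · by_cases hw : w = v
      · subst hw
        exfalso
        rw [HEGraph.expand_star_some, Set.ncard_insert_of_notMem (by simp),
          Set.ncard_image_of_injective _ Sum.inl_injective] at hw3
        rw [HEGraph.expand_star_some, HEGraph.expand_legs, Set.insert_inter_of_notMem (by simp),
          ← Set.image_inter Sum.inl_injective,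
          Set.ncard_image_of_injective _ Sum.inl_injective] at hw2
        have hsub : X.C.star w \ S ⊆ X.C.legs := by
          have := Set.eq_of_subset_of_ncard_le
            (Set.inter_subset_left (s := X.C.star w \ S) (t := X.C.legs)) (by omega)
          rw [← this]
          exact Set.inter_subset_right
        have hst : X.C.star w ⊆ X.C.legs := fun a ha => by
          by_cases haS : a ∈ S
          · exact hS haS
          · exact hsub ⟨ha, haS⟩
        have h4 := Set.ncard_le_ncard (X.tree.legs_subset_star hst)
        have h5 := Set.ncard_sdiff_add_ncard_of_subset hv
        rw [X.card_legs] at h4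
        omega
      · rw [HEGraph.expand_star_some_of_ne hv hw,
          Set.ncard_image_of_injective _ Sum.inl_injective] at hw3
        rw [HEGraph.expand_star_some_of_ne hv hw, HEGraph.expand_legs,
          ← Set.image_inter Sum.inl_injective,
          Set.ncard_image_of_injective _ Sum.inl_injective] at hw2
        have hj' := hroot j w hj
        have hk' := hroot k w hk
        have := X.not_conjugate w hw3 hw2 j k hj' hk'
        rw [s.root_eq_iff (by rw [X.f_mP, X.f_mP, hj', hk']), X.f_mP, X.f_mP, hj'] at this
        refine this.imp_left ?_
        rintro ⟨a, ha, ha1⟩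
        refine ⟨Sum.inl a, ?_, ha1⟩
        rw [HEGraph.expand_star_some_of_ne hv hw]
        exact ⟨a, ha, rfl⟩
  not_weierstrass := by
    rintro w ⟨hw3, hw2, hw1⟩
    change ((X.C.expand S v).star w).ncard = 3 at hw3
    change ((X.C.expand S v).star w ∩ (X.C.expand S v).legs).ncard = 2 at hw2
    change {j | (X.C.expand S v).r (Sum.inl (X.mC j)) = w}.ncard = 1 at hw1
    rcases w with _ | w
    · rw [HEGraph.expand_star_none, Set.ncard_insert_of_notMem (by simp),
        Set.ncard_image_of_injective _ Sum.inl_injective] at hw3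
      have hset : {j | (X.C.expand S v).r (Sum.inl (X.mC j)) = none} = {j | X.mC j ∈ S} := by
        ext j
        by_cases h : X.mC j ∈ S
        · exact iff_of_true (HEGraph.expand_r_of_mem h) h
        · refine iff_of_false (fun hj => ?_) h
          have hj : (X.C.expand S v).r (Sum.inl (X.mC j)) = none := hj
          rw [HEGraph.expand_r_of_notMem h] at hj
          simp at hj
      rw [hset] at hw1
      rcases hpure with hp | hp
      · have : S = X.mC '' {j | X.mC j ∈ S} := by
          ext a
          constructor
          · intro ha
            obtain ⟨j, rfl⟩ := hp ha
            exact ⟨j, ha, rfl⟩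
          · rintro ⟨j, hj, rfl⟩
            exact hj
        rw [this, Set.ncard_image_of_injective _ X.mC_injective] at hw3
        omega
      · have : {j | X.mC j ∈ S} = ∅ := by
          ext j
          exact iff_of_false (fun hj => Set.disjoint_left.1 hp hj ⟨j, rfl⟩) (fun h => h)
        rw [this, Set.ncard_empty] at hw1
        omega
    · by_cases hw : w = v
      · subst hw
        rw [HEGraph.expand_star_some, Set.ncard_insert_of_notMem (by simp),
          Set.ncard_image_of_injective _ Sum.inl_injective] at hw3
        rw [HEGraph.expand_star_some, HEGraph.expand_legs, Set.insert_inter_of_notMem (by simp),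
          ← Set.image_inter Sum.inl_injective,
          Set.ncard_image_of_injective _ Sum.inl_injective] at hw2
        have hsub : X.C.star w \ S ⊆ X.C.legs := by
          have := Set.eq_of_subset_of_ncard_le
            (Set.inter_subset_left (s := X.C.star w \ S) (t := X.C.legs)) (by omega)
          rw [← this]
          exact Set.inter_subset_right
        have hst : X.C.star w ⊆ X.C.legs := fun a ha => by
          by_cases haS : a ∈ S
          · exact hS haS
          · exact hsub ⟨ha, haS⟩
        have h4 := Set.ncard_le_ncard (X.tree.legs_subset_star hst)
        have h5 := Set.ncard_sdiff_add_ncard_of_subset hv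
        rw [X.card_legs] at h4
        omega
      · rw [HEGraph.expand_star_some_of_ne hv hw,
          Set.ncard_image_of_injective _ Sum.inl_injective] at hw3
        rw [HEGraph.expand_star_some_of_ne hv hw, HEGraph.expand_legs,
          ← Set.image_inter Sum.inl_injective,
          Set.ncard_image_of_injective _ Sum.inl_injective] at hw2
        refine X.not_weierstrass w ⟨hw3, hw2, ?_⟩
        rw [← hw1]
        congr 1
        ext j
        change X.mC j ∈ X.C.star w ↔ Sum.inl (X.mC j) ∈ (X.C.expand S v).star (some w)
        rw [HEGraph.expand_star_some_of_ne hv hw, Sum.inl_injective.mem_set_image]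

end HCover

namespace LabelledHCover

/-- The legs `S` of `X` have been moved to a fan with edge label `0` in `Y`. -/
def IsExpansion {g n k : ℕ} (X : LabelledHCover g n k) (S : Set X.C.H)
    (Y : LabelledHCover g n (k + 1)) : Prop :=
  ∃ e : Iso (Y.face (0 : Fin (k + 1)).succAboveEmb) X,
    Y.Fan 0 {h | ∃ hh, e.ψ.eH ⟨h, hh⟩ ∈ S}

/-- Legs that are together can be moved to a fan, unless they already form one.  At least two further
half-edges then remain at the old vertex: if it only carries legs, these are all the legs of the
tree, of which there are enough, and otherwise one further half-edge would make `S` a fan.  Since the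
legs in `S` are all marked or all unmarked, the new vertex is not of a forbidden kind. -/
theorem exists_isExpansion {g n k : ℕ} (X : LabelledHCover g n k) {S : Set X.C.H}
    (hS : S ⊆ X.C.legs) (ht : X.Together S) (h2 : 2 ≤ S.ncard) (h3 : S.ncard + 3 ≤ 2 * g + 2 + n)
    (hpure : S ⊆ Set.range X.mC ∨ Disjoint S (Set.range X.mC)) (hf : ∀ a, ¬ X.C.IsFan a S) :
    ∃ Y, X.IsExpansion S Y := by
  classical
  obtain ⟨s, hs⟩ := ht.exists_section
  obtain ⟨⟨v, hv⟩, hc⟩ := ht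
  have h5 := Set.ncard_sdiff_add_ncard_of_subset hv
  have h2' : 2 ≤ (X.C.star v \ S).ncard := by
    by_contra! hlt
    by_cases hst : X.C.star v ⊆ X.C.legs
    · have h4 := Set.ncard_le_ncard (X.tree.legs_subset_star hst)
      rw [X.card_legs] at h4
      omega
    · obtain ⟨a, ha, hal⟩ := Set.not_subset.1 hst
      have haS : a ∉ S := fun h => hal (hS h)
      refine hf a ⟨hal, hS, ?_⟩
      rw [show X.C.r a = v from ha]
      have h6 : X.C.star v \ S = {a} := by
        refine (Set.eq_of_subset_of_ncard_le (s := {a})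
          (Set.singleton_subset_iff.2 (show a ∈ X.C.star v \ S from And.intro ha haS)) ?_).symm
        rw [Set.ncard_singleton]; omega
      rw [← Set.sdiff_union_of_subset hv, h6]
      rfl
  let Y : LabelledHCover g n (k + 1) :=
    { X.toHCover.expand S v s hS hv h2 h2' h3 hpure hs with
      ω := Fin.cons {Sum.inr true, Sum.inr false} (fun j => Sum.inl '' X.ω j)
      ω_bijOn := HEGraph.expand_bijOn X.ω_bijOn }
  have hrem : Y.removed (0 : Fin (k + 1)).succAboveEmb = {Sum.inr true, Sum.inr false} :=
    Y.removed_succAboveEmb 0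
  have hnot : ∀ h : X.C.H, Sum.inl h ∉ Y.removed (0 : Fin (k + 1)).succAboveEmb := by
    intro h hh
    have hh : Sum.inl h ∈ ({Sum.inr true, Sum.inr false} : Set (X.C.H ⊕ Bool)) := hrem ▸ hh
    simp at hh
  let E : X.C.H ≃ (Y.face (0 : Fin (k + 1)).succAboveEmb).C.H :=
    Equiv.ofBijective (fun h => ⟨Sum.inl h, hnot h⟩) (by
      constructor
      · intro a b hab
        exact Sum.inl_injective (congrArg Subtype.val hab)
      · rintro ⟨a | b, hh⟩
        · exact ⟨a, rfl⟩
        · refine absurd ?_ hh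
          rw [hrem]
          cases b
          · exact Or.inr rfl
          · exact Or.inl rfl)
  let ψ : HEGraph.Iso X.C (Y.face (0 : Fin (k + 1)).succAboveEmb).C :=
    HEGraph.Iso.ofHalfEdges X.star_nonempty
      (Y.face (0 : Fin (k + 1)).succAboveEmb).star_nonempty E (fun h => rfl) (fun h h' => by
        refine Iff.trans ?_ HEGraph.mk_eq_iff.symm
        have hc : ∀ F : Set Y.C.H, F = {Sum.inr true, Sum.inr false} →
            (X.C.r h = X.C.r h' ↔ Y.C.Conn F (Y.C.r (Sum.inl h)) (Y.C.r (Sum.inl h'))) := by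
          rintro _ rfl
          exact (HEGraph.expand_conn_iff hv h h').symm
        exact hc _ hrem)
  let t : Y.toAdmissibleCover.Section := AdmissibleCover.ofTreeSection ..
  let e : Iso X (Y.face (0 : Fin (k + 1)).succAboveEmb) :=
    Iso.ofSections ψ (fun j => rfl) (fun h => rfl)
      (fun j h => by
        change Sum.inl h ∈ Y.ω ((0 : Fin (k + 1)).succAbove j) ↔ _
        rw [Fin.succAbove_zero_apply]
        exact Sum.inl_injective.mem_set_image)
      s (t.contract (Y.isEdgeSet_removed _)) (fun j => by
        constructor
        · intro h
          refine Subtype.ext (Subtype.ext (Prod.ext rfl ?_))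
          change (!decide (X.mP j = s.s (X.mC j))) = false
          simpa using h
        · intro h
          have : (!decide (X.mP j = s.s (X.mC j))) = false :=
            congrArg (fun z => z.1.1.2) h
          simpa using this)
  have hT : {h | ∃ hh, e.symm.ψ.eH ⟨h, hh⟩ ∈ S} = Sum.inl '' S := by
    ext h
    constructor
    · rintro ⟨hh, hS⟩
      refine ⟨_, hS, ?_⟩
      exact congrArg Subtype.val (E.apply_symm_apply ⟨h, hh⟩)
    · rintro ⟨a, ha, rfl⟩
      refine ⟨hnot a, ?_⟩
      change E.symm (E a) ∈ S
      rw [E.symm_apply_apply]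
      exact ha
  refine ⟨Y, e.symm, ?_⟩
  rw [hT]
  refine ⟨Sum.inr true, Or.inl rfl, HEGraph.expand_isFan hS, ?_⟩
  intro j l hj hl
  have hj : X.mC j ∈ S := Sum.inl_injective.mem_set_image.1 hj
  have hl : X.mC l ∈ S := Sum.inl_injective.mem_set_image.1 hl
  have hrj : (X.C.expand S v).r (Sum.inl (X.mC j)) = none := HEGraph.expand_r_of_mem hj
  have hrl : (X.C.expand S v).r (Sum.inl (X.mC l)) = none := HEGraph.expand_r_of_mem hl
  refine Subtype.ext (Prod.ext (hrj.trans hrl.symm) ?_)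
  change (if (X.C.expand S v).Ram (X.C.expandμ S X.μ) ((X.C.expand S v).r (Sum.inl (X.mC j)))
    then false else !decide (X.mP j = s.s (X.mC j))) =
      if (X.C.expand S v).Ram (X.C.expandμ S X.μ) ((X.C.expand S v).r (Sum.inl (X.mC l)))
        then false else !decide (X.mP l = s.s (X.mC l))
  rw [hrj, hrl]
  simp only [hs j l hj hl]

end LabelledHCover

/-! ### Bunches, fans and expansions under isomorphisms and contractions -/

namespace HEGraph

/-- A path along edges that do not touch its first vertex is constant. -/
theorem Conn.eq_of_root_ne {C : HEGraph} {F : Set C.H} (hF : C.IsEdgeSet F) {v w : C.V}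
    (hv : ∀ h ∈ F, C.r h ≠ v) (h : C.Conn F v w) : w = v :=
  (Conn.mem_iff (Z := fun x => x = v)
    (fun a ha => iff_of_false (hv a ha) (hv _ (hF a ha).1)) h).1 rfl

theorem IsFan.root_ne_of_mem {C : HEGraph} {h : C.H} {S : Set C.H} (hf : C.IsFan h S) {F : Set C.H}
    (hF : C.IsEdgeSet F) (hh : h ∉ F) : ∀ a ∈ F, C.r a ≠ C.r h := by
  intro a ha hr
  rcases hf.root_eq_iff.1 hr with rfl | h1
  · exact hh ha
  · exact (hF a ha).2 (hf.legs h1)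

theorem IsFan.contract {C : HEGraph} {h : C.H} {S : Set C.H} (hf : C.IsFan h S) {F : Set C.H}
    (hF : C.IsEdgeSet F) (hh : h ∉ F) :
    (C.contract F hF).IsFan ⟨h, hh⟩ {a | a.1 ∈ S} where
  ne := fun h1 => hf.ne (congrArg Subtype.val h1)
  legs := fun a ha => Subtype.ext (hf.legs ha)
  star := by
    ext a
    have h1 : a ∈ (C.contract F hF).star ((C.contract F hF).r ⟨h, hh⟩) ↔
        C.Conn F (C.r a.1) (C.r h) := mk_eq_iff
    rw [h1]
    constructor
    · intro hc
      rcases hf.root_eq_iff.1 (hc.symm.eq_of_root_ne hF (hf.root_ne_of_mem hF hh)) with h2 | h2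
      · exact Or.inl (Subtype.ext h2)
      · exact Or.inr h2
    · intro ha
      have : C.r a.1 = C.r h := hf.root_eq_iff.2 (ha.imp (fun h2 => congrArg Subtype.val h2) id)
      rw [this]; exact Conn.refl _

theorem IsFan.preimage {C D : HEGraph} (e : Iso C D) {h : C.H} {S : Set D.H}
    (hf : D.IsFan (e.eH h) S) : C.IsFan h (e.eH ⁻¹' S) where
  ne h1 := hf.ne (by rw [← e.map_i, h1])
  legs a ha := e.eH.injective (by rw [e.map_i]; exact hf.legs ha)
  star := by
    ext a
    change C.r a = C.r h ↔ _
    rw [← e.root_eq_iff, hf.root_eq_iff]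
    exact or_congr e.eH.injective.eq_iff Iff.rfl

/-- A fan `S` of the contraction of the edge of a fan `T` with at least as many legs comes from a
fan unless `T ⊆ S`. -/
theorem IsFan.of_contract {C : HEGraph} {a h : C.H} {T : Set C.H} (hT : C.IsFan a T)
    {F : Set C.H} (hF : C.IsEdgeSet F) (hFa : F = {a, C.i a}) {hh : h ∉ F}
    {S : Set {h // h ∉ F}} (hS : (C.contract F hF).IsFan ⟨h, hh⟩ S)
    (hTS : ¬ T ⊆ {b | ∃ hb, ⟨b, hb⟩ ∈ S}) : (∀ b ∈ F, C.r b ≠ C.r h) ∧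
      C.IsFan h {b | ∃ hb, ⟨b, hb⟩ ∈ S} := by
  have hst : ∀ b hb, C.Conn F (C.r b) (C.r h) ↔ b = h ∨ (⟨b, hb⟩ : {h // h ∉ F}) ∈ S := by
    intro b hb
    refine Iff.trans mk_eq_iff.symm ((hS.root_eq_iff (a := ⟨b, hb⟩)).trans
      (or_congr ⟨fun h1 => congrArg Subtype.val h1, fun h1 => Subtype.ext h1⟩ Iff.rfl))
  have hS' : ∀ b hb, (⟨b, hb⟩ : {h // h ∉ F}) ∈ S → b ∈ C.legs := fun b hb h1 =>
    congrArg Subtype.val (hS.legs h1)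
  have hne : C.i h ≠ h := fun h1 => hS.ne (Subtype.ext h1)
  have hroot : ∀ b ∈ F, C.r b ≠ C.r h := by
    intro b hb hr
    apply hTS
    intro t ht
    have htF : t ∉ F := hFa ▸ leg_notMem_pair hT.ne (hT.legs ht)
    refine ⟨htF, ((hst t htF).1 ?_).resolve_left ?_⟩
    · have h1 : C.Conn F (C.r a) (C.r h) := by
        have ha : a ∈ F := hFa ▸ Or.inl rfl
        rw [hFa] at hb
        rcases hb with rfl | hb
        · rw [hr]; exact Conn.refl _
        · rw [← hr, Set.mem_singleton_iff.1 hb]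
          exact Conn.step ha
      rwa [hT.root_eq_iff.2 (Or.inr ht)]
    · rintro rfl
      exact hne (hT.legs ht)
  refine ⟨hroot, hne, ?_, ?_⟩
  · rintro b ⟨hb, hbS⟩
    exact hS' b hb hbS
  · ext b
    constructor
    · intro hb
      have hb : C.r b = C.r h := hb
      have hbF : b ∉ F := fun h1 => hroot b h1 hb
      refine ((hst b hbF).1 ?_).imp id (fun h1 => ⟨hbF, h1⟩)
      rw [hb]; exact Conn.refl _
    · rintro (rfl | ⟨hbF, hb⟩)
      · rfl
      · exact ((hst b hbF).2 (Or.inr hb)).symm.eq_of_root_ne hF hroot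

end HEGraph

namespace HCover

theorem IsBunch.contract {g n s : ℕ} {B : Set (Fin n)} {X : HCover g n} {S : Set X.C.H}
    (hS : X.IsBunch B s S) {F : Set X.C.H} (hF : X.C.IsEdgeSet F) :
    (X.contract F hF).IsBunch B s {a | a.1 ∈ S} where
  legs _ ha := Subtype.ext (hS.legs ha)
  mem_iff j := hS.mem_iff j
  ncard := by
    refine (Set.ncard_image_of_injective _ Subtype.val_injective).symm.trans
      (Eq.trans (congrArg _ ?_) hS.ncard)
    ext a
    constructor
    · rintro ⟨a, ⟨h1, h2⟩, rfl⟩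
      exact ⟨h1, fun ⟨j, hj⟩ => h2 ⟨j, Subtype.ext hj⟩⟩
    · rintro ⟨h1, h2⟩
      exact ⟨⟨a, not_mem_of_leg hF (hS.legs h1)⟩,
        ⟨h1, fun ⟨j, hj⟩ => h2 ⟨j, congrArg Subtype.val hj⟩⟩, rfl⟩

theorem IsBunch.of_contract {g n s : ℕ} {B : Set (Fin n)} {X : HCover g n} {F : Set X.C.H}
    {hF : X.C.IsEdgeSet F} {S : Set {h // h ∉ F}} (hS : (X.contract F hF).IsBunch B s S) :
    X.IsBunch B s {a | ∃ ha, ⟨a, ha⟩ ∈ S} where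
  legs := fun _ ⟨_, ha⟩ => congrArg Subtype.val (hS.legs ha)
  mem_iff j := by
    rw [← hS.mem_iff j]
    exact ⟨fun ⟨_, ha⟩ => ha, fun ha => ⟨_, ha⟩⟩
  ncard := by
    refine Eq.trans (Eq.symm ?_) hS.ncard
    refine (Set.ncard_image_of_injective _ Subtype.val_injective).symm.trans (congrArg _ ?_)
    ext a
    constructor
    · rintro ⟨a, ⟨h1, h2⟩, rfl⟩
      exact ⟨⟨a.2, h1⟩, fun ⟨j, hj⟩ => h2 ⟨j, Subtype.ext hj⟩⟩
    · rintro ⟨⟨ha, h1⟩, h2⟩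
      exact ⟨⟨a, ha⟩, ⟨h1, fun ⟨j, hj⟩ => h2 ⟨j, congrArg Subtype.val hj⟩⟩, rfl⟩

theorem IsBunch.ncard_eq {g n s : ℕ} {B : Set (Fin n)} {X : HCover g n} {S : Set X.C.H}
    (hS : X.IsBunch B s S) : S.ncard = B.ncard + s := by
  rw [← Set.ncard_inter_add_ncard_sdiff_eq_ncard S (Set.range X.mC), hS.ncard]
  congr 1
  rw [← Set.ncard_image_of_injective B X.mC_injective]
  congr 1
  ext a
  constructor
  · rintro ⟨h1, j, rfl⟩
    exact ⟨j, (hS.mem_iff j).1 h1, rfl⟩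
  · rintro ⟨j, hj, rfl⟩
    exact ⟨(hS.mem_iff j).2 hj, j, rfl⟩

/-- Marked legs that are rooted away from the contracted edges have the same root in the source if
this holds after the contraction. -/
theorem Coherent.of_contract {g n : ℕ} {X : HCover g n} {F : Set X.C.H} {hF : X.C.IsEdgeSet F}
    {S : Set {h // h ∉ F}} (hS : (X.contract F hF).Coherent S)
    (hr : ∀ a ∈ S, ∀ b ∈ F, X.C.r b ≠ X.C.r a.1) : X.Coherent {a | ∃ ha, ⟨a, ha⟩ ∈ S} := by
  rintro j k ⟨hj, hjS⟩ ⟨hk, hkS⟩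
  have hc : X.P.Conn (X.fH ⁻¹' F) (X.P.r (X.mP j)) (X.P.r (X.mP k)) :=
    HEGraph.mk_eq_iff.1 (hS j k hjS hkS)
  refine (hc.eq_of_root_ne (X.isEdgeSet_preimage hF) fun b hb h1 => hr _ hjS _ hb ?_).symm
  have := congrArg X.fV h1
  rwa [X.f_r, X.f_r, X.f_mP] at this

end HCover

namespace LabelledHCover

variable {g n k l s : ℕ} {B : Set (Fin n)}

theorem IsBunch.preimage {X Y : LabelledHCover g n k} (e : Iso X Y) {S : Set Y.C.H}
    (hS : Y.IsBunch B s S) : X.IsBunch B s (e.ψ.eH ⁻¹' S) where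
  legs a ha := e.ψ.eH.injective (by rw [e.ψ.map_i]; exact hS.legs ha)
  mem_iff j := by rw [← hS.mem_iff j, ← e.map_mC]; rfl
  ncard := by
    rw [← hS.ncard, ← Set.ncard_image_of_injective _ e.ψ.eH.injective]
    congr 1
    ext a
    obtain ⟨a, rfl⟩ := e.ψ.eH.surjective a
    rw [e.ψ.eH.injective.mem_set_image]
    refine and_congr Iff.rfl (not_congr (exists_congr fun j => ?_))
    rw [← e.map_mC, e.ψ.eH.injective.eq_iff]

theorem Coherent.preimage {X Y : LabelledHCover g n k} (e : Iso X Y) {S : Set Y.C.H}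
    (hS : Y.Coherent S) : X.Coherent (e.ψ.eH ⁻¹' S) := by
  intro j l hj hl
  rw [Set.mem_preimage, e.map_mC] at hj hl
  have := hS j l hj hl
  rwa [← e.map_mP, ← e.map_mP, e.φ.root_eq_iff] at this

theorem Fan.preimage {X Y : LabelledHCover g n k} (e : Iso X Y) {i : Fin k} {S : Set Y.C.H}
    (hS : Y.Fan i S) : X.Fan i (e.ψ.eH ⁻¹' S) := by
  obtain ⟨h, hh, hf, hc⟩ := hS
  obtain ⟨h, rfl⟩ := e.ψ.eH.surjective h
  exact ⟨h, (e.map_ω i h).1 hh, hf.preimage, Coherent.preimage e hc⟩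

theorem Fan.face {X : LabelledHCover g n l} {ι : Fin k ↪ Fin l} {i : Fin k} {j : Fin l}
    (hij : ι i = j) {S : Set X.C.H} (hS : X.Fan j S) : (X.face ι).Fan i {a | a.1 ∈ S} := by
  subst hij
  obtain ⟨h, hh, hf, hc⟩ := hS
  refine ⟨⟨h, X.not_mem_removed ι hh⟩, hh, hf.contract (X.isEdgeSet_removed ι) _, ?_⟩
  intro j l hj hl
  exact congrArg (Quot.mk _) (hc j l hj hl)

/-- A fan of the contraction of the edge of another fan with as many legs comes from a fan. -/
theorem Fan.of_face {X : LabelledHCover g n (k + 1)} {T : Set X.C.H} (hT : X.Fan 0 T) {i : Fin k}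
    {S : Set (X.face (0 : Fin (k + 1)).succAboveEmb).C.H}
    (hS : (X.face (0 : Fin (k + 1)).succAboveEmb).Fan i S)
    (hTS : ¬ T ⊆ {b | ∃ hb, ⟨b, hb⟩ ∈ S}) : X.Fan i.succ {b | ∃ hb, ⟨b, hb⟩ ∈ S} := by
  obtain ⟨a, haω, ha, -⟩ := hT
  obtain ⟨⟨h, hh⟩, hhω, hf, hc⟩ := hS
  have hFa : X.removed (0 : Fin (k + 1)).succAboveEmb = {a, X.C.i a} :=
    (X.removed_succAboveEmb 0).trans (X.ω_eq_pair haω)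
  have h1 := ha.of_contract (X.isEdgeSet_removed _) hFa hf hTS
  refine ⟨h, hhω, h1.2, hc.of_contract (hF := X.isEdgeSet_removed _) ?_⟩
  rintro ⟨b, hbF⟩ hb c hcF
  rw [h1.2.root_eq_iff.2 (Or.inr ⟨hbF, hb⟩)]
  exact h1.1 c hcF

/-- The faces along equal compositions are isomorphic, by an isomorphism that does not move the
half-edges. -/
theorem exists_iso_face_face {m : ℕ} (X : LabelledHCover g n m) {κ : Fin k ↪ Fin l}
    {ι : Fin l ↪ Fin m} {ι' : Fin k ↪ Fin m} (h : κ.trans ι = ι') :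
    ∃ e : Iso (X.face ι') ((X.face ι).face κ), ∀ a, (e.ψ.eH a).1.1 = a.1 := by
  subst h
  exact ⟨Iso.faceTrans X κ ι, fun _ => rfl⟩

namespace IsExpansion

theorem of_iso {X X' : LabelledHCover g n k} {S : Set X.C.H} {Y : LabelledHCover g n (k + 1)}
    (h : X.IsExpansion S Y) (f : Iso X' X) : X'.IsExpansion (f.ψ.eH ⁻¹' S) Y := by
  obtain ⟨e, he⟩ := h
  refine ⟨e.trans f.symm, ?_⟩
  convert he using 3 with a
  refine exists_congr fun ha => ?_
  rw [Set.mem_preimage]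
  exact iff_of_eq (congrArg (· ∈ S) (f.ψ.eH.apply_symm_apply _))

/-- The legs of the new fan form a bunch of the expansion. -/
theorem isBunch {X : LabelledHCover g n k} {S : Set X.C.H} {Y : LabelledHCover g n (k + 1)}
    (hS : X.IsBunch B s S) (e : Iso (Y.face (0 : Fin (k + 1)).succAboveEmb) X) :
    Y.IsBunch B s {h | ∃ hh, e.ψ.eH ⟨h, hh⟩ ∈ S} :=
  HCover.IsBunch.of_contract (hF := Y.isEdgeSet_removed _) (IsBunch.preimage e hS)

/-- The expansion at a bunch is unique. -/
theorem nonempty_iso (hs : s = 0 ∨ Odd s ∨ n ≤ 1) {X : LabelledHCover g n k} {S : Set X.C.H}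
    (hS : X.IsBunch B s S) (hne : S.Nonempty) {Y Y' : LabelledHCover g n (k + 1)}
    (h : X.IsExpansion S Y) (h' : X.IsExpansion S Y') : Nonempty (Iso Y Y') := by
  obtain ⟨e, he⟩ := h
  obtain ⟨e', he'⟩ := h'
  refine nonempty_iso_of_fan hs (isBunch hS e) (isBunch hS e') ?_ he he' (e.trans e'.symm) ?_
  · obtain ⟨a, ha⟩ := hne
    obtain ⟨⟨b, hb⟩, rfl⟩ := e.ψ.eH.surjective a
    exact ⟨b, hb, ha⟩
  · intro a ha
    have h1 : e'.ψ.eH ((e.trans e'.symm).ψ.eH ⟨a, ha⟩) = e.ψ.eH ⟨a, ha⟩ :=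
      e'.ψ.eH.apply_symm_apply _
    refine ⟨fun ⟨_, h⟩ => ⟨((e.trans e'.symm).ψ.eH ⟨a, ha⟩).2, ?_⟩, fun ⟨_, h⟩ => ⟨ha, ?_⟩⟩
    · exact h1 ▸ h
    · exact h1 ▸ h

/-- Expanding commutes with contracting and relabelling the edges other than the new one. -/
theorem face {X : LabelledHCover g n l} {S : Set X.C.H} {Y : LabelledHCover g n (l + 1)}
    (h : X.IsExpansion S Y) {ι : Fin k ↪ Fin l} {κ : Fin (k + 1) ↪ Fin (l + 1)} (h0 : κ 0 = 0)
    (hs : ∀ a, κ (Fin.succ a) = Fin.succ (ι a)) :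
    (X.face ι).IsExpansion {a | a.1 ∈ S} (Y.face κ) := by
  obtain ⟨e, he⟩ := h
  have hκ : (0 : Fin (k + 1)).succAboveEmb.trans κ = ι.trans (0 : Fin (l + 1)).succAboveEmb := by
    ext a
    simp [hs]
  obtain ⟨e₁, h₁⟩ := Y.exists_iso_face_face hκ
  obtain ⟨e₂, h₂⟩ := Y.exists_iso_face_face (rfl : ι.trans (0 : Fin (l + 1)).succAboveEmb = _)
  refine ⟨(e₁.symm.trans e₂).trans (e.face ι), ?_⟩
  have hset : {a | ∃ ha, ((e₁.symm.trans e₂).trans (e.face ι)).ψ.eH ⟨a, ha⟩ ∈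
      {a : (X.face ι).C.H | a.1 ∈ S}} = {a : (Y.face κ).C.H | ∃ ha, e.ψ.eH ⟨a.1, ha⟩ ∈ S} := by
    have key : ∀ a : ((Y.face κ).face (0 : Fin (k + 1)).succAboveEmb).C.H,
        (e₂.ψ.eH (e₁.ψ.eH.symm a)).1.1 = a.1.1 := by
      intro a
      obtain ⟨a, rfl⟩ := e₁.ψ.eH.surjective a
      rw [h₁, ← h₂]
      exact congrArg (fun z => (e₂.ψ.eH z).1.1) (e₁.ψ.eH.symm_apply_apply a)
    ext a
    constructor
    · rintro ⟨ha, hS⟩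
      refine ⟨fun h1 => (e₂.ψ.eH (e₁.ψ.eH.symm ⟨a, ha⟩)).1.2 ((key ⟨a, ha⟩).symm ▸ h1), ?_⟩
      have h1 : (⟨a.1, fun h1 => (e₂.ψ.eH (e₁.ψ.eH.symm ⟨a, ha⟩)).1.2 ((key ⟨a, ha⟩).symm ▸ h1)⟩ :
        (Y.face (0 : Fin (l + 1)).succAboveEmb).C.H) = (e₂.ψ.eH (e₁.ψ.eH.symm ⟨a, ha⟩)).1 :=
        Subtype.ext (key ⟨a, ha⟩).symm
      exact (congrArg (fun z => e.ψ.eH z ∈ S) h1).mpr hS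
    · rintro ⟨ha, hS⟩
      have ha' : a ∉ (Y.face κ).removed (0 : Fin (k + 1)).succAboveEmb := by
        rw [removed_succAboveEmb]
        rw [removed_succAboveEmb, ← h0] at ha
        exact ha
      refine ⟨ha', ?_⟩
      have h1 : (⟨a.1, ha⟩ : (Y.face (0 : Fin (l + 1)).succAboveEmb).C.H) =
        (e₂.ψ.eH (e₁.ψ.eH.symm ⟨a, ha'⟩)).1 := Subtype.ext (key ⟨a, ha'⟩).symm
      exact (congrArg (fun z => e.ψ.eH z ∈ S) h1).mp hS
  rw [hset]
  exact he.face h0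

/-- The expansion of a contracted fan is the original cover, up to the labels. -/
theorem of_fan {X : LabelledHCover g n (k + 1)} {i : Fin (k + 1)} {S : Set X.C.H}
    (hS : X.Fan i S) : (X.face i.succAboveEmb).IsExpansion {a | a.1 ∈ S}
      (X.face i.cycleRange.symm.toEmbedding) := by
  have hκ : (0 : Fin (k + 1)).succAboveEmb.trans i.cycleRange.symm.toEmbedding =
      i.succAboveEmb := by
    ext a
    simp
  obtain ⟨e, he⟩ := X.exists_iso_face_face hκ
  refine ⟨e.symm, ?_⟩
  have hset : {a | ∃ ha, e.symm.ψ.eH ⟨a, ha⟩ ∈ {a : (X.face i.succAboveEmb).C.H | a.1 ∈ S}} =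
      {a : (X.face i.cycleRange.symm.toEmbedding).C.H | a.1 ∈ S} := by
    have key : ∀ a, (e.ψ.eH.symm a).1 = a.1.1 := by
      intro a
      obtain ⟨a, rfl⟩ := e.ψ.eH.surjective a
      rw [he]
      exact congrArg Subtype.val (e.ψ.eH.symm_apply_apply a)
    ext a
    constructor
    · rintro ⟨ha, hS⟩
      exact (congrArg (· ∈ S) (key ⟨a, ha⟩)).mp hS
    · intro haS
      have ha : a ∉ (X.face i.cycleRange.symm.toEmbedding).removed
          (0 : Fin (k + 1)).succAboveEmb :=
        HCover.not_mem_of_leg (isEdgeSet_removed _ _) (hS.choose_spec.2.1.contract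
          (X.isEdgeSet_removed _) (X.not_mem_removed _ (j := 0) (by
            have := hS.choose_spec.1
            simpa using this)) |>.legs haS)
      exact ⟨ha, (congrArg (· ∈ S) (key ⟨a, ha⟩)).mpr haS⟩
  rw [hset]
  exact hS.face (by simp)

/-- The legs of a fan cannot be expanded. -/
theorem not_fan {X : LabelledHCover g n k} {S : Set X.C.H} {Y : LabelledHCover g n (k + 1)}
    (h : X.IsExpansion S Y) (hne : S.Nonempty) (i : Fin k) : ¬ X.Fan i S := by
  rintro ⟨a, -, ha, -⟩
  obtain ⟨e, b, hbω, hb, -⟩ := h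
  obtain ⟨c, hc⟩ := hne
  have hF : Y.removed (0 : Fin (k + 1)).succAboveEmb = {b, Y.C.i b} :=
    (Y.removed_succAboveEmb 0).trans (Y.ω_eq_pair hbω)
  obtain ⟨⟨c, hcF⟩, rfl⟩ := e.ψ.eH.surjective c
  have hcr : Y.C.r c = Y.C.r b := hb.root_eq_iff.2 (Or.inr ⟨hcF, hc⟩)
  have hbi := hb.root_ne
  -- the other end of the new edge carries two half-edges besides it, but the fan leaves only one
  have key : Y.C.star (Y.C.r (Y.C.i b)) ⊆ {Y.C.i b, (e.ψ.eH.symm a).1} := by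
    intro d hd
    have hd : Y.C.r d = Y.C.r (Y.C.i b) := hd
    by_cases hdF : d ∈ Y.removed (0 : Fin (k + 1)).succAboveEmb
    · rw [hF] at hdF
      rcases hdF with rfl | h1
      · exact absurd hd.symm hbi
      · exact Or.inl h1
    · right
      have hdc : (Y.face (0 : Fin (k + 1)).succAboveEmb).C.r ⟨d, hdF⟩ =
          (Y.face (0 : Fin (k + 1)).succAboveEmb).C.r ⟨c, hcF⟩ := by
        refine HEGraph.mk_eq_iff.2 ?_
        rw [hd, hcr]
        exact (HEGraph.Conn.step (hF ▸ Or.inl rfl)).symm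
      have hdc := (e.ψ.root_eq_iff _ _).2 hdc
      rcases ha.root_eq_iff.1 (hdc.trans (ha.root_eq_iff.2 (Or.inr hc))) with h1 | h1
      · exact congrArg Subtype.val ((Equiv.eq_symm_apply _).2 h1)
      · exact absurd (hd.symm.trans (hb.root_eq_iff.2 (Or.inr ⟨hdF, h1⟩))) hbi
  have h3 := Y.stable (Y.C.r (Y.C.i b))
  have h4 := Set.ncard_le_ncard key
  have h5 : ({Y.C.i b, (e.ψ.eH.symm a).1} : Set Y.C.H).ncard ≤ 2 :=
    (Set.ncard_insert_le _ _).trans (by simp)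
  omega

/-- Only legs with a common root can be expanded. -/
theorem exists_subset_star {X : LabelledHCover g n k} {S : Set X.C.H}
    {Y : LabelledHCover g n (k + 1)} (h : X.IsExpansion S Y) : ∃ v, S ⊆ X.C.star v := by
  obtain ⟨e, b, hbω, hb, -⟩ := h
  refine ⟨e.ψ.eV (Quot.mk _ (Y.C.r b)), ?_⟩
  intro c hc
  obtain ⟨⟨c, hcF⟩, rfl⟩ := e.ψ.eH.surjective c
  refine (e.ψ.map_r _).symm.trans ?_
  exact congrArg (fun z => e.ψ.eV (Quot.mk _ z)) (hb.root_eq_iff.2 (Or.inr ⟨hcF, hc⟩))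

end IsExpansion

end LabelledHCover

/-! ### Exchanging bunches and the chain of an expansion -/

/-- Two sets with equally many elements are exchanged by a permutation that only moves elements
of their symmetric difference. -/
theorem exists_perm_exchange {H : Type*} [Finite H] {S T : Set H} (h : S.ncard = T.ncard) :
    ∃ p : Equiv.Perm H, p ⁻¹' S = T ∧
      ∀ a, p a = a ∨ a ∈ S \ T ∧ p a ∈ T \ S ∨ a ∈ T \ S ∧ p a ∈ S \ T := by
  classical
  have hc : (S \ T).ncard = (T \ S).ncard := by
    have h1 := Set.ncard_inter_add_ncard_sdiff_eq_ncard S T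
    have h2 := Set.ncard_inter_add_ncard_sdiff_eq_ncard T S
    rw [Set.inter_comm] at h2
    omega
  obtain ⟨g⟩ : Nonempty (↥(S \ T) ≃ ↥(T \ S)) := Finite.card_eq.1 hc
  let f : H → H := fun a => if hA : a ∈ S \ T then g ⟨a, hA⟩ else
    if hB : a ∈ T \ S then g.symm ⟨a, hB⟩ else a
  have f1 : ∀ a (hA : a ∈ S \ T), f a = g ⟨a, hA⟩ := fun a hA => dif_pos hA
  have f2 : ∀ a (hB : a ∈ T \ S), f a = g.symm ⟨a, hB⟩ := fun a hB =>
    (dif_neg fun hA => hA.2 hB.1).trans (dif_pos hB)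
  have f3 : ∀ a, a ∉ S \ T → a ∉ T \ S → f a = a := fun a hA hB =>
    (dif_neg hA).trans (dif_neg hB)
  have hf : Function.Involutive f := by
    intro a
    by_cases hA : a ∈ S \ T
    · rw [f1 a hA, f2 _ (g _).2]; simp
    · by_cases hB : a ∈ T \ S
      · rw [f2 a hB, f1 _ (g.symm _).2]; simp
      · rw [f3 a hA hB, f3 a hA hB]
  have hcase : ∀ a, f a = a ∧ (a ∈ S ↔ a ∈ T) ∨ a ∈ S \ T ∧ f a ∈ T \ S ∨
      a ∈ T \ S ∧ f a ∈ S \ T := by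
    intro a
    by_cases hA : a ∈ S \ T
    · exact Or.inr (Or.inl ⟨hA, by rw [f1 a hA]; exact (g _).2⟩)
    · by_cases hB : a ∈ T \ S
      · exact Or.inr (Or.inr ⟨hB, by rw [f2 a hB]; exact (g.symm _).2⟩)
      · refine Or.inl ⟨f3 a hA hB, ?_⟩
        simp only [Set.mem_sdiff, not_and_not_right] at hA hB
        exact ⟨hA, hB⟩
  refine ⟨hf.toPerm f, ?_, fun a => (hcase a).imp And.left id⟩
  ext a
  change f a ∈ S ↔ a ∈ T
  rcases hcase a with ⟨h1, h2⟩ | ⟨h1, h2⟩ | ⟨h1, h2⟩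
  · rw [h1, h2]
  · exact iff_of_false h2.2 h1.2
  · exact iff_of_true h2.1 h1.1

namespace LabelledHCover

variable {g n k l s : ℕ} {B : Set (Fin n)}

/-- Two bunches at the same vertex are exchanged by an automorphism. -/
theorem exists_iso_exchange {X : LabelledHCover g n k} {S T : Set X.C.H} (hS : X.IsBunch B s S)
    (hT : X.IsBunch B s T) {v : X.C.V} (hSv : S ⊆ X.C.star v) (hTv : T ⊆ X.C.star v) :
    ∃ f : Iso X X, f.ψ.eH ⁻¹' S = T := by
  obtain ⟨p, hp, hp'⟩ := exists_perm_exchange (hS.ncard_eq.trans hT.ncard_eq.symm)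
  -- only unmarked legs at `v` are moved
  have hmov : ∀ a, p a = a ∨ ∀ b, b = a ∨ b = p a →
      X.C.i b = b ∧ X.C.r b = v ∧ b ∉ Set.range X.mC := by
    have h1 : ∀ b, b ∈ S \ T → X.C.i b = b ∧ X.C.r b = v ∧ b ∉ Set.range X.mC := fun b hb =>
      ⟨hS.legs hb.1, hSv hb.1, by
        rintro ⟨j, rfl⟩
        exact hb.2 ((hT.mem_iff j).2 ((hS.mem_iff j).1 hb.1))⟩
    have h2 : ∀ b, b ∈ T \ S → X.C.i b = b ∧ X.C.r b = v ∧ b ∉ Set.range X.mC := fun b hb =>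
      ⟨hT.legs hb.1, hTv hb.1, by
        rintro ⟨j, rfl⟩
        exact hb.2 ((hS.mem_iff j).2 ((hT.mem_iff j).1 hb.1))⟩
    intro a
    refine (hp' a).imp id ?_
    rintro (⟨h3, h4⟩ | ⟨h3, h4⟩) b (rfl | rfl)
    exacts [h1 _ h3, h2 _ h4, h2 _ h3, h1 _ h4]
  have hi : ∀ a, p (X.C.i a) = X.C.i (p a) := by
    intro a
    rcases hmov a with h1 | h1
    · rcases hmov (X.C.i a) with h2 | h2
      · rw [h1, h2]
      · have := (h2 _ (Or.inl rfl)).1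
        rw [X.C.i_i] at this
        rw [← this, h1, ← this]
    · rw [(h1 _ (Or.inl rfl)).1, (h1 _ (Or.inr rfl)).1]
  have hr : ∀ a, X.C.r (p a) = X.C.r a := by
    intro a
    rcases hmov a with h1 | h1
    · rw [h1]
    · rw [(h1 _ (Or.inl rfl)).2.1, (h1 _ (Or.inr rfl)).2.1]
  obtain ⟨σ⟩ := X.exists_section
  have hmC : ∀ j, p (X.mC j) = X.mC j := fun j =>
    (hmov _).resolve_right fun h1 => (h1 _ (Or.inl rfl)).2.2 ⟨j, rfl⟩
  refine ⟨Iso.ofSections (HEGraph.Iso.ofHalfEdges X.star_nonempty X.star_nonempty p hi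
    (fun a b => by rw [hr, hr])) hmC ?_ ?_ σ σ (fun j => Iff.rfl), hp⟩
  · intro a
    change X.μ (p a) = X.μ a
    rcases hmov a with h1 | h1
    · rw [h1]
    · have h2 := h1 _ (Or.inl rfl)
      have h3 := h1 _ (Or.inr rfl)
      rw [X.μ_unmarked _ h2.1 h2.2.2, X.μ_unmarked _ h3.1 h3.2.2]
  · intro j a
    change p a ∈ X.ω j ↔ a ∈ X.ω j
    rcases hmov a with h1 | h1
    · rw [h1]
    · exact iff_of_false (fun h => X.i_ne_of_mem_ω h (h1 _ (Or.inr rfl)).1)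
        (fun h => X.i_ne_of_mem_ω h (h1 _ (Or.inl rfl)).1)

theorem Coherent.face {X : LabelledHCover g n l} {S : Set X.C.H} (hS : X.Coherent S)
    (ι : Fin k ↪ Fin l) : (X.face ι).Coherent {a | a.1 ∈ S} := fun j l hj hl =>
  congrArg (Quot.mk _) (hS j l hj hl)

theorem IsExpansion.coherent {X : LabelledHCover g n k} {S : Set X.C.H}
    {Y : LabelledHCover g n (k + 1)} (h : X.IsExpansion S Y) : X.Coherent S := by
  obtain ⟨e, b, -, -, hc⟩ := h
  have := Coherent.preimage e.symm (Coherent.face hc (0 : Fin (k + 1)).succAboveEmb)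
  convert this using 1
  ext a
  constructor
  · intro ha
    exact ⟨(e.ψ.eH.symm a).2, by rwa [← e.ψ.eH.apply_symm_apply a] at ha⟩
  · rintro ⟨_, ha⟩
    have ha : e.ψ.eH (e.ψ.eH.symm a) ∈ S := ha
    rwa [e.ψ.eH.apply_symm_apply] at ha

/-- A permutation of the labels, extended by a new label `0`. -/
def extendPerm (ρ : Equiv.Perm (Fin k)) : Equiv.Perm (Fin (k + 1)) :=
  Equiv.Perm.decomposeFin.symm (0, ρ)

theorem sign_extendPerm (ρ : Equiv.Perm (Fin k)) : (extendPerm ρ).sign = ρ.sign :=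
  (Equiv.Perm.decomposeFin.symm_sign _ _).trans (by simp)

theorem IsExpansion.face_perm {X : LabelledHCover g n k} {S : Set X.C.H}
    {Y : LabelledHCover g n (k + 1)} (h : X.IsExpansion S Y) (ρ : Equiv.Perm (Fin k)) :
    (X.face ρ.toEmbedding).IsExpansion {a | a.1 ∈ S} (Y.face (extendPerm ρ).toEmbedding) :=
  h.face (by simp [extendPerm]) (by simp [extendPerm])

theorem IsExpansion.exists_of_face_perm {X : LabelledHCover g n k} {S : Set X.C.H}
    {ρ : Equiv.Perm (Fin k)} {Y : LabelledHCover g n (k + 1)}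
    (h : (X.face ρ.toEmbedding).IsExpansion {a | a.1 ∈ S} Y) : ∃ Y, X.IsExpansion S Y := by
  have hρ : ρ.symm.toEmbedding.trans ρ.toEmbedding = Function.Embedding.refl _ := by
    ext a; simp
  obtain ⟨e, he⟩ := X.exists_iso_face_face hρ
  have := (h.face_perm ρ.symm).of_iso ((Iso.faceId X).symm.trans e)
  refine ⟨_, (congrArg (fun S => X.IsExpansion S _) ?_).mp this⟩
  ext a
  exact iff_of_eq (congrArg (· ∈ S) (he _))

/-- The isomorphism class of a labelled cover, as a simplex. -/
def simplex (X : LabelledHCover g n k) : (Theta g n).simplices k := Quotient.mk (setoid g n k) X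

theorem pull_simplex (X : LabelledHCover g n l) (ι : Fin k ↪ Fin l) :
    (Theta g n).pull ι X.simplex = (X.face ι).simplex := rfl

theorem simplex_eq_iff {X Y : LabelledHCover g n k} :
    X.simplex = Y.simplex ↔ Nonempty (Iso X Y) :=
  Quotient.eq (r := setoid g n k)

theorem exists_simplex (x : (Theta g n).simplices k) : ∃ X : LabelledHCover g n k, X.simplex = x :=
  Quotient.exists_rep (s := setoid g n k) x

open Classical in
/-- The chain of the expansion of `X` at `S`, zero if there is none. -/
noncomputable def expansionChain (X : LabelledHCover g n k) (S : Set X.C.H) :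
    (Theta g n).Chains (k + 1) :=
  if h : ∃ Y, X.IsExpansion S Y then (Theta g n).chain h.choose.simplex else 0

theorem expansionChain_eq_zero {X : LabelledHCover g n k} {S : Set X.C.H}
    (h : ¬ ∃ Y, X.IsExpansion S Y) : X.expansionChain S = 0 := dif_neg h

theorem IsExpansion.chain_eq (hs : s = 0 ∨ Odd s ∨ n ≤ 1) {X : LabelledHCover g n k}
    {S : Set X.C.H} (hS : X.IsBunch B s S) (hne : S.Nonempty) {Y : LabelledHCover g n (k + 1)}
    (h : X.IsExpansion S Y) : X.expansionChain S = (Theta g n).chain Y.simplex := by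
  have h' : ∃ Y, X.IsExpansion S Y := ⟨Y, h⟩
  refine (dif_pos h').trans (congrArg _ (simplex_eq_iff.2 ?_))
  exact nonempty_iso hs hS hne h'.choose_spec h

theorem expansionChain_preimage (hs : s = 0 ∨ Odd s ∨ n ≤ 1) {X X' : LabelledHCover g n k}
    {S : Set X.C.H} (hS : X.IsBunch B s S) (hne : S.Nonempty) (f : Iso X' X) :
    X'.expansionChain (f.ψ.eH ⁻¹' S) = X.expansionChain S := by
  by_cases h : ∃ Y, X.IsExpansion S Y
  · obtain ⟨Y, h⟩ := h
    rw [h.chain_eq hs hS hne, (h.of_iso f).chain_eq hs (IsBunch.preimage f hS)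
      (hne.preimage f.ψ.eH.surjective)]
  · rw [expansionChain_eq_zero h, expansionChain_eq_zero]
    rintro ⟨Y, h'⟩
    refine h ⟨Y, ?_⟩
    convert h'.of_iso f.symm using 1
    ext a
    exact iff_of_eq (congrArg (· ∈ S) (f.ψ.eH.apply_symm_apply a).symm)

end LabelledHCover

/-! ### The operator that expands bunches -/

namespace LabelledHCover

variable {g n k l s : ℕ} {B : Set (Fin n)}

/-- Conditions on `B` and `s` under which the bunches consisting of `s` unmarked legs and the legs
marked by `B` can be expanded, in a unique way.  In the field `unique`, either the fan is unramified
and its marked legs fix the sheets, or the new edge is ramified, or there is at most one marking to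
be matched.  By `pure`, a bunch has only marked or only unmarked legs; by `le`, at least three legs
do not belong to it. -/
structure BunchType (g n : ℕ) (B : Set (Fin n)) (s : ℕ) : Prop where
  unique : s = 0 ∨ Odd s ∨ n ≤ 1
  pure : s = 0 ∨ B = ∅
  two_le : 2 ≤ B.ncard + s
  le : B.ncard + s + 3 ≤ 2 * g + 2 + n

theorem BunchType.nonempty (hB : BunchType g n B s) {X : HCover g n} {S : Set X.C.H}
    (hS : X.IsBunch B s S) : S.Nonempty := by
  rw [Set.nonempty_iff_ne_empty]
  rintro rfl
  have := hS.ncard_eq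
  have := hB.two_le
  simp only [Set.ncard_empty] at *
  omega

/-- Legs that are rooted at one vertex are expandable unless they already form a fan. -/
theorem BunchType.fan_or_isExpansion (hB : BunchType g n B s) {X : LabelledHCover g n k}
    {S : Set X.C.H} (hS : X.IsBunch B s S) (ht : X.Together S) :
    (∃ i, X.Fan i S) ∨ ∃ Y, X.IsExpansion S Y := by
  by_cases hf : ∃ a, X.C.IsFan a S
  · obtain ⟨a, ha⟩ := hf
    obtain ⟨i, -, hi⟩ := X.ω_bijOn.surjOn (show {a, X.C.i a} ∈ X.C.edges from ⟨a, ha.ne, rfl⟩)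
    exact Or.inl ⟨i, a, by rw [hi]; exact Or.inl rfl, ha, ht.2⟩
  · refine Or.inr (X.exists_isExpansion hS.legs ht ?_ ?_ ?_ (not_exists.1 hf))
    · rw [hS.ncard_eq]; exact hB.two_le
    · rw [hS.ncard_eq]; exact hB.le
    · rcases hB.pure with h | h
      · left
        have := hS.ncard
        rwa [h, Set.ncard_eq_zero, Set.sdiff_eq_empty] at this
      · right
        rw [Set.disjoint_left]
        rintro _ ha ⟨j, rfl⟩
        have := (hS.mem_iff j).1 ha
        rw [h] at this
        exact this

/-- The bunches of a face are the bunches of the cover. -/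
theorem bijOn_isBunch_face (X : LabelledHCover g n l) (ι : Fin k ↪ Fin l) :
    Set.BijOn (fun S => {a : (X.face ι).C.H | a.1 ∈ S}) {S | X.IsBunch B s S}
      {S | (X.face ι).IsBunch B s S} := by
  refine ⟨fun S hS => HCover.IsBunch.contract hS (X.isEdgeSet_removed ι), ?_, ?_⟩
  · have key : ∀ S T : Set X.C.H, X.IsBunch B s S →
        {a : (X.face ι).C.H | a.1 ∈ S} = {a : (X.face ι).C.H | a.1 ∈ T} → S ⊆ T :=
      fun S T hS h a ha => (Set.ext_iff.1 h
        ⟨a, HCover.not_mem_of_leg (X.isEdgeSet_removed ι) (hS.legs ha)⟩).1 ha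
    exact fun S hS T hT h => (key S T hS h).antisymm (key T S hT h.symm)
  · intro S hS
    refine ⟨_, HCover.IsBunch.of_contract (hF := X.isEdgeSet_removed ι) hS, ?_⟩
    ext a
    exact ⟨fun ⟨_, h⟩ => h, fun h => ⟨a.2, h⟩⟩

/-- The sum of the expansions of `X` at all bunches. -/
noncomputable def bunchChain (B : Set (Fin n)) (s : ℕ) (X : LabelledHCover g n k) :
    (Theta g n).Chains (k + 1) :=
  ∑ᶠ S ∈ {S | X.IsBunch B s S}, X.expansionChain S

theorem bunchChain_eq_of_iso (hB : BunchType g n B s) {X X' : LabelledHCover g n k}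
    (f : Iso X' X) : X'.bunchChain B s = X.bunchChain B s := by
  refine (finsum_mem_eq_of_bijOn (fun S => f.ψ.eH ⁻¹' S) ⟨?_, ?_, ?_⟩ ?_).symm
  · exact fun S hS => IsBunch.preimage f hS
  · exact (Set.preimage_injective.2 f.ψ.eH.surjective).injOn
  · intro S hS
    refine ⟨f.ψ.eH.symm ⁻¹' S, IsBunch.preimage f.symm hS, ?_⟩
    change f.ψ.eH ⁻¹' (f.ψ.eH.symm ⁻¹' S) = S
    ext a
    simp
  · exact fun S hS => (expansionChain_preimage hB.unique hS (hB.nonempty hS) f).symm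

theorem expansionChain_face_perm (hB : BunchType g n B s) {X : LabelledHCover g n k}
    {S : Set X.C.H} (hS : X.IsBunch B s S) (ρ : Equiv.Perm (Fin k)) :
    (X.face ρ.toEmbedding).expansionChain {a | a.1 ∈ S} =
      ((ρ.sign : ℤ) : ℚ) • X.expansionChain S := by
  by_cases h : ∃ Y, X.IsExpansion S Y
  · obtain ⟨Y, h⟩ := h
    have hS' : (X.face ρ.toEmbedding).IsBunch B s {a | a.1 ∈ S} :=
      HCover.IsBunch.contract hS (X.isEdgeSet_removed _)
    rw [h.chain_eq hB.unique hS (hB.nonempty hS),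
      (h.face_perm ρ).chain_eq hB.unique hS' (hB.nonempty hS'), ← pull_simplex,
      SymmDeltaComplex.chain_pull_perm, sign_extendPerm]
  · rw [expansionChain_eq_zero h, smul_zero, expansionChain_eq_zero]
    rintro ⟨Y, h'⟩
    exact h h'.exists_of_face_perm

theorem bunchChain_face (X : LabelledHCover g n l) (ι : Fin k ↪ Fin l) :
    (X.face ι).bunchChain B s =
      ∑ᶠ S ∈ {S | X.IsBunch B s S}, (X.face ι).expansionChain {a | a.1 ∈ S} :=
  (finsum_mem_eq_of_bijOn _ (bijOn_isBunch_face X ι) fun _ _ => rfl).symm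

theorem bunchChain_face_perm (hB : BunchType g n B s) (X : LabelledHCover g n k)
    (ρ : Equiv.Perm (Fin k)) :
    (X.face ρ.toEmbedding).bunchChain B s = ((ρ.sign : ℤ) : ℚ) • X.bunchChain B s := by
  rw [bunchChain_face, bunchChain, smul_finsum_mem (Set.toFinite _)]
  exact finsum_mem_congr rfl fun S hS => expansionChain_face_perm hB hS ρ

/-- The operator on chains that expands the bunches in all possible ways. -/
noncomputable def expandChains (hB : BunchType g n B s) (k : ℕ) :
    (Theta g n).Chains k →ₗ[ℚ] (Theta g n).Chains (k + 1) :=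
  (Theta g n).liftChains (fun x => (exists_simplex x).choose.bunchChain B s) (by
    intro x ρ
    obtain ⟨e⟩ := simplex_eq_iff.1
      ((exists_simplex ((Theta g n).pull ρ.toEmbedding x)).choose_spec.trans
        ((congrArg _ (exists_simplex x).choose_spec.symm).trans (pull_simplex _ _)))
    exact (bunchChain_eq_of_iso hB e).trans (bunchChain_face_perm hB _ ρ))

theorem expandChains_chain (hB : BunchType g n B s) (X : LabelledHCover g n k) :
    expandChains hB k ((Theta g n).chain X.simplex) = X.bunchChain B s := by
  obtain ⟨e⟩ := simplex_eq_iff.1 (exists_simplex X.simplex).choose_spec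
  exact ((Theta g n).liftChains_chain _ _ _).trans (bunchChain_eq_of_iso hB e)

/-- The number of edges that end in a fan whose legs form a bunch. -/
noncomputable def fanCount (B : Set (Fin n)) (s : ℕ) (k : ℕ) (x : (Theta g n).simplices k) : ℕ :=
  {i | ∃ X : LabelledHCover g n k, X.simplex = x ∧ ∃ S, X.IsBunch B s S ∧ X.Fan i S}.ncard

theorem fanCount_le (x : (Theta g n).simplices k) : fanCount B s k x ≤ k :=
  (Set.ncard_le_ncard (Set.subset_univ _)).trans (by rw [Set.ncard_univ, Nat.card_fin])

theorem fanCount_simplex (X : LabelledHCover g n k) :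
    fanCount B s k X.simplex = {i | ∃ S, X.IsBunch B s S ∧ X.Fan i S}.ncard := by
  unfold fanCount
  congr 1
  ext i
  constructor
  · rintro ⟨Y, hY, S, hS, hf⟩
    obtain ⟨e⟩ := simplex_eq_iff.1 hY
    exact ⟨_, IsBunch.preimage e.symm hS, hf.preimage e.symm⟩
  · exact fun h => ⟨X, rfl, h⟩

/-- A fan of a face is a fan of an expansion of the face, and the new edge ends in one more fan. -/
theorem IsExpansion.fan_succ {X : LabelledHCover g n k} {S T : Set X.C.H}
    {Y : LabelledHCover g n (k + 1)} (h : X.IsExpansion S Y) (hS : X.IsBunch B s S)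
    (hT : X.IsBunch B s T) (hST : S ≠ T) {i : Fin k} (hf : X.Fan i T) :
    ∃ U, Y.IsBunch B s U ∧ Y.Fan i.succ U := by
  obtain ⟨e, he⟩ := h
  refine ⟨_, IsExpansion.isBunch hT e, he.of_face (hf.preimage e) fun hsub => hST ?_⟩
  refine Set.eq_of_subset_of_ncard_le (fun a ha => ?_) (hT.ncard_eq.trans hS.ncard_eq.symm).le
  obtain ⟨⟨b, hb⟩, rfl⟩ := e.ψ.eH.surjective a
  obtain ⟨_, h⟩ := hsub ⟨hb, ha⟩
  exact h

/-- If contracting an edge makes `S` expandable, and this edge does not end in the fan of a bunch,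
then the expansion has the fans of `X` and one more. -/
theorem fanCount_lt_of_isExpansion {X : LabelledHCover g n (k + 1)} {S : Set X.C.H}
    (hS : X.IsBunch B s S) (hf : ∀ i, ¬ X.Fan i S) {j : Fin (k + 1)}
    (hj : ∀ T, X.IsBunch B s T → ¬ X.Fan j T) {Y : LabelledHCover g n (k + 1)}
    (h : (X.face j.succAboveEmb).IsExpansion {a | a.1 ∈ S} Y) :
    fanCount B s (k + 1) X.simplex < fanCount B s (k + 1) Y.simplex := by
  rw [fanCount_simplex, fanCount_simplex]
  have hS' : (X.face j.succAboveEmb).IsBunch B s {a | a.1 ∈ S} :=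
    HCover.IsBunch.contract hS (X.isEdgeSet_removed _)
  have hX : {i | ∃ T, X.IsBunch B s T ∧ X.Fan i T} ⊆
      j.succAbove '' {i | ∃ T, X.IsBunch B s T ∧ X.Fan (j.succAbove i) T} := by
    rintro i ⟨T, hT, hi⟩
    obtain ⟨i, rfl⟩ := Fin.exists_succAbove_eq (x := i) (y := j) (by rintro rfl; exact hj T hT hi)
    exact ⟨i, ⟨T, hT, hi⟩, rfl⟩
  have hY : insert 0 (Fin.succ '' {i | ∃ T, X.IsBunch B s T ∧ X.Fan (j.succAbove i) T}) ⊆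
      {i | ∃ T, Y.IsBunch B s T ∧ Y.Fan i T} := by
    rintro _ (rfl | ⟨i, ⟨T, hT, hi⟩, rfl⟩)
    · obtain ⟨e, he⟩ := h
      exact ⟨_, IsExpansion.isBunch hS' e, he⟩
    · have hT' : (X.face j.succAboveEmb).IsBunch B s {a | a.1 ∈ T} :=
        HCover.IsBunch.contract hT (X.isEdgeSet_removed _)
      refine h.fan_succ hS' hT' (fun hST => ?_) (hi.face (ι := j.succAboveEmb) rfl)
      exact hf _ ((bijOn_isBunch_face X _).injOn hS hT hST ▸ hi)
  have h1 := Set.ncard_le_ncard hX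
  have h2 := Set.ncard_le_ncard hY
  rw [Set.ncard_image_of_injective _ Fin.succAbove_right_injective] at h1
  rw [Set.ncard_insert_of_notMem (by simp), Set.ncard_image_of_injective _
    (Fin.succ_injective _)] at h2
  omega

end LabelledHCover

/-! ### Acyclicity from bunches -/

theorem exists_nat_sum_sub_mem {R M ι : Type*} [Ring R] [AddCommGroup M] [Module R M]
    (N : Submodule R M) (c : M) (t : Finset ι) (f : ι → M)
    (h : ∀ i ∈ t, ∃ m : ℕ, f i - (m : R) • c ∈ N)
    (hp : ∃ i ∈ t, ∃ m : ℕ, 0 < m ∧ f i - (m : R) • c ∈ N) :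
    ∃ m : ℕ, 0 < m ∧ ∑ i ∈ t, f i - (m : R) • c ∈ N := by
  classical
  obtain ⟨i₀, hi₀, m₀, hm₀, h₀⟩ := hp
  choose! m hm using h
  refine ⟨m₀ + ∑ i ∈ t.erase i₀, m i, by omega, ?_⟩
  rw [← Finset.add_sum_erase t f hi₀, Nat.cast_add, Nat.cast_sum, add_smul, Finset.sum_smul,
    add_sub_add_comm, ← Finset.sum_sub_distrib]
  exact N.add_mem h₀ (N.sum_mem fun i hi => hm i (Finset.mem_of_mem_erase hi))

namespace LabelledHCover

variable {g n k l s : ℕ} {B : Set (Fin n)}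

/-- If the legs of `S` come together after the contraction of an edge, although they neither form a
fan nor can be expanded, and if the edge ends in a fan with legs `T`, then `S` and `T` come to the
same vertex. -/
theorem exists_subset_star_of_fan (hB : BunchType g n B s) {X : LabelledHCover g n (k + 1)}
    {S T : Set X.C.H} (hS : X.IsBunch B s S) (hf : ∀ i, ¬ X.Fan i S)
    (hX : ¬ ∃ Y, X.IsExpansion S Y) {j : Fin (k + 1)} (hT : X.Fan j T)
    {Y : LabelledHCover g n (k + 1)}
    (h : (X.face j.succAboveEmb).IsExpansion {a | a.1 ∈ S} Y) :
    ∃ v, {a : (X.face j.succAboveEmb).C.H | a.1 ∈ S} ⊆ (X.face j.succAboveEmb).C.star v ∧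
      {a : (X.face j.succAboveEmb).C.H | a.1 ∈ T} ⊆ (X.face j.succAboveEmb).C.star v := by
  obtain ⟨v, hv⟩ := h.exists_subset_star
  obtain ⟨b, hbω, hb, -⟩ := hT
  have hF : X.removed j.succAboveEmb = {b, X.C.i b} :=
    (X.removed_succAboveEmb j).trans (X.ω_eq_pair hbω)
  refine ⟨v, hv, ?_⟩
  have hvb : v = Quot.mk _ (X.C.r b) := by
    by_contra hne
    -- otherwise the legs of `S` have a common root away from the contracted edge
    have hroot : ∀ a ∈ {a : (X.face j.succAboveEmb).C.H | a.1 ∈ S}, ∀ c ∈ X.removed j.succAboveEmb,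
        X.C.r c ≠ X.C.r a.1 := by
      intro a ha c hc hr
      refine hne ((show _ = v from hv ha).symm.trans (HEGraph.mk_eq_iff.2 ?_))
      rw [← hr]
      rw [hF] at hc ⊢
      rcases hc with rfl | hc
      · exact HEGraph.Conn.refl _
      · rw [Set.mem_singleton_iff.1 hc]
        exact (HEGraph.Conn.step (Or.inl rfl)).symm
    have hmem : ∀ a ∈ S, a ∉ X.removed j.succAboveEmb := fun a ha =>
      HCover.not_mem_of_leg (X.isEdgeSet_removed _) (hS.legs ha)
    have hc : X.Coherent S := by
      have := HCover.Coherent.of_contract (hF := X.isEdgeSet_removed _) h.coherent hroot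
      refine (congrArg (fun S => X.Coherent S) ?_).mp this
      ext a
      exact ⟨fun ⟨_, h⟩ => h, fun h => ⟨hmem a h, h⟩⟩
    obtain ⟨c, hcS⟩ := hB.nonempty hS
    have ht : X.Together S := by
      refine ⟨⟨X.C.r c, fun a ha => ?_⟩, hc⟩
      have h1 : X.C.Conn (X.removed j.succAboveEmb) (X.C.r c) (X.C.r a) := HEGraph.mk_eq_iff.1
        ((show _ = v from hv (show ⟨c, hmem c hcS⟩ ∈ _ from hcS)).trans
          (show _ = v from hv (show ⟨a, hmem a ha⟩ ∈ _ from ha)).symm)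
      exact h1.eq_of_root_ne (X.isEdgeSet_removed _) (hroot ⟨c, hmem c hcS⟩ hcS)
    rcases hB.fan_or_isExpansion hS ht with ⟨i, hi⟩ | hi
    · exact hf i hi
    · exact hX hi
  intro a ha
  rw [hvb]
  exact congrArg (Quot.mk _) (hb.root_eq_iff.2 (Or.inr ha))

/-- Contracting the edge of a fan and expanding the fan again only moves the label of the edge to
`0`, which accounts for the sign. -/
theorem expansionChain_face_of_fan (hB : BunchType g n B s) {X : LabelledHCover g n (k + 1)}
    {S : Set X.C.H} (hS : X.IsBunch B s S) {j : Fin (k + 1)} (hf : X.Fan j S) :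
    (X.face j.succAboveEmb).expansionChain {a | a.1 ∈ S} =
      (-1 : ℚ) ^ (j : ℕ) • (Theta g n).chain X.simplex := by
  have hS' : (X.face j.succAboveEmb).IsBunch B s {a | a.1 ∈ S} :=
    HCover.IsBunch.contract hS (X.isEdgeSet_removed _)
  rw [(IsExpansion.of_fan hf).chain_eq hB.unique hS' (hB.nonempty hS'), ← pull_simplex,
    SymmDeltaComplex.chain_pull_perm, Equiv.Perm.sign_symm, Fin.sign_cycleRange]
  simp

/-- The face of the expansion that contracts the new edge is `X`, and the other faces are the
expansions of the faces of `X`, with the opposite sign because of the new label. -/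
theorem boundary_expansionChain (hB : BunchType g n B s) {X : LabelledHCover g n (k + 1)}
    {S : Set X.C.H} (hS : X.IsBunch B s S) (h : ∃ Y, X.IsExpansion S Y) :
    (Theta g n).boundary (k + 1) (X.expansionChain S) = (Theta g n).chain X.simplex -
      ∑ j : Fin (k + 1), (-1 : ℚ) ^ (j : ℕ) •
        (X.face j.succAboveEmb).expansionChain {a | a.1 ∈ S} := by
  obtain ⟨Y, h⟩ := h
  rw [h.chain_eq hB.unique hS (hB.nonempty hS), SymmDeltaComplex.boundary_chain,
    SymmDeltaComplex.facesSum, Fin.sum_univ_succ, sub_eq_add_neg, ← Finset.sum_neg_distrib]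
  congr 1
  · obtain ⟨e, -⟩ := h
    rw [Fin.val_zero, pow_zero, one_smul, pull_simplex, simplex_eq_iff.2 ⟨e⟩]
  · refine Finset.sum_congr rfl fun j _ => ?_
    have hS' : (X.face j.succAboveEmb).IsBunch B s {a | a.1 ∈ S} :=
      HCover.IsBunch.contract hS (X.isEdgeSet_removed _)
    rw [(h.face (ι := j.succAboveEmb) (κ := j.succ.succAboveEmb) (by simp)
      (by simp)).chain_eq hB.unique hS' (hB.nonempty hS'), pull_simplex, Fin.val_succ, pow_succ,
      mul_neg_one, neg_smul]

/-- The contribution of a bunch to `∂h + h∂` on a cover: a multiple of the cover, positive if the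
bunch is together, and covers with more fans. -/
theorem exists_boundary_expansionChain_add (hB : BunchType g n B s) {K : Subfunctor (Theta g n)}
    (hK : ∀ k (X : LabelledHCover g n k) S Y, X.simplex ∈ SymmDeltaComplex.simplicesIn K k →
      X.IsBunch B s S → X.IsExpansion S Y →
        Y.simplex ∈ SymmDeltaComplex.simplicesIn K (k + 1))
    {X : LabelledHCover g n (k + 1)} (hX : X.simplex ∈ SymmDeltaComplex.simplicesIn K (k + 1))
    {S : Set X.C.H} (hS : X.IsBunch B s S) :
    ∃ N : ℕ, (X.Together S → 0 < N) ∧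
      ((Theta g n).boundary (k + 1) (X.expansionChain S) + ∑ j : Fin (k + 1), (-1 : ℚ) ^ (j : ℕ) •
        (X.face j.succAboveEmb).expansionChain {a | a.1 ∈ S}) -
          (N : ℚ) • (Theta g n).chain X.simplex ∈ Submodule.span ℚ ((Theta g n).chain ''
            {y | y ∈ SymmDeltaComplex.simplicesIn K (k + 1) ∧
              fanCount B s (k + 1) X.simplex < fanCount B s (k + 1) y}) := by
  by_cases h : ∃ Y, X.IsExpansion S Y
  · refine ⟨1, fun _ => one_pos, ?_⟩
    rw [boundary_expansionChain hB hS h, sub_add_cancel, Nat.cast_one, one_smul, sub_self]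
    exact Submodule.zero_mem _
  rw [expansionChain_eq_zero h, map_zero, zero_add]
  have hsq : ∀ j : ℕ, (-1 : ℚ) ^ j * (-1) ^ j = 1 := fun j => by rw [← mul_pow]; simp
  have hS' : ∀ j : Fin (k + 1), (X.face j.succAboveEmb).IsBunch B s {a | a.1 ∈ S} := fun j =>
    HCover.IsBunch.contract hS (X.isEdgeSet_removed _)
  by_cases hf : ∃ i, X.Fan i S
  · obtain ⟨i, hi⟩ := hf
    refine ⟨1, fun _ => one_pos, ?_⟩
    rw [Finset.sum_eq_single i]
    · rw [expansionChain_face_of_fan hB hS hi, smul_smul, hsq, Nat.cast_one, sub_self]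
      exact Submodule.zero_mem _
    · intro j _ hj
      rw [expansionChain_eq_zero, smul_zero]
      rintro ⟨Y, hY⟩
      obtain ⟨i, rfl⟩ := Fin.exists_succAbove_eq hj.symm
      exact hY.not_fan (hB.nonempty (hS' j)) i (hi.face rfl)
    · simp
  have hne : ∀ i, ¬ X.Fan i S := not_exists.1 hf
  have key : ∀ j : Fin (k + 1), ∃ m : ℕ, (-1 : ℚ) ^ (j : ℕ) •
      (X.face j.succAboveEmb).expansionChain {a | a.1 ∈ S} -
        (m : ℚ) • (Theta g n).chain X.simplex ∈ Submodule.span ℚ ((Theta g n).chain ''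
            {y | y ∈ SymmDeltaComplex.simplicesIn K (k + 1) ∧
              fanCount B s (k + 1) X.simplex < fanCount B s (k + 1) y}) := by
    intro j
    by_cases hj : ∃ Y, (X.face j.succAboveEmb).IsExpansion {a | a.1 ∈ S} Y
    · obtain ⟨Y, hY⟩ := hj
      by_cases hT : ∃ T, X.IsBunch B s T ∧ X.Fan j T
      · -- the legs of `S` and of the contracted fan are exchanged by an automorphism
        obtain ⟨T, hT, hTf⟩ := hT
        obtain ⟨v, hSv, hTv⟩ := exists_subset_star_of_fan hB hS hne h hTf hY
        have hT' : (X.face j.succAboveEmb).IsBunch B s {a | a.1 ∈ T} :=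
          HCover.IsBunch.contract hT (X.isEdgeSet_removed _)
        obtain ⟨f, hfST⟩ := exists_iso_exchange (hS' j) hT' hSv hTv
        refine ⟨1, ?_⟩
        rw [← expansionChain_preimage hB.unique (hS' j) (hB.nonempty (hS' j)) f, hfST,
          expansionChain_face_of_fan hB hT hTf, smul_smul, hsq, Nat.cast_one, sub_self]
        exact Submodule.zero_mem _
      · refine ⟨0, ?_⟩
        rw [Nat.cast_zero, zero_smul, sub_zero,
          hY.chain_eq hB.unique (hS' j) (hB.nonempty (hS' j))]
        refine Submodule.smul_mem _ _ (Submodule.subset_span ⟨_, ⟨?_, ?_⟩, rfl⟩)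
        · exact hK _ _ _ _ (SymmDeltaComplex.pull_mem K j.succAboveEmb hX) (hS' j) hY
        · exact fanCount_lt_of_isExpansion hS hne
            (fun T hT hTf => absurd ⟨T, hT, hTf⟩ ‹¬ ∃ T, X.IsBunch B s T ∧ X.Fan j T›) hY
    · refine ⟨0, ?_⟩
      rw [expansionChain_eq_zero hj, smul_zero, Nat.cast_zero, zero_smul, sub_zero]
      exact Submodule.zero_mem _
  choose m hm using key
  refine ⟨∑ j, m j, fun ht => ?_, ?_⟩
  · rcases hB.fan_or_isExpansion hS ht with h1 | h1
    · exact absurd h1 hf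
    · exact absurd h1 h
  · rw [Nat.cast_sum, Finset.sum_smul, ← Finset.sum_sub_distrib]
    exact Submodule.sum_mem _ fun j _ => hm j

/-- The contribution of a bunch to `∂h` on a cover without edges. -/
theorem exists_boundary_expansionChain_zero (hB : BunchType g n B s) {X : LabelledHCover g n 0}
    {S : Set X.C.H} (hS : X.IsBunch B s S) :
    ∃ N : ℕ, (X.Together S → 0 < N) ∧ (Theta g n).boundary 0 (X.expansionChain S) =
      (N : ℚ) • (Theta g n).chain X.simplex := by
  by_cases h : ∃ Y, X.IsExpansion S Y
  · obtain ⟨Y, h⟩ := h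
    refine ⟨1, fun _ => one_pos, ?_⟩
    rw [h.chain_eq hB.unique hS (hB.nonempty hS), SymmDeltaComplex.boundary_chain,
      SymmDeltaComplex.facesSum, Fin.sum_univ_succ]
    obtain ⟨e, -⟩ := h
    simp only [Finset.univ_eq_empty, Finset.sum_empty, add_zero, Nat.cast_one, one_smul]
    rw [Fin.val_zero, pow_zero, one_smul, pull_simplex, simplex_eq_iff.2 ⟨e⟩]
  · refine ⟨0, fun ht => ?_, ?_⟩
    · rcases hB.fan_or_isExpansion hS ht with ⟨i, -⟩ | h1
      · exact i.elim0
      · exact absurd h1 h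
    · rw [expansionChain_eq_zero h, map_zero, Nat.cast_zero, zero_smul]

/-- A subcomplex that is closed under expansions at bunches, and in which every cover has a bunch
that is expandable or a fan, is acyclic. -/
theorem acyclicOn_of_bunches (hB : BunchType g n B s) {K : Subfunctor (Theta g n)}
    (hK : ∀ k (X : LabelledHCover g n k) S Y, X.simplex ∈ SymmDeltaComplex.simplicesIn K k →
      X.IsBunch B s S → X.IsExpansion S Y →
        Y.simplex ∈ SymmDeltaComplex.simplicesIn K (k + 1))
    (hT : ∀ k (X : LabelledHCover g n k), X.simplex ∈ SymmDeltaComplex.simplicesIn K k →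
      ∃ S, X.IsBunch B s S ∧ X.Together S) :
    SymmDeltaComplex.AcyclicOn K := by
  refine SymmDeltaComplex.AcyclicOn.of_triangular_homotopy (fanCount B s) (fun k x => fanCount_le x)
    (expandChains hB) ?_ ?_
  · intro k x hx
    obtain ⟨X, rfl⟩ := exists_simplex x
    rw [expandChains_chain, bunchChain, finsum_mem_eq_finite_toFinset_sum _ (Set.toFinite _)]
    refine Submodule.sum_mem _ fun S hS => ?_
    have hS : X.IsBunch B s S := (Set.Finite.mem_toFinset _).1 hS
    by_cases h : ∃ Y, X.IsExpansion S Y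
    · obtain ⟨Y, h⟩ := h
      rw [h.chain_eq hB.unique hS (hB.nonempty hS)]
      exact SymmDeltaComplex.chain_mem_chainsIn (hK k X S Y hx hS h)
    · rw [expansionChain_eq_zero h]
      exact Submodule.zero_mem _
  · intro k x hx
    obtain ⟨X, rfl⟩ := exists_simplex x
    obtain ⟨S₀, hS₀, ht⟩ := hT k X hx
    cases k with
    | zero =>
      have h0 : SymmDeltaComplex.afterBoundary (expandChains hB) 0
          ((Theta g n).chain X.simplex) = 0 := rfl
      rw [h0, add_zero, expandChains_chain, bunchChain,
        finsum_mem_eq_finite_toFinset_sum _ (Set.toFinite _), map_sum]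
      refine exists_nat_sum_sub_mem _ _ _ _ (fun S hS => ?_)
        ⟨S₀, (Set.Finite.mem_toFinset _).2 hS₀, ?_⟩
      · obtain ⟨N, -, hN⟩ :=
          exists_boundary_expansionChain_zero hB ((Set.Finite.mem_toFinset _).1 hS)
        exact ⟨N, by rw [hN, sub_self]; exact Submodule.zero_mem _⟩
      · obtain ⟨N, hN0, hN⟩ := exists_boundary_expansionChain_zero hB hS₀
        exact ⟨N, hN0 ht, by rw [hN, sub_self]; exact Submodule.zero_mem _⟩
    | succ k =>
      have h0 : SymmDeltaComplex.afterBoundary (expandChains hB) (k + 1)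
          ((Theta g n).chain X.simplex) = ∑ j : Fin (k + 1), (-1 : ℚ) ^ (j : ℕ) •
            (X.face j.succAboveEmb).bunchChain B s := by
        change expandChains hB k ((Theta g n).boundary k ((Theta g n).chain X.simplex)) = _
        rw [SymmDeltaComplex.boundary_chain, SymmDeltaComplex.facesSum, map_sum]
        refine Finset.sum_congr rfl fun j _ => ?_
        rw [map_smul, pull_simplex, expandChains_chain]
      simp only [bunchChain_face] at h0
      rw [h0, expandChains_chain, bunchChain]
      simp only [finsum_mem_eq_finite_toFinset_sum _ (Set.toFinite {S | X.IsBunch B s S})]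
      simp only [Finset.smul_sum]
      rw [Finset.sum_comm, map_sum, ← Finset.sum_add_distrib]
      refine exists_nat_sum_sub_mem _ _ _ _ (fun S hS => ?_)
        ⟨S₀, (Set.Finite.mem_toFinset _).2 hS₀, ?_⟩
      · obtain ⟨N, -, hN⟩ := exists_boundary_expansionChain_add hB hK hx
          ((Set.Finite.mem_toFinset _).1 hS)
        exact ⟨N, hN⟩
      · obtain ⟨N, hN0, hN⟩ := exists_boundary_expansionChain_add hB hK hx hS₀
        exact ⟨N, hN0 ht, hN⟩

end LabelledHCover

/-! ### The locus of weight three, and covers with at most one marking -/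

namespace HEGraph

/-- In a tree with an edge, some vertex carries legs and exactly one other half-edge: take an edge
for which the part of the tree behind it is as small as possible. -/
theorem IsTree.exists_star_subset {C : HEGraph} (hC : C.IsTree) (hne : ∃ h, C.i h ≠ h) :
    ∃ h, C.i h ≠ h ∧ C.star (C.r h) ⊆ insert h C.legs := by
  let side : C.H → Set C.V := fun h => {w | C.Conn {h, C.i h}ᶜ (C.r (C.i h)) w}
  obtain ⟨h, hh, hmin⟩ := Set.exists_min_image {h | C.i h ≠ h} (fun h => (side h).ncard)
    (Set.toFinite _) hne
  have hh : C.i h ≠ h := hh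
  refine ⟨C.i h, by rwa [C.i_i, ne_comm], fun a ha => ?_⟩
  have ha : C.r a = C.r (C.i h) := ha
  by_contra hn
  rw [Set.mem_insert_iff, not_or] at hn
  obtain ⟨hn, hleg⟩ := hn
  have hai : C.i a ≠ a := hleg
  have hroot : C.r h ≠ C.r (C.i h) := fun h1 => hC.bridge h hh (h1 ▸ Conn.refl _)
  have hah : a ≠ h := fun h1 => hroot (h1 ▸ ha)
  have hamem : a ∈ ({h, C.i h}ᶜ : Set C.H) := by
    rintro (h1 | h1)
    · exact hah h1
    · exact hn h1
  refine (hmin a hai).not_gt (Set.ncard_lt_ncard ⟨?_, fun hsub => ?_⟩)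
  · intro w hw
    have hstep : C.Conn {h, C.i h}ᶜ (C.r (C.i h)) (C.r (C.i a)) := ha ▸ Conn.step hamem
    -- a path behind `a` does not meet the edge `h`
    have key : C.Conn ({h, C.i h}ᶜ ∩ {a, C.i a}ᶜ) (C.r (C.i a)) w := by
      have hw : C.Conn {a, C.i a}ᶜ (C.r (C.i a)) w := hw
      refine (hw.mem_iff (Z := fun w => C.Conn ({h, C.i h}ᶜ ∩ {a, C.i a}ᶜ) (C.r (C.i a)) w)
        ?_).1 (Conn.refl _)
      have h1 : ¬ C.Conn ({h, C.i h}ᶜ ∩ {a, C.i a}ᶜ) (C.r (C.i a)) (C.r h) := fun hc =>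
        hC.bridge h hh (hstep.trans (hc.mono Set.inter_subset_left)).symm
      have h2 : ¬ C.Conn ({h, C.i h}ᶜ ∩ {a, C.i a}ᶜ) (C.r (C.i a)) (C.r (C.i h)) := fun hc =>
        hC.bridge a hai (ha.symm ▸ (hc.mono Set.inter_subset_right).symm)
      intro b hb
      by_cases hbh : b ∈ ({h, C.i h} : Set C.H)
      · rcases hbh with rfl | rfl
        · exact iff_of_false h1 h2
        · rw [C.i_i]
          exact iff_of_false h2 h1
      · have := Conn.step (C := C) (A := {h, C.i h}ᶜ ∩ {a, C.i a}ᶜ) ⟨hbh, hb⟩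
        exact ⟨fun h => h.trans this, fun h => h.trans this.symm⟩
    exact hstep.trans (key.mono Set.inter_subset_left)
  · have h1 : C.r a ∈ side a := hsub (show C.Conn _ _ _ from ha ▸ Conn.refl _)
    exact hC.bridge a hai (Conn.symm h1)

end HEGraph

namespace HCover

variable {g n : ℕ}

theorem weight_add (X : HCover g n) (v : X.C.V) :
    X.weight v + {j | X.C.r (X.mC j) = v}.ncard = (X.C.star v ∩ X.C.legs).ncard := by
  rw [← Set.ncard_inter_add_ncard_sdiff_eq_ncard (X.C.star v ∩ X.C.legs) (Set.range X.mC), add_comm]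
  congr 1
  · rw [← Set.ncard_image_of_injective _ X.mC_injective]
    congr 1
    ext a
    constructor
    · rintro ⟨j, hj, rfl⟩
      exact ⟨⟨hj, X.mC_leg j⟩, j, rfl⟩
    · rintro ⟨⟨h1, -⟩, j, rfl⟩
      exact ⟨j, h1, rfl⟩
  · unfold weight
    congr 1
    ext a
    exact and_assoc.symm

/-- With at most one marking, some vertex carries at least two unmarked legs. -/
theorem exists_two_le_weight (X : HCover g n) (hg : 2 ≤ g) (hn : n ≤ 1) : ∃ v, 2 ≤ X.weight v := by
  have hmark : ∀ v, {j | X.C.r (X.mC j) = v}.ncard ≤ n := fun v =>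
    (Set.ncard_le_ncard (Set.subset_univ _)).trans (by rw [Set.ncard_univ, Nat.card_fin])
  by_cases hne : ∃ h, X.C.i h ≠ h
  · obtain ⟨h, hh, hst⟩ := X.tree.exists_star_subset hne
    refine ⟨X.C.r h, ?_⟩
    have h1 := X.weight_add (X.C.r h)
    have h2 := X.stable (X.C.r h)
    have h3 : X.C.star (X.C.r h) = insert h (X.C.star (X.C.r h) ∩ X.C.legs) := by
      ext a
      constructor
      · intro ha
        exact (hst ha).imp id fun h => ⟨ha, h⟩
      · rintro (rfl | ha)
        · rfl
        · exact ha.1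
    have h4 : (X.C.star (X.C.r h)).ncard = (X.C.star (X.C.r h) ∩ X.C.legs).ncard + 1 := by
      conv_lhs => rw [h3]
      exact Set.ncard_insert_of_notMem fun h => hh h.2
    have h5 := hmark (X.C.r h)
    have h6 := X.not_weierstrass (X.C.r h)
    by_contra hlt
    exact h6 ⟨by omega, by omega, by omega⟩
  · have hleg : ∀ h, X.C.i h = h := by simpa using hne
    obtain ⟨v⟩ := X.tree.nonempty
    refine ⟨v, ?_⟩
    have h1 := X.weight_add v
    rw [Set.inter_eq_self_of_subset_right (X.tree.legs_subset_star fun a _ => hleg a),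
      X.card_legs] at h1
    have := hmark v
    omega

theorem exists_isBunch_of_le_weight {s : ℕ} (X : HCover g n) {v : X.C.V} (h : s ≤ X.weight v) :
    ∃ S, X.IsBunch ∅ s S ∧ X.Together S := by
  obtain ⟨S, hS, hc⟩ := Set.exists_subset_card_eq h
  have hm : ∀ j, X.mC j ∉ S := fun j hj => (hS hj).2.2 ⟨j, rfl⟩
  refine ⟨S, ⟨fun a ha => (hS ha).2.1, fun j => iff_of_false (hm j) (Set.notMem_empty j), ?_⟩,
    ⟨v, fun a ha => (hS ha).1⟩, fun j k hj => absurd hj (hm j)⟩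
  rw [← hc]
  congr 1
  refine sdiff_eq_left.2 (Set.disjoint_left.2 ?_)
  rintro _ ha ⟨j, rfl⟩
  exact hm j ha

theorem IsBunch.le_weight {s : ℕ} {X : HCover g n} {S : Set X.C.H} (hS : X.IsBunch ∅ s S)
    {v : X.C.V} (hv : S ⊆ X.C.star v) : s ≤ X.weight v := by
  rw [← hS.ncard]
  exact Set.ncard_le_ncard fun a ha => ⟨hv ha.1, hS.legs ha.1, ha.2⟩

end HCover

namespace LabelledHCover

variable {g n k : ℕ}

theorem simplex_mem_thetaWeightThree {X : LabelledHCover g n k} :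
    X.simplex ∈ SymmDeltaComplex.simplicesIn (ThetaWeightThree g n) k ↔ X.HasWeightThree := by
  constructor
  · rintro ⟨Y, hY, h⟩
    obtain ⟨e⟩ := simplex_eq_iff.1 hY
    exact e.hasWeightThree h
  · exact fun h => ⟨X, rfl, h⟩

theorem simplex_mem_thetaRep {X : LabelledHCover g n k} :
    X.simplex ∈ SymmDeltaComplex.simplicesIn (ThetaRep g n) k ↔ X.HasRepeatedMarking := by
  constructor
  · rintro ⟨Y, hY, h⟩
    obtain ⟨e⟩ := simplex_eq_iff.1 hY
    exact e.hasRepeatedMarking h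
  · exact fun h => ⟨X, rfl, h⟩

/-- Expanding bunches of three unmarked legs. -/
theorem acyclicOn_thetaWeightThree (hg : 2 ≤ g) :
    SymmDeltaComplex.AcyclicOn (ThetaWeightThree g n) := by
  have hB : BunchType g n ∅ 3 := ⟨Or.inr (Or.inl (by decide)), Or.inr rfl, by simp, by simp; omega⟩
  refine acyclicOn_of_bunches hB ?_ ?_
  · rintro k X S Y - hS ⟨e, b, -, hb, -⟩
    exact simplex_mem_thetaWeightThree.2 ⟨_, (IsExpansion.isBunch hS e).le_weight
      fun a ha => hb.root_eq_iff.2 (Or.inr ha)⟩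
  · intro k X hX
    obtain ⟨v, hv⟩ := simplex_mem_thetaWeightThree.1 hX
    exact X.exists_isBunch_of_le_weight hv

/-- Expanding pairs of unmarked legs. -/
theorem acyclicOn_top (hg : 2 ≤ g) (hn : n ≤ 1) :
    SymmDeltaComplex.AcyclicOn (⊤ : Subfunctor (Theta g n)) := by
  have hB : BunchType g n ∅ 2 := ⟨Or.inr (Or.inr hn), Or.inr rfl, by simp, by simp; omega⟩
  refine acyclicOn_of_bunches hB (fun _ _ _ _ _ _ _ => trivial) fun k X _ => ?_
  obtain ⟨v, hv⟩ := X.exists_two_le_weight hg hn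
  exact X.exists_isBunch_of_le_weight hv

/-! ### The repeated marking locus -/

/-- The covers for which the markings of every pair in `R` are supported by one vertex of the
source. -/
noncomputable def coincidence (g : ℕ) {n : ℕ} (R : Set (Fin n × Fin n)) :
    Subfunctor (Theta g n) where
  obj a := {x | ∃ X : LabelledHCover g n a.unop.card, X.simplex = x ∧
    ∀ p ∈ R, X.P.r (X.mP p.1) = X.P.r (X.mP p.2)}
  map f := by
    rintro _ ⟨X, rfl, hX⟩
    exact ⟨X.face f.unop, rfl, fun p hp => congrArg (Quot.mk _) (hX p hp)⟩

theorem simplex_mem_coincidence {R : Set (Fin n × Fin n)} {X : LabelledHCover g n k} :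
    X.simplex ∈ SymmDeltaComplex.simplicesIn (coincidence g R) k ↔
      ∀ p ∈ R, X.P.r (X.mP p.1) = X.P.r (X.mP p.2) := by
  constructor
  · rintro ⟨Y, hY, h⟩ p hp
    obtain ⟨e⟩ := simplex_eq_iff.1 hY
    rw [← e.map_mP, ← e.map_mP, e.φ.root_eq_iff, h p hp]
  · exact fun h => ⟨X, rfl, h⟩

theorem subfunctor_ext {K L : Subfunctor (Theta g n)} (h : ∀ k (X : LabelledHCover g n k),
    X.simplex ∈ SymmDeltaComplex.simplicesIn K k ↔ X.simplex ∈ SymmDeltaComplex.simplicesIn L k) :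
    K = L := by
  ext a x
  obtain ⟨X, rfl⟩ := exists_simplex (k := a.unop.card) x
  exact h _ X

theorem coincidence_inf (R R' : Set (Fin n × Fin n)) :
    coincidence g R ⊓ coincidence g R' = coincidence g (R ∪ R') := by
  refine subfunctor_ext fun k X => ?_
  rw [simplex_mem_coincidence]
  refine (and_congr simplex_mem_coincidence simplex_mem_coincidence).trans ?_
  exact ⟨fun h p hp => hp.elim (h.1 p) (h.2 p),
    fun h => ⟨fun p hp => h p (Or.inl hp), fun p hp => h p (Or.inr hp)⟩⟩

theorem thetaRep_eq : ThetaRep g n =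
    ⨆ p ∈ (Finset.univ.filter fun p : Fin n × Fin n => p.1 ≠ p.2), coincidence g {p} := by
  refine subfunctor_ext fun k X => ?_
  rw [simplex_mem_thetaRep]
  unfold SymmDeltaComplex.simplicesIn
  simp only [Subfunctor.iSup_obj, Set.mem_iUnion]
  constructor
  · rintro ⟨x, j, l, hjl, hj, hl⟩
    refine ⟨(j, l), by simpa using hjl, simplex_mem_coincidence.2 ?_⟩
    rintro _ rfl
    exact hj.trans hl.symm
  · rintro ⟨p, hp, h⟩
    exact ⟨_, p.1, p.2, (Finset.mem_filter.1 hp).2, simplex_mem_coincidence.1 h p rfl, rfl⟩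

/-- Expanding a bunch of marked legs does not separate other markings in the source.  Their roots in
the target do not change, and such a root is ramified in the expansion if it was so before, because
all half-edges of the fan have trivial monodromy. -/
theorem IsExpansion.root_eq_of_notMem {B : Set (Fin n)} {X : LabelledHCover g n k} {S : Set X.C.H}
    (hS : X.IsBunch B 0 S) {Y : LabelledHCover g n (k + 1)} (h : X.IsExpansion S Y) {a b : Fin n}
    (ha : a ∉ B) (hb : b ∉ B) (hab : X.P.r (X.mP a) = X.P.r (X.mP b)) :
    Y.P.r (Y.mP a) = Y.P.r (Y.mP b) := by
  obtain ⟨e, c, hcω, hc, -⟩ := h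
  have hT := IsExpansion.isBunch hS e
  have hF : Y.removed (0 : Fin (k + 1)).succAboveEmb = {c, Y.C.i c} :=
    (Y.removed_succAboveEmb 0).trans (Y.ω_eq_pair hcω)
  have hroot : ∀ j, j ∉ B → Y.C.r (Y.mC j) ≠ Y.C.r c := by
    intro j hj hr
    rcases hc.root_eq_iff.1 hr with h1 | h1
    · exact hc.ne (h1 ▸ Y.mC_leg j)
    · exact hj ((hT.mem_iff j).1 h1)
  have h1 : (Y.face (0 : Fin (k + 1)).succAboveEmb).P.r
      ((Y.face (0 : Fin (k + 1)).succAboveEmb).mP a) =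
      (Y.face (0 : Fin (k + 1)).succAboveEmb).P.r
      ((Y.face (0 : Fin (k + 1)).succAboveEmb).mP b) := by
    rw [← e.symm.map_mP, ← e.symm.map_mP, e.symm.φ.root_eq_iff, hab]
  have hC : Y.C.Conn (Y.removed (0 : Fin (k + 1)).succAboveEmb) (Y.C.r (Y.mC a))
      (Y.C.r (Y.mC b)) := by
    have : Y.C.Conn (Y.removed (0 : Fin (k + 1)).succAboveEmb) (Y.fV (Y.P.r (Y.mP a)))
      (Y.fV (Y.P.r (Y.mP b))) := Y.conn_proj (HEGraph.mk_eq_iff.1 h1)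
    rwa [Y.f_r, Y.f_r, Y.f_mP, Y.f_mP] at this
  have hCr : Y.C.r (Y.mC a) = Y.C.r (Y.mC b) :=
    hc.eq_iff.2 ⟨hF ▸ hC, iff_of_false (hroot a ha) (hroot b hb)⟩
  obtain ⟨u⟩ := Y.exists_section
  rw [u.root_eq_iff (by rw [Y.f_mP, Y.f_mP, hCr]), Y.f_mP, Y.f_mP]
  have h2 := ((u.contract (Y.isEdgeSet_removed _)).root_eq_iff
    (k := (Y.face (0 : Fin (k + 1)).succAboveEmb).mP a)
    (l := (Y.face (0 : Fin (k + 1)).succAboveEmb).mP b) (HEGraph.mk_eq_iff.2 (by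
      change Y.C.Conn _ (Y.C.r (Y.fH (Y.mP a))) (Y.C.r (Y.fH (Y.mP b)))
      rwa [Y.f_mP, Y.f_mP]))).1 h1
  refine h2.imp ?_ fun h3 => ?_
  · rintro ⟨⟨d, hd⟩, hdr, hd1⟩
    have hd1 : Y.μ d = 1 := hd1
    have hdr : Y.C.Conn (Y.removed (0 : Fin (k + 1)).succAboveEmb) (Y.C.r d)
        (Y.C.r (Y.mC a)) := by
      have : Y.C.Conn (Y.removed (0 : Fin (k + 1)).succAboveEmb) (Y.C.r d)
        (Y.C.r (Y.fH (Y.mP a))) := HEGraph.mk_eq_iff.1 hdr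
      rwa [Y.f_mP] at this
    refine ⟨d, hc.eq_iff.2 ⟨hF ▸ hdr, iff_of_false (fun h3 => ?_) (hroot a ha)⟩, hd1⟩
    rcases hc.root_eq_iff.1 h3 with rfl | h3
    · exact hd (hF ▸ Or.inl rfl)
    · have h4 := hT.ncard
      rw [Set.ncard_eq_zero, Set.sdiff_eq_empty] at h4
      obtain ⟨j, rfl⟩ := h4 h3
      rw [Y.μ_marked] at hd1
      exact zero_ne_one hd1
  · have h4 : ∀ j, (Y.mP j = u.s (Y.mC j) ↔ (Y.face (0 : Fin (k + 1)).succAboveEmb).mP j =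
        (u.contract (Y.isEdgeSet_removed _)).s ((Y.face (0 : Fin (k + 1)).succAboveEmb).fH
          ((Y.face (0 : Fin (k + 1)).succAboveEmb).mP j))) := by
      intro j
      refine Iff.trans ?_ Subtype.ext_iff.symm
      change _ ↔ Y.mP j = u.s (Y.fH (Y.mP j))
      rw [Y.f_mP]
    exact (h4 a).trans (h3.trans (h4 b).symm)

/-- Expanding a bunch of marked legs leaves the unmarked legs at their vertices. -/
theorem IsExpansion.hasWeightThree {B : Set (Fin n)} {X : LabelledHCover g n k} {S : Set X.C.H}
    (hS : X.IsBunch B 0 S) {Y : LabelledHCover g n (k + 1)} (h : X.IsExpansion S Y)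
    (hX : X.HasWeightThree) : Y.HasWeightThree := by
  obtain ⟨e, c, hcω, hc, -⟩ := h
  have hT := IsExpansion.isBunch hS e
  have hF : Y.removed (0 : Fin (k + 1)).succAboveEmb = {c, Y.C.i c} :=
    (Y.removed_succAboveEmb 0).trans (Y.ω_eq_pair hcω)
  obtain ⟨v, hv⟩ := e.symm.hasWeightThree hX
  have hleg : ∀ d : (Y.face (0 : Fin (k + 1)).succAboveEmb).C.H,
      d ∈ (Y.face (0 : Fin (k + 1)).succAboveEmb).C.legs →
      d ∉ Set.range (Y.face (0 : Fin (k + 1)).succAboveEmb).mC →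
      d.1 ∈ Y.C.legs ∧ d.1 ∉ Set.range Y.mC ∧ Y.C.r d.1 ≠ Y.C.r c := by
    intro d hd hdm
    have hdm' : d.1 ∉ Set.range Y.mC := fun ⟨j, hj⟩ => hdm ⟨j, Subtype.ext hj⟩
    refine ⟨congrArg Subtype.val hd, hdm', fun h3 => ?_⟩
    rcases hc.root_eq_iff.1 h3 with h3 | h3
    · exact d.2 ((congrArg (d.1 ∈ ·) hF).mpr (Or.inl h3))
    · have h4 := hT.ncard
      rw [Set.ncard_eq_zero, Set.sdiff_eq_empty] at h4
      exact hdm' (h4 h3)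
  obtain ⟨d, hd⟩ := Set.nonempty_of_ncard_ne_zero (show HCover.weight _ v ≠ 0 by omega)
  refine ⟨Y.C.r d.1, hv.trans ((Set.ncard_image_of_injective _
    Subtype.val_injective).symm.trans_le (Set.ncard_le_ncard ?_))⟩
  rintro _ ⟨a, ha, rfl⟩
  have h1 := hleg a ha.2.1 ha.2.2
  have h2 := hleg d hd.2.1 hd.2.2
  refine ⟨hc.eq_iff.2 ⟨hF ▸ HEGraph.mk_eq_iff.1 (ha.1.trans hd.1.symm),
    iff_of_false h1.2.2 h2.2.2⟩, h1.1, h1.2.1⟩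

/-- Expanding the bunch of all markings that the coincidences put together with a given one. -/
theorem acyclicOn_coincidence_inf (hg : 2 ≤ g) {R : Set (Fin n × Fin n)}
    (hR : ∃ p ∈ R, p.1 ≠ p.2) {K : Subfunctor (Theta g n)}
    (hK : ∀ k (X : LabelledHCover g n k) B S Y, X.simplex ∈ SymmDeltaComplex.simplicesIn K k →
      X.IsBunch B 0 S → X.IsExpansion S Y →
        Y.simplex ∈ SymmDeltaComplex.simplicesIn K (k + 1)) :
    SymmDeltaComplex.AcyclicOn (coincidence g R ⊓ K) := by
  obtain ⟨⟨j, l⟩, hp, hjl⟩ := hR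
  let r : Fin n → Fin n → Prop := fun a b => (a, b) ∈ R
  let B : Set (Fin n) := {a | Relation.EqvGen r j a}
  have hBn : B.ncard ≤ n :=
    (Set.ncard_le_ncard (Set.subset_univ _)).trans (by rw [Set.ncard_univ, Nat.card_fin])
  have hB2 : 2 ≤ B.ncard := by
    rw [← Set.ncard_pair hjl]
    refine Set.ncard_le_ncard ?_
    rintro _ (rfl | rfl)
    · exact Relation.EqvGen.refl _
    · exact Relation.EqvGen.rel _ _ hp
  have hB : BunchType g n B 0 := ⟨Or.inl rfl, Or.inl rfl, hB2, by omega⟩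
  have hr : ∀ p ∈ R, (p.1 ∈ B ↔ p.2 ∈ B) := fun p hp =>
    ⟨fun h => h.trans _ _ _ (Relation.EqvGen.rel _ _ hp),
      fun h => h.trans _ _ _ (Relation.EqvGen.rel _ _ hp).symm⟩
  refine acyclicOn_of_bunches hB ?_ ?_
  · rintro k X S Y ⟨h1, h2⟩ hS hY
    refine ⟨simplex_mem_coincidence.2 fun p hp => ?_, hK k X B S Y h2 hS hY⟩
    by_cases hpB : p.1 ∈ B
    · obtain ⟨e, c, -, -, hc⟩ := hY
      have hT := IsExpansion.isBunch hS e
      exact hc _ _ ((hT.mem_iff _).2 hpB) ((hT.mem_iff _).2 ((hr p hp).1 hpB))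
    · exact hY.root_eq_of_notMem hS hpB (mt (hr p hp).2 hpB) (simplex_mem_coincidence.1 h1 p hp)
  · rintro k X ⟨hX, -⟩
    have hX := simplex_mem_coincidence.1 hX
    have hab : ∀ a b, Relation.EqvGen r a b → X.P.r (X.mP a) = X.P.r (X.mP b) := by
      intro a b h
      induction h with
      | rel a b h => exact hX _ h
      | refl => rfl
      | symm a b _ ih => exact ih.symm
      | trans a b c _ _ ih ih' => exact ih.trans ih'
    have hjB : ∀ a ∈ B, X.P.r (X.mP j) = X.P.r (X.mP a) := fun a ha => hab j a ha
    refine ⟨X.mC '' B, ⟨?_, fun a => X.mC_injective.mem_set_image, ?_⟩,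
      ⟨X.C.r (X.mC j), ?_⟩, ?_⟩
    · rintro _ ⟨a, -, rfl⟩
      exact X.mC_leg a
    · rw [Set.sdiff_eq_empty.2 (Set.image_subset_range _ _), Set.ncard_empty]
    · rintro _ ⟨a, ha, rfl⟩
      have := congrArg X.fV (hjB a ha)
      rw [X.f_r, X.f_r, X.f_mP, X.f_mP] at this
      exact this.symm
    · intro a b ha hb
      exact (hjB a (X.mC_injective.mem_set_image.1 ha)).symm.trans
        (hjB b (X.mC_injective.mem_set_image.1 hb))

/-- The repeated marking locus is the union of the loci where two given markings coincide. -/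
theorem acyclicOn_thetaRep_inf (hg : 2 ≤ g) {K : Subfunctor (Theta g n)}
    (hK : ∀ k (X : LabelledHCover g n k) B S Y, X.simplex ∈ SymmDeltaComplex.simplicesIn K k →
      X.IsBunch B 0 S → X.IsExpansion S Y →
        Y.simplex ∈ SymmDeltaComplex.simplicesIn K (k + 1)) :
    SymmDeltaComplex.AcyclicOn (ThetaRep g n ⊓ K) := by
  rw [thetaRep_eq]
  simp only [Subfunctor.iSup_min]
  refine SymmDeltaComplex.acyclicOn_biSup
    (𝓕 := {L | ∃ R : Set (Fin n × Fin n), (∃ p ∈ R, p.1 ≠ p.2) ∧ L = coincidence g R ⊓ K}) ?_ ?_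
    _ _ fun p hp => ⟨{p}, ⟨p, rfl, (Finset.mem_filter.1 hp).2⟩, rfl⟩
  · rintro _ ⟨R, ⟨p, hp, hne⟩, rfl⟩ _ ⟨R', -, rfl⟩
    refine ⟨R ∪ R', ⟨p, Or.inl hp, hne⟩, ?_⟩
    rw [← coincidence_inf, inf_inf_inf_comm, inf_idem]
  · rintro _ ⟨R, hR, rfl⟩
    exact acyclicOn_coincidence_inf hg hR hK

end LabelledHCover

theorem mainTheorem5 (g n : ℕ) (hg : 2 ≤ g) :
    (∀ k : ℕ, Limits.IsZero
      (SymmDeltaComplex.reducedHomology (ThetaRep g n).toFunctor k)) ∧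
    (∀ k : ℕ, Limits.IsZero
      (SymmDeltaComplex.reducedHomology (ThetaWeightThree g n).toFunctor k)) ∧
    (∀ k : ℕ, Limits.IsZero
      (SymmDeltaComplex.reducedHomology (ThetaRep g n ⊓ ThetaWeightThree g n).toFunctor k)) ∧
    (n ≤ 1 → (SymmDeltaComplex.cellularChainComplex (Theta g n)).Acyclic) := by
  refine ⟨?_, ?_, ?_, fun hn => (LabelledHCover.acyclicOn_top hg hn).acyclic⟩
  · have h := LabelledHCover.acyclicOn_thetaRep_inf (g := g) (n := n) hg (K := ⊤)
      (fun _ _ _ _ _ _ _ _ => trivial)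
    rw [inf_top_eq] at h
    exact h.isZero_reducedHomology
  · exact (LabelledHCover.acyclicOn_thetaWeightThree hg).isZero_reducedHomology
  · refine (LabelledHCover.acyclicOn_thetaRep_inf hg fun k X B S Y hX hS hY => ?_
      ).isZero_reducedHomology
    exact LabelledHCover.simplex_mem_thetaWeightThree.2
      (hY.hasWeightThree hS (LabelledHCover.simplex_mem_thetaWeightThree.1 hX))
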